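/- Let $d_1,d_2\ge 1$, $p\in[1,\infty]$ and let $K\in C^\infty(\mathbf R^{d_2}\times\mathbf R^{d_1})$ be complex-valued. Below, $(f_{1,j}\otimes f_{2,j})(x_2,x_1)=f_{1,j}(x_1)f_{2,j}(x_2)$ for $(x_2,x_1)\in\mathbf R^{d_2}\times\mathbf R^{d_1}$, derivatives $D^\beta$ are taken in the sense of distributions, and $\|x^\alpha D^\beta f\|_{L^p}=\infty$ if $D^\beta f$ is not a locally integrable function or $x^\alpha D^\beta f\notin L^p$. Consider, for a given $N$, the conditions $$ \sup_{j\ge 1}\big(j^N\lambda_j\big)<\infty\quad\text{and}\quad \sup_{j\ge 1}\big(j^N\|x^\alpha D^\beta f_{k,j}\|_{L^p(\mathbf R^{d_k})}\big)<\infty \quad\text{for } k=1,2 \text{ and all multi-indices } \alpha,\beta\in\mathbf N^{d_k}. \tag{$*$} $$ (1) If $K\in\mathscr S(\mathbf R^{d_2}\times\mathbf R^{d_1})$, then there are numbers $\lambda_j\ge 0$ and functions $f_{k,j}\in\mathscr S(\mathbf R^{d_k})\setminus\{0\}$, $j\ge 1$, $k=1,2$, such that for each $k$ the sequence $\{f_{k,j}\}_{j\ge1}$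 is orthogonal in $L^2(\mathbf R^{d_k})$ (not necessarily normalized), such that $$K=\sum_{j=1}^\infty\lambda_j\, f_{1,j}\otimes f_{2,j}$$ with unconditional convergence at every point and convergence in $L^2(\mathbf R^{d_2}\times\mathbf R^{d_1})$, and such that $(*)$ holds for every integer $N\ge 0$. Moreover, either $\lambda_j>0$ for all $j$, or there is an $n\ge 0$ such that $\lambda_j>0$ for $j\le n$ and $\lambda_j=0$ for $j>n$; the latter can occur only if $K$ is a finite sum of products of a function of $x_1$ and a function of $x_2$. (2) Conversely, let $\lambda_j\ge 0$ and let $f_{k,j}$ be locally integrable functions on $\mathbf R^{d_k}$, $j\ge 1$, $k=1,2$ (not assumed to be orthogonal), such that $K=\sum_{j=1}^\infty\lambda_j\, f_{1,j}\otimes f_{2,j}$ with convergence in the sense of distributions, and such that $(*)$ holds for every integer $N\ge 1$. Then $K\in\mathscr S(\mathbf R^{d_2}\times\mathbf R^{d_1})$. -/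

import Mathlib

open MeasureTheory Filter Topology SchwartzMap
open scoped ENNReal ContDiff

noncomputable section

namespace KernelExpansion

/-- The Euclidean space `ℝ^d`. -/
abbrev E (d : ℕ) : Type := EuclideanSpace ℝ (Fin d)

/-- Orthogonal sequences in `L²(ℝ^d)`: all members are nonzero (but not necessarily normalized),
and any two different members are orthogonal. -/
def IsOG {d : ℕ} (u : ℕ → Lp ℂ 2 (volume : Measure (E d))) : Prop :=
  (∀ j, u j ≠ 0) ∧ ∀ i j, i ≠ j → inner ℂ (u i) (u j) = 0

/-- The classical partial derivative `∂φ/∂x_i`. -/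
def partialDeriv {d : ℕ} (i : Fin d) (φ : E d → ℂ) : E d → ℂ :=
  fun x => fderiv ℝ φ x (EuclideanSpace.single i 1)

/-- The classical derivative `∂^β φ = ∂_1^{β_1} ⋯ ∂_d^{β_d} φ` (applied to smooth `φ` only). -/
def multiDeriv {d : ℕ} (β : Fin d → ℕ) (φ : E d → ℂ) : E d → ℂ :=
  (List.finRange d).foldr (fun i ψ => (partialDeriv i)^[β i] ψ) φ

/-- The monomial `x^α`. -/
def monomial {d : ℕ} (α : Fin d → ℕ) (x : E d) : ℝ :=
  ∏ i, x i ^ α i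

/-- `g` is the weak (distributional) derivative `∂^β f`, with `f` and `g` locally integrable. -/
def HasWeakDeriv {d : ℕ} (β : Fin d → ℕ) (f g : E d → ℂ) : Prop :=
  LocallyIntegrable f volume ∧ LocallyIntegrable g volume ∧
    ∀ φ : E d → ℂ, ContDiff ℝ ∞ φ → HasCompactSupport φ →
      ∫ x, g x * φ x = (-1 : ℂ) ^ (∑ i, β i) * ∫ x, f x * multiDeriv β φ x

/-- `‖x^α D^β f‖_{L^p(ℝ^d)}` for the weak derivative `D^β f`. The weak derivative is unique up to
null sets, so the infimum is over equal values; it is `∞` if there is no locally integrable weak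
derivative. (The unimodular factor in `D^β = (-i)^{|β|} ∂^β` does not affect the norm.) -/
def weightedDerivNorm {d : ℕ} (p : ℝ≥0∞) (α β : Fin d → ℕ) (f : E d → ℂ) : ℝ≥0∞ :=
  ⨅ (g : E d → ℂ) (_ : HasWeakDeriv β f g), eLpNorm (fun x => (monomial α x : ℂ) * g x) p volume

/-- `sup_{j ≥ 1} j^N λ_j < ∞`; the member with number `j + 1` is stored at index `j : ℕ`. -/
def CoeffBound (N : ℕ) (lam : ℕ → ℝ) : Prop :=
  BddAbove (Set.range fun j : ℕ => ((j : ℝ) + 1) ^ N * lam j)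

/-- `sup_{j ≥ 1} j^N ‖x^α D^β f_j‖_{L^p} < ∞` for all multi-indices `α`, `β`;
the member with number `j + 1` is stored at index `j : ℕ`. -/
def FunBound {d : ℕ} (p : ℝ≥0∞) (N : ℕ) (f : ℕ → E d → ℂ) : Prop :=
  ∀ α β : Fin d → ℕ, ⨆ j : ℕ, ((j : ℝ≥0∞) + 1) ^ N * weightedDerivNorm p α β (f j) < ⊤

/-- The tensor product `f₁ ⊗ f₂` as a function of `(x₂, x₁) ∈ ℝ^{d₂} × ℝ^{d₁}`. -/
def tensor {d₁ d₂ : ℕ} (f₁ : E d₁ → ℂ) (f₂ : E d₂ → ℂ) : E d₂ × E d₁ → ℂ :=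
  fun x => f₁ x.2 * f₂ x.1

/-- `K = ∑_j λ_j f_{1,j} ⊗ f_{2,j}` with convergence in the sense of distributions. -/
def HasExpansion {d₁ d₂ : ℕ} (K : E d₂ × E d₁ → ℂ) (lam : ℕ → ℝ)
    (f₁ : ℕ → E d₁ → ℂ) (f₂ : ℕ → E d₂ → ℂ) : Prop :=
  ∀ φ : E d₂ × E d₁ → ℂ, ContDiff ℝ ∞ φ → HasCompactSupport φ →
    Tendsto (fun n : ℕ => ∑ j ∈ Finset.range n, (lam j : ℂ) * ∫ x, tensor (f₁ j) (f₂ j) x * φ x)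
      atTop (𝓝 (∫ x, K x * φ x))

/-- `K = ∑_j λ_j f_{1,j} ⊗ f_{2,j}` with unconditional convergence at every point and convergence
of the partial sums in `L²`. -/
def HasStrongExpansion {d₁ d₂ : ℕ} (K : E d₂ × E d₁ → ℂ) (lam : ℕ → ℝ)
    (f₁ : ℕ → E d₁ → ℂ) (f₂ : ℕ → E d₂ → ℂ) : Prop :=
  (∀ x, HasSum (fun j => (lam j : ℂ) * tensor (f₁ j) (f₂ j) x) (K x)) ∧
    Tendsto (fun n : ℕ => eLpNorm
      (fun x => K x - ∑ j ∈ Finset.range n, (lam j : ℂ) * tensor (f₁ j) (f₂ j) x) 2 volume)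
      atTop (𝓝 0)

/-- `K` belongs to the Schwartz space `𝓢(ℝ^{d₂} × ℝ^{d₁})`. -/
def IsSchwartz {d₁ d₂ : ℕ} (K : E d₂ × E d₁ → ℂ) : Prop :=
  ∃ S : 𝓢(E d₂ × E d₁, ℂ), ⇑S = K

end KernelExpansion

end

/-!
The integral operator `A` with Schwartz kernel `K` is a Hilbert–Schmidt operator from `L²(ℝ^{d₁})`
to `L²(ℝ^{d₂})` that takes values in the Schwartz space, and so does its adjoint. Hence its singular
functions `v_j`, `u_j` are Schwartz functions, and any operator `L` on the Schwartz space costs at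
most one factor `1 / s_j`: `‖L v_j‖ ≤ C / s_j`. If `L` has an adjoint, then iterating
`‖L v‖² ≤ ‖v‖ ‖L'L v‖` improves this to `C s_j^{-ε}` for every `ε > 0`. A Sobolev inequality turns
these bounds into bounds of the Schwartz seminorms. Moreover, a suitable operator `L` can be
uniformly bounded only on finitely many members of an orthonormal sequence, quantitatively
`j ≤ C max_{i ≤ j} ‖L v_i‖²`, so that `j s_j^ε ≤ C`: the singular values decrease rapidly. Thus
`λ_j = s_j^{1/2}`, with `v_j` and `u_j` each multiplied by `s_j^{1/4}`, gives `(*)`.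

For the converse, integrate by parts in the expansion: each partial derivative of `K` is, for every
`k`, bounded by `C sup (1 + |x|)^{-k} |ψ|` as a functional of the test function `ψ`. Consequently
the average of `∂^β K` at scale `t ≤ 1` around `x` is `O((1 + |x|)^{-k} t^{-n})`, `n` being the
dimension. As the `t`-derivative of an average is an average of derivatives, integration in `t`
gains one power of `t` for all `β` at once, and after finitely many steps the averages are
`O((1 + |x|)^{-k})` uniformly in `t`; let `t → 0`.
-/

namespace KernelExpansion

open FourierTransform LineDeriv
open scoped InnerProduct

/-! ### Sobolev bounds and interpolation on the Schwartz space -/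

section Bracket

variable {V : Type*} [NormedAddCommGroup V]

/-- The power `⟨x⟩^{2r}` of the Japanese bracket `⟨x⟩ = (1 + |x|²)^{1/2}`. -/
noncomputable def bracketPow (r : ℝ) (x : V) : ℝ := (1 + ‖x‖ ^ 2) ^ r

theorem bracketPow_pos (r : ℝ) (x : V) : 0 < bracketPow r x := by
  unfold bracketPow
  positivity

theorem norm_bracketPow (r : ℝ) (x : V) : ‖bracketPow r x‖ = bracketPow r x :=
  Real.norm_of_nonneg (bracketPow_pos r x).le

theorem continuous_bracketPow (r : ℝ) : Continuous (bracketPow r : V → ℝ) :=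
  .rpow_const (by fun_prop) fun _ => .inl (by positivity)

theorem bracketPow_neg (r : ℝ) (x : V) : bracketPow (-r) x = (bracketPow r x)⁻¹ :=
  Real.rpow_neg (by positivity) r

theorem bracketPow_neg_mul_bracketPow (r : ℝ) (x : V) : bracketPow (-r) x * bracketPow r x = 1 := by
  rw [bracketPow_neg, inv_mul_cancel₀ (bracketPow_pos r x).ne']

theorem norm_pow_le_bracketPow (k : ℕ) (x : V) : ‖x‖ ^ k ≤ bracketPow k x := by
  rw [bracketPow, Real.rpow_natCast]
  gcongr
  nlinarith [sq_nonneg (‖x‖ - 1)]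

theorem exists_bracketPow_le_one_add_norm_pow (r : ℝ) :
    ∃ k : ℕ, ∀ x : V, bracketPow r x ≤ (1 + ‖x‖) ^ k := by
  obtain ⟨m, hm⟩ := exists_nat_ge r
  refine ⟨2 * m, fun x => ?_⟩
  calc (1 + ‖x‖ ^ 2) ^ r ≤ (1 + ‖x‖ ^ 2) ^ (m : ℝ) :=
        Real.rpow_le_rpow_of_exponent_le (by nlinarith [sq_nonneg ‖x‖]) hm
    _ = (1 + ‖x‖ ^ 2) ^ m := Real.rpow_natCast _ _
    _ ≤ ((1 + ‖x‖) ^ 2) ^ m := by gcongr; nlinarith [norm_nonneg x]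
    _ = (1 + ‖x‖) ^ (2 * m) := by rw [← pow_mul]

variable [InnerProductSpace ℝ V]

theorem hasTemperateGrowth_bracketPow (r : ℝ) : (bracketPow r : V → ℝ).HasTemperateGrowth :=
  Function.hasTemperateGrowth_one_add_norm_sq_rpow V r

variable (V) in
/-- Multiplication by `⟨x⟩^{2r}` on Schwartz functions. -/
noncomputable def bracketCLM (r : ℝ) : 𝓢(V, ℂ) →L[ℂ] 𝓢(V, ℂ) :=
  smulLeftCLM ℂ fun x => (bracketPow r x : ℂ)

theorem bracketCLM_apply (r : ℝ) (f : 𝓢(V, ℂ)) (x : V) :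
    bracketCLM V r f x = bracketPow r x * f x :=
  smulLeftCLM_apply_apply
    (Function.Complex.hasTemperateGrowth_ofReal.comp (hasTemperateGrowth_bracketPow r)) f x

theorem bracketCLM_neg_bracketCLM (r : ℝ) (f : 𝓢(V, ℂ)) :
    bracketCLM V (-r) (bracketCLM V r f) = f := by
  ext x
  rw [bracketCLM_apply, bracketCLM_apply, ← mul_assoc, ← Complex.ofReal_mul,
    bracketPow_neg_mul_bracketPow, Complex.ofReal_one, one_mul]

variable (V) in
/-- An exponent `r` for which `⟨x⟩^{-2r}` is square integrable. -/
noncomputable def decayExp : ℝ := (Module.finrank ℝ V + 1) / 4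

variable [FiniteDimensional ℝ V] [MeasurableSpace V] [BorelSpace V]

variable (V) in
theorem memLp_bracketPow_neg_decayExp :
    MemLp (bracketPow (-decayExp V) : V → ℝ) 2 volume := by
  rw [memLp_two_iff_integrable_sq (continuous_bracketPow _).aestronglyMeasurable]
  have hr : (Module.finrank ℝ V : ℝ) < Module.finrank ℝ V + 1 := by linarith
  refine (integrable_rpow_neg_one_add_norm_sq hr).congr (ae_of_all _ fun x => ?_)
  simp only [bracketPow, decayExp]
  rw [← Real.rpow_mul_natCast (by positivity)]
  congr 1
  push_cast
  ring

variable (V) in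
/-- The `L²` norm of `⟨x⟩^{-2r}` with `r = decayExp V`. -/
noncomputable def decayNorm : ℝ :=
  (eLpNorm (bracketPow (-decayExp V) : V → ℝ) 2 volume).toReal

theorem norm_toLp_le_mul_decayNorm {f : V → ℂ} (hf : MemLp f 2 volume) {C : ℝ} (hC : 0 ≤ C)
    (h : ∀ x, ‖f x‖ ≤ C * bracketPow (-decayExp V) x) : ‖hf.toLp‖ ≤ C * decayNorm V := by
  have hle : eLpNorm f 2 volume ≤
      ENNReal.ofReal C * eLpNorm (bracketPow (-decayExp V) : V → ℝ) 2 volume :=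
    eLpNorm_le_mul_eLpNorm_of_ae_le_mul (ae_of_all _ fun x => by rw [norm_bracketPow]; exact h x) 2
  rw [Lp.norm_toLp]
  refine (ENNReal.toReal_mono (ENNReal.mul_ne_top ENNReal.ofReal_ne_top
    (memLp_bracketPow_neg_decayExp V).2.ne) hle).trans_eq ?_
  rw [ENNReal.toReal_mul, ENNReal.toReal_ofReal hC, decayNorm]

end Bracket

section FormalAdjoint

variable {V : Type*} [NormedAddCommGroup V] [InnerProductSpace ℝ V] [FiniteDimensional ℝ V]
  [MeasurableSpace V] [BorelSpace V] {L L' M M' : 𝓢(V, ℂ) →L[ℂ] 𝓢(V, ℂ)}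

/-- `L'` is an adjoint of `L` on Schwartz functions with respect to the `L²` inner product. -/
def IsFormalAdjoint (L L' : 𝓢(V, ℂ) →L[ℂ] 𝓢(V, ℂ)) : Prop :=
  ∀ f g : 𝓢(V, ℂ), inner ℂ ((L f).toLp 2) (g.toLp 2) = inner ℂ (f.toLp 2) ((L' g).toLp 2)

/-- The operators on Schwartz space to which the interpolation inequality `‖L v‖² ≤ ‖v‖ ‖L'L v‖`
can be applied. -/
def HasFormalAdjoint (L : 𝓢(V, ℂ) →L[ℂ] 𝓢(V, ℂ)) : Prop := ∃ L', IsFormalAdjoint L L'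

theorem IsFormalAdjoint.symm (h : IsFormalAdjoint L L') : IsFormalAdjoint L' L := fun f g => by
  rw [← inner_conj_symm, ← h, inner_conj_symm]

theorem HasFormalAdjoint.comp (hL : HasFormalAdjoint L) (hM : HasFormalAdjoint M) :
    HasFormalAdjoint (L ∘L M) := by
  obtain ⟨L', hL⟩ := hL
  obtain ⟨M', hM⟩ := hM
  exact ⟨M' ∘L L', fun f g => by rw [ContinuousLinearMap.comp_apply, hL, hM]; rfl⟩

theorem IsFormalAdjoint.norm_sq_le (h : IsFormalAdjoint L L') (f : 𝓢(V, ℂ)) :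
    ‖(L f).toLp 2‖ ^ 2 ≤ ‖f.toLp 2‖ * ‖(L' (L f)).toLp 2‖ :=
  calc ‖(L f).toLp 2 volume‖ ^ 2
      = ‖(inner ℂ ((L f).toLp 2 volume) ((L f).toLp 2 volume) : ℂ)‖ := by
        rw [inner_self_eq_norm_sq_to_K, norm_pow, RCLike.norm_ofReal, abs_norm]
    _ = ‖(inner ℂ (f.toLp 2 volume) ((L' (L f)).toLp 2 volume) : ℂ)‖ := by rw [h]
    _ ≤ ‖f.toLp 2 volume‖ * ‖(L' (L f)).toLp 2 volume‖ := norm_inner_le_norm _ _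

theorem hasFormalAdjoint_fourier : HasFormalAdjoint (fourierCLM ℂ 𝓢(V, ℂ)) := by
  refine ⟨fourierInvCLM ℂ 𝓢(V, ℂ), fun f g => ?_⟩
  have h := inner_fourier_toL2_eq f (𝓕⁻ g)
  rwa [fourier_fourierInv_eq] at h

theorem hasFormalAdjoint_lineDeriv (v : V) : HasFormalAdjoint (lineDerivOpCLM ℂ 𝓢(V, ℂ) v) := by
  refine ⟨-lineDerivOpCLM ℂ 𝓢(V, ℂ) v, fun f g => ?_⟩
  have hparts := integral_bilinear_lineDerivOp_right_eq_neg_left (μ := volume) f g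
    ((ContinuousLinearMap.mul ℝ ℂ).comp (Complex.conjCLE : ℂ →L[ℝ] ℂ)) v
  simp only [ContinuousLinearMap.comp_apply, ContinuousLinearMap.mul_apply',
    ContinuousLinearEquiv.coe_coe, Complex.conjCLE_apply] at hparts
  change _ = inner ℂ (f.toLp 2) ((-(∂_{v} g)).toLp 2)
  rw [inner_toL2_toL2_eq _ _ volume, inner_toL2_toL2_eq _ _ volume]
  simp only [RCLike.inner_apply', lineDerivOpCLM_apply, neg_apply, mul_neg, integral_neg]
  rw [hparts, neg_neg]

theorem isFormalAdjoint_bracketCLM (r : ℝ) :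
    IsFormalAdjoint (bracketCLM V r) (bracketCLM V r) := fun f g => by
  rw [inner_toL2_toL2_eq _ _ volume, inner_toL2_toL2_eq _ _ volume]
  congr 1 with x
  rw [bracketCLM_apply, bracketCLM_apply, ← smul_eq_mul, ← smul_eq_mul, inner_smul_left,
    inner_smul_right, Complex.conj_ofReal]

theorem inner_bracketCLM_neg_bracketCLM (r : ℝ) (f g : 𝓢(V, ℂ)) :
    inner ℂ ((bracketCLM V (-r) f).toLp 2) ((bracketCLM V r g).toLp 2) =
      inner ℂ (f.toLp 2) (g.toLp 2) := by
  rw [isFormalAdjoint_bracketCLM, bracketCLM_neg_bracketCLM]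

end FormalAdjoint

section Sobolev

variable {V : Type*} [NormedAddCommGroup V] [InnerProductSpace ℝ V] [FiniteDimensional ℝ V]
  [MeasurableSpace V] [BorelSpace V]

theorem norm_toLp_one_le (g : 𝓢(V, ℂ)) :
    ‖g.toLp 1 volume‖ ≤ decayNorm V * ‖(bracketCLM V (decayExp V) g).toLp 2‖ := by
  have hfactor : (g : V → ℂ) =
      (bracketPow (-decayExp V) : V → ℝ) • (bracketCLM V (decayExp V) g : V → ℂ) := by
    ext x
    rw [Pi.smul_apply', bracketCLM_apply, Complex.real_smul, ← mul_assoc, ← Complex.ofReal_mul,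
      bracketPow_neg_mul_bracketPow, Complex.ofReal_one, one_mul]
  rw [norm_toLp, norm_toLp, decayNorm, ← ENNReal.toReal_mul]
  refine ENNReal.toReal_mono (ENNReal.mul_ne_top (memLp_bracketPow_neg_decayExp V).2.ne
    (eLpNorm_lt_top _ _ _).ne) ?_
  conv_lhs => rw [hfactor]
  exact eLpNorm_smul_le_mul_eLpNorm (SchwartzMap.memLp _ 2 _).1 (memLp_bracketPow_neg_decayExp V).1

theorem norm_apply_le_norm_fourier_toLp_one (f : 𝓢(V, ℂ)) (x : V) :
    ‖f x‖ ≤ ‖(𝓕 f).toLp 1 volume‖ := by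
  have hinv : 𝓕⁻ (𝓕 f) = f := fourierInv_fourier_eq f
  conv_lhs => rw [← hinv, fourierInv_apply_eq]
  exact norm_fourier_apply_le_toLp_one _ _

variable (V) in
/-- The operator `f ↦ ⟨ξ⟩^{2s} 𝓕 (⟨x⟩^{2r} f)`. -/
noncomputable def bracketFourierCLM (s r : ℝ) : 𝓢(V, ℂ) →L[ℂ] 𝓢(V, ℂ) :=
  bracketCLM V s ∘L fourierCLM ℂ 𝓢(V, ℂ) ∘L bracketCLM V r

theorem bracketFourierCLM_apply (s r : ℝ) (f : 𝓢(V, ℂ)) :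
    bracketFourierCLM V s r f = bracketCLM V s (𝓕 (bracketCLM V r f)) := rfl

theorem hasFormalAdjoint_bracketFourierCLM (s r : ℝ) :
    HasFormalAdjoint (bracketFourierCLM V s r) :=
  .comp ⟨_, isFormalAdjoint_bracketCLM s⟩
    (hasFormalAdjoint_fourier.comp ⟨_, isFormalAdjoint_bracketCLM r⟩)

theorem norm_pow_mul_norm_apply_le (k : ℕ) (f : 𝓢(V, ℂ)) (x : V) :
    ‖x‖ ^ k * ‖f x‖ ≤ decayNorm V * ‖(bracketFourierCLM V (decayExp V) k f).toLp 2‖ :=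
  calc ‖x‖ ^ k * ‖f x‖ ≤ bracketPow k x * ‖f x‖ := by
        gcongr
        exact norm_pow_le_bracketPow k x
    _ = ‖bracketCLM V k f x‖ := by
        rw [bracketCLM_apply, norm_mul, Complex.norm_real, norm_bracketPow]
    _ ≤ ‖(𝓕 (bracketCLM V k f)).toLp 1 volume‖ := norm_apply_le_norm_fourier_toLp_one _ x
    _ ≤ decayNorm V * ‖(bracketFourierCLM V (decayExp V) k f).toLp 2 volume‖ :=
        norm_toLp_one_le _

theorem exists_norm_iteratedFDeriv_succ_le {W F ι : Type*} [NormedAddCommGroup W]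
    [NormedSpace ℝ W] [FiniteDimensional ℝ W] [NormedAddCommGroup F] [NormedSpace ℝ F] [Fintype ι]
    (b : Module.Basis ι ℝ W) :
    ∃ C, 0 ≤ C ∧ ∀ f : W → F, ContDiff ℝ ∞ f → ∀ (n : ℕ) (x : W),
      ‖iteratedFDeriv ℝ (n + 1) f x‖ ≤
        C * ∑ i, ‖iteratedFDeriv ℝ n (fun y => fderiv ℝ f y (b i)) x‖ := by
  let T (i : ι) : F →L[ℝ] (W →L[ℝ] F) :=
    ContinuousLinearMap.smulRightL ℝ W F (LinearMap.toContinuousLinearMap (b.coord i))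
  refine ⟨∑ i, ‖T i‖, by positivity, fun f hf n x => ?_⟩
  have hpartial (i : ι) : ContDiff ℝ ∞ fun y => fderiv ℝ f y (b i) :=
    (hf.fderiv_right (m := ∞) (by simp)).clm_apply contDiff_const
  have hexpand : fderiv ℝ f = fun y => ∑ i, (T i ∘ fun y => fderiv ℝ f y (b i)) y := by
    ext y v
    conv_lhs => rw [← b.sum_repr v, map_sum]
    simp [T]
  rw [← norm_iteratedFDeriv_fderiv]
  conv_lhs => rw [hexpand]
  rw [iteratedFDeriv_fun_sum_apply
    fun i _ => (((T i).contDiff.comp (hpartial i)).of_le (by exact_mod_cast le_top)).contDiffAt]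
  refine (norm_sum_le _ _).trans ?_
  rw [Finset.sum_mul]
  refine Finset.sum_le_sum fun i _ => ((T i).norm_iteratedFDeriv_comp_left
    (hpartial i).contDiffAt (by exact_mod_cast le_top)).trans ?_
  gcongr
  exact Finset.single_le_sum (f := fun j => ‖iteratedFDeriv ℝ n (fun y => fderiv ℝ f y (b j)) x‖)
    (fun j _ => norm_nonneg _) (Finset.mem_univ i)

theorem exists_seminorm_succ_le_sum_lineDeriv (V : Type*) [NormedAddCommGroup V]
    [NormedSpace ℝ V] [FiniteDimensional ℝ V] {ι : Type*} [Fintype ι] (b : Module.Basis ι ℝ V)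
    (k n : ℕ) : ∃ C, 0 ≤ C ∧ ∀ f : 𝓢(V, ℂ),
      SchwartzMap.seminorm ℝ k (n + 1) f ≤ C * ∑ i, SchwartzMap.seminorm ℝ k n (∂_{b i} f) := by
  obtain ⟨C, hC0, hC⟩ := exists_norm_iteratedFDeriv_succ_le (F := ℂ) b
  refine ⟨C, hC0, fun f => seminorm_le_bound ℝ k (n + 1) _ (by positivity) fun x => ?_⟩
  calc ‖x‖ ^ k * ‖iteratedFDeriv ℝ (n + 1) f x‖
      ≤ ‖x‖ ^ k * (C * ∑ i, ‖iteratedFDeriv ℝ n (fun y => fderiv ℝ f y (b i)) x‖) := by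
        gcongr
        exact hC _ (f.smooth ⊤) n x
    _ = C * ∑ i, ‖x‖ ^ k * ‖iteratedFDeriv ℝ n (∂_{b i} f : 𝓢(V, ℂ)) x‖ := by
        rw [mul_left_comm, Finset.mul_sum]; rfl
    _ ≤ C * ∑ i, SchwartzMap.seminorm ℝ k n (∂_{b i} f) := by
        gcongr with i
        exact le_seminorm ℝ k n _ x

variable (V) in
theorem exists_seminorm_le_sum_norm_toLp (k n : ℕ) :
    ∃ (ι : Type) (_ : Fintype ι) (c : ι → ℝ) (L : ι → 𝓢(V, ℂ) →L[ℂ] 𝓢(V, ℂ)),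
      (∀ i, 0 ≤ c i) ∧ (∀ i, HasFormalAdjoint (L i)) ∧
      ∀ f, SchwartzMap.seminorm ℝ k n f ≤ ∑ i, c i * ‖(L i f).toLp 2‖ := by
  induction n with
  | zero =>
    refine ⟨Unit, inferInstance, fun _ => decayNorm V,
      fun _ => bracketFourierCLM V (decayExp V) k, fun _ => ENNReal.toReal_nonneg,
      fun _ => hasFormalAdjoint_bracketFourierCLM _ _, fun f => ?_⟩
    have := ENNReal.toReal_nonneg (a := eLpNorm (bracketPow (-decayExp V) : V → ℝ) 2 volume)
    rw [Fintype.sum_unique]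
    refine seminorm_le_bound ℝ k 0 _ (mul_nonneg this (norm_nonneg _)) fun x => ?_
    rw [norm_iteratedFDeriv_zero]
    exact norm_pow_mul_norm_apply_le k f x
  | succ n ih =>
    obtain ⟨ι, _, c, L, hc, hL, h⟩ := ih
    let b := (stdOrthonormalBasis ℝ V).toBasis
    obtain ⟨C, hC0, hC⟩ := exists_seminorm_succ_le_sum_lineDeriv V b k n
    refine ⟨Fin (Module.finrank ℝ V) × ι, inferInstance, fun p => C * c p.2,
      fun p => L p.2 ∘L lineDerivOpCLM ℂ 𝓢(V, ℂ) (b p.1), fun p => mul_nonneg hC0 (hc p.2),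
      fun p => (hL p.2).comp (hasFormalAdjoint_lineDeriv _), fun f => (hC f).trans ?_⟩
    rw [Fintype.sum_prod_type, Finset.mul_sum]
    refine Finset.sum_le_sum fun j _ => ?_
    simp only [mul_assoc C, ← Finset.mul_sum]
    gcongr
    exact h (∂_{b j} f)

end Sobolev

section Interpolation

variable {V : Type*} [NormedAddCommGroup V] [InnerProductSpace ℝ V] [FiniteDimensional ℝ V]
  [MeasurableSpace V] [BorelSpace V] {ι : Type*} {v : ι → 𝓢(V, ℂ)} {s : ι → ℝ}

theorem HasFormalAdjoint.exists_norm_toLp_le_rpow (hs : ∀ i, 0 < s i)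
    (hv : ∀ i, ‖(v i).toLp 2‖ = 1)
    (h : ∀ L : 𝓢(V, ℂ) →L[ℂ] 𝓢(V, ℂ), ∃ C, ∀ i, ‖(L (v i)).toLp 2‖ ≤ C / s i) (r : ℕ)
    {L : 𝓢(V, ℂ) →L[ℂ] 𝓢(V, ℂ)} (hL : HasFormalAdjoint L) :
    ∃ C, 0 ≤ C ∧ ∀ i, ‖(L (v i)).toLp 2‖ ≤ C * s i ^ (-(1 / 2 : ℝ) ^ r) := by
  induction r generalizing L with
  | zero =>
    obtain ⟨C, hC⟩ := h L
    refine ⟨|C|, abs_nonneg C, fun i => (hC i).trans ?_⟩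
    rw [pow_zero, Real.rpow_neg_one, ← div_eq_mul_inv]
    have := hs i
    gcongr
    exact le_abs_self C
  | succ r ih =>
    obtain ⟨L', hL'⟩ := hL
    obtain ⟨C, hC0, hC⟩ := ih (HasFormalAdjoint.comp ⟨L, hL'.symm⟩ ⟨L', hL'⟩)
    refine ⟨√C, Real.sqrt_nonneg C, fun i => ?_⟩
    have hsi := hs i
    refine le_of_sq_le_sq ?_ (by positivity)
    calc ‖(L (v i)).toLp 2 volume‖ ^ 2
        ≤ ‖(v i).toLp 2 volume‖ * ‖(L' (L (v i))).toLp 2 volume‖ := hL'.norm_sq_le _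
      _ ≤ C * s i ^ (-(1 / 2 : ℝ) ^ r) := by rw [hv, one_mul]; exact hC i
      _ = (√C * s i ^ (-(1 / 2 : ℝ) ^ (r + 1))) ^ 2 := by
          rw [mul_pow, Real.sq_sqrt hC0, ← Real.rpow_natCast (s i ^ _), ← Real.rpow_mul hsi.le]
          congr 2
          push_cast
          ring

theorem exists_seminorm_le_rpow (hs : ∀ i, 0 < s i) (hv : ∀ i, ‖(v i).toLp 2‖ = 1)
    (h : ∀ L : 𝓢(V, ℂ) →L[ℂ] 𝓢(V, ℂ), ∃ C, ∀ i, ‖(L (v i)).toLp 2‖ ≤ C / s i) (r k n : ℕ) :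
    ∃ C, 0 ≤ C ∧ ∀ i, SchwartzMap.seminorm ℝ k n (v i) ≤ C * s i ^ (-(1 / 2 : ℝ) ^ r) := by
  obtain ⟨κ, _, c, L, hc, hL, hsem⟩ := exists_seminorm_le_sum_norm_toLp V k n
  choose C hC0 hC using fun j => (hL j).exists_norm_toLp_le_rpow hs hv h r
  refine ⟨∑ j, c j * C j, Finset.sum_nonneg fun j _ => mul_nonneg (hc j) (hC0 j),
    fun i => (hsem (v i)).trans ?_⟩
  rw [Finset.sum_mul]
  refine Finset.sum_le_sum fun j _ => ?_
  rw [mul_assoc]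
  exact mul_le_mul_of_nonneg_left (hC j i) (hc j)

end Interpolation

section Counting

variable {V : Type*} [NormedAddCommGroup V] [InnerProductSpace ℝ V] [FiniteDimensional ℝ V]
  [MeasurableSpace V] [BorelSpace V]

theorem exists_fourier_eq_inner (ξ : V) : ∃ h : Lp ℂ 2 (volume : Measure V),
    ‖h‖ ≤ decayNorm V ∧
      ∀ f : 𝓢(V, ℂ), 𝓕 (bracketCLM V (-decayExp V) f) ξ = inner ℂ h (f.toLp 2) := by
  let e (x : V) : ℂ := Complex.exp (((2 * Real.pi * inner ℝ x ξ : ℝ) : ℂ) * Complex.I)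
  let w : V → ℝ := bracketPow (-decayExp V)
  have hw : Continuous w := continuous_bracketPow _
  have hnorm (x : V) : ‖e x * w x‖ = w x := by
    rw [norm_mul, Complex.norm_exp_ofReal_mul_I, one_mul, Complex.norm_real]
    exact norm_bracketPow _ x
  have hmem : MemLp (fun x => e x * w x) 2 volume :=
    (memLp_bracketPow_neg_decayExp V).of_le (Continuous.aestronglyMeasurable (by fun_prop))
      (ae_of_all _ fun x => by rw [hnorm, norm_bracketPow])
  refine ⟨hmem.toLp, ?_, fun f => ?_⟩
  · simpa only [one_mul] using
      norm_toLp_le_mul_decayNorm hmem zero_le_one fun x => by rw [hnorm, one_mul]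
  · rw [fourier_coe, Real.fourier_eq', L2.inner_def]
    refine integral_congr_ae ?_
    filter_upwards [hmem.coeFn_toLp, f.coeFn_toLp 2 volume] with x h1 h2
    rw [h1, h2, bracketCLM_apply, RCLike.inner_apply', map_mul, Complex.conj_ofReal,
      ← Complex.exp_conj, map_mul, Complex.conj_I, Complex.conj_ofReal, smul_eq_mul, ← mul_assoc]
    congr 3
    push_cast
    ring

theorem norm_toLp_two_sq (f : 𝓢(V, ℂ)) : ‖f.toLp 2‖ ^ 2 = ∫ x, ‖f x‖ ^ 2 := by
  rw [norm_toLp' (by simp) (by simp), ← Real.rpow_natCast,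
    ← Real.rpow_mul (integral_nonneg fun x => by positivity)]
  simp

theorem sum_norm_sq_bracketFourierCLM_le {ι : Type*} (t : Finset ι) {v : ι → 𝓢(V, ℂ)}
    (hv : Orthonormal ℂ fun i => (v i).toLp 2) :
    ∑ i ∈ t, ‖(bracketFourierCLM V (-decayExp V) (-decayExp V) (v i)).toLp 2‖ ^ 2 ≤
      decayNorm V ^ 2 * ∫ ξ : V, bracketPow (-decayExp V) ξ ^ 2 := by
  have hint (g : 𝓢(V, ℂ)) : Integrable fun x => ‖g x‖ ^ 2 :=
    (SchwartzMap.memLp g 2 volume).integrable_norm_pow (by simp)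
  have hbessel (ξ : V) : ∑ i ∈ t, ‖𝓕 (bracketCLM V (-decayExp V) (v i)) ξ‖ ^ 2 ≤
      decayNorm V ^ 2 := by
    obtain ⟨h, hh, hF⟩ := exists_fourier_eq_inner ξ
    calc ∑ i ∈ t, ‖𝓕 (bracketCLM V (-decayExp V) (v i)) ξ‖ ^ 2
        = ∑ i ∈ t, ‖(inner ℂ ((v i).toLp 2 volume) h : ℂ)‖ ^ 2 := by
          simp only [hF, norm_inner_symm h]
      _ ≤ ‖h‖ ^ 2 := hv.sum_inner_products_le h
      _ ≤ decayNorm V ^ 2 := by gcongr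
  simp_rw [norm_toLp_two_sq]
  rw [← integral_finsetSum _ fun i _ => hint _, ← integral_const_mul]
  refine integral_mono (integrable_finsetSum _ fun i _ => hint _)
    ((memLp_bracketPow_neg_decayExp V).integrable_sq.const_mul _) fun ξ => ?_
  simp only [bracketFourierCLM_apply, bracketCLM_apply _ (𝓕 _), norm_mul, mul_pow,
    Complex.norm_real, norm_bracketPow, ← Finset.mul_sum]
  rw [mul_comm]
  gcongr
  exact hbessel ξ

theorem one_le_norm_mul_norm_bracketFourierCLM (r s : ℝ) {f : 𝓢(V, ℂ)} (hf : ‖f.toLp 2‖ = 1) :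
    1 ≤ ‖(bracketFourierCLM V (-s) (-r) f).toLp 2‖ * ‖(bracketFourierCLM V s r f).toLp 2‖ := by
  have hpair : inner ℂ ((bracketFourierCLM V (-s) (-r) f).toLp 2)
      ((bracketFourierCLM V s r f).toLp 2) = (1 : ℂ) := by
    rw [bracketFourierCLM_apply, bracketFourierCLM_apply, inner_bracketCLM_neg_bracketCLM,
      inner_fourier_toL2_eq, inner_bracketCLM_neg_bracketCLM, inner_self_eq_norm_sq_to_K, hf]
    simp
  have hle := norm_inner_le_norm (𝕜 := ℂ) ((bracketFourierCLM V (-s) (-r) f).toLp 2 volume)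
    ((bracketFourierCLM V s r f).toLp 2 volume)
  rwa [hpair, norm_one] at hle

variable (V) in
theorem exists_card_le_of_orthonormal : ∃ L : 𝓢(V, ℂ) →L[ℂ] 𝓢(V, ℂ), HasFormalAdjoint L ∧
    ∃ C, 0 ≤ C ∧ ∀ {ι : Type} (t : Finset ι) (v : ι → 𝓢(V, ℂ)) (M : ℝ),
      Orthonormal ℂ (fun i => (v i).toLp 2) →
      (∀ i ∈ t, ‖(L (v i)).toLp 2‖ ≤ M) → (t.card : ℝ) ≤ C * M ^ 2 := by
  refine ⟨bracketFourierCLM V (decayExp V) (decayExp V), hasFormalAdjoint_bracketFourierCLM _ _,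
    decayNorm V ^ 2 * ∫ ξ : V, bracketPow (-decayExp V) ξ ^ 2,
    mul_nonneg (by positivity) (integral_nonneg fun x => by positivity), fun t v M hv hM => ?_⟩
  let N i := ‖(bracketFourierCLM V (-decayExp V) (-decayExp V) (v i)).toLp 2‖
  calc (t.card : ℝ) = ∑ _i ∈ t, (1 : ℝ) := by simp
    _ ≤ ∑ i ∈ t, N i ^ 2 * M ^ 2 := Finset.sum_le_sum fun i hi => by
      rw [← mul_pow]
      refine one_le_pow₀ ((one_le_norm_mul_norm_bracketFourierCLM (decayExp V) (decayExp V)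
        (hv.1 i)).trans ?_)
      gcongr
      exact hM i hi
    _ ≤ _ := by
      rw [← Finset.sum_mul]
      gcongr
      exact sum_norm_sq_bracketFourierCLM_le t hv

end Counting

/-! ### Integral operators with Schwartz kernel -/

section IntegralOperator

section

variable {V₁ V₂ F : Type*} [NormedAddCommGroup V₁] [NormedSpace ℝ V₁] [NormedAddCommGroup V₂]
  [NormedSpace ℝ V₂] [NormedAddCommGroup F] [NormedSpace ℝ F]

/-- The derivative of the kernel `K` in its first variable. -/
noncomputable def fstFDeriv (K : 𝓢(V₂ × V₁, F)) : 𝓢(V₂ × V₁, V₂ →L[ℝ] F) :=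
  postcompCLM ((ContinuousLinearMap.compL ℝ V₂ (V₂ × V₁) F).flip (.inl ℝ V₂ V₁))
    (fderivCLM ℝ (V₂ × V₁) F K)

theorem hasFDerivAt_fstFDeriv (K : 𝓢(V₂ × V₁, F)) (x : V₂) (y : V₁) :
    HasFDerivAt (fun x => K (x, y)) (fstFDeriv K (x, y)) x :=
  (K.hasFDerivAt (x, y)).comp x (hasFDerivAt_prodMk_left x y)

theorem exists_norm_kernel_le (K : 𝓢(V₂ × V₁, F)) (ρ σ : ℝ) :
    ∃ C, 0 ≤ C ∧ ∀ x y, ‖K (x, y)‖ ≤ C * bracketPow (-ρ) x * bracketPow (-σ) y := by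
  obtain ⟨k, hk⟩ := exists_bracketPow_le_one_add_norm_pow (V := V₂) ρ
  obtain ⟨m, hm⟩ := exists_bracketPow_le_one_add_norm_pow (V := V₁) σ
  refine ⟨2 ^ (k + m) * ((Finset.Iic (k + m, 0)).sup fun m => SchwartzMap.seminorm ℝ m.1 m.2) K,
    by positivity, fun x y => ?_⟩
  have h := one_add_le_sup_seminorm_apply (𝕜 := ℝ) (m := (k + m, 0)) le_rfl le_rfl K (x, y)
  rw [norm_iteratedFDeriv_zero] at h
  have hx := bracketPow_pos ρ x
  have hy := bracketPow_pos σ y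
  rw [bracketPow_neg, bracketPow_neg, ← div_eq_mul_inv, ← div_eq_mul_inv, div_div,
    le_div_iff₀ (by positivity)]
  refine le_trans ?_ h
  rw [mul_comm, pow_add]
  gcongr
  · exact (hk x).trans (by gcongr; exact le_max_left _ _)
  · exact (hm y).trans (by gcongr; exact le_max_right _ _)

end

variable {V₁ V₂ F : Type*} [NormedAddCommGroup V₁] [InnerProductSpace ℝ V₁]
  [FiniteDimensional ℝ V₁] [MeasurableSpace V₁] [BorelSpace V₁]
  [NormedAddCommGroup V₂] [NormedSpace ℝ V₂]
  [NormedAddCommGroup F] [NormedSpace ℝ F] [NormedSpace ℂ F]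

/-- The value at `x` of the integral operator with kernel `K` applied to `u`. -/
noncomputable def integralOp (K : 𝓢(V₂ × V₁, F)) (u : Lp ℂ 2 (volume : Measure V₁)) (x : V₂) : F :=
  ∫ y, u y • K (x, y)

theorem integrable_bracketPow_mul (u : Lp ℂ 2 (volume : Measure V₁)) :
    Integrable fun y => bracketPow (-decayExp V₁) y * ‖u y‖ :=
  (memLp_bracketPow_neg_decayExp V₁).integrable_mul (Lp.memLp u).norm

theorem aestronglyMeasurable_smul_kernel (K : 𝓢(V₂ × V₁, F))
    (u : Lp ℂ 2 (volume : Measure V₁)) (x : V₂) :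
    AEStronglyMeasurable (fun y => u y • K (x, y)) volume :=
  (Lp.aestronglyMeasurable u).smul (Continuous.aestronglyMeasurable (by fun_prop))

theorem exists_norm_smul_kernel_le (K : 𝓢(V₂ × V₁, F)) (u : Lp ℂ 2 (volume : Measure V₁)) :
    ∃ C, ∀ x y, ‖u y • K (x, y)‖ ≤ C * (bracketPow (-decayExp V₁) y * ‖u y‖) := by
  obtain ⟨C, -, hC⟩ := exists_norm_kernel_le K 0 (decayExp V₁)
  refine ⟨C, fun x y => ?_⟩
  have h : ‖K (x, y)‖ ≤ C * bracketPow (-decayExp V₁) y := by simpa [bracketPow] using hC x y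
  rw [norm_smul, mul_comm, ← mul_assoc]
  gcongr

theorem integrable_smul_kernel (K : 𝓢(V₂ × V₁, F)) (u : Lp ℂ 2 (volume : Measure V₁)) (x : V₂) :
    Integrable fun y => u y • K (x, y) := by
  obtain ⟨C, hC⟩ := exists_norm_smul_kernel_le K u
  exact ((integrable_bracketPow_mul u).const_mul C).mono'
    (aestronglyMeasurable_smul_kernel K u x) (ae_of_all _ (hC x))

variable [SMulCommClass ℝ ℂ F]

theorem hasFDerivAt_integralOp (K : 𝓢(V₂ × V₁, F)) (u : Lp ℂ 2 (volume : Measure V₁)) (x : V₂) :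
    HasFDerivAt (integralOp K u) (integralOp (fstFDeriv K) u x) x := by
  obtain ⟨C, hC⟩ := exists_norm_smul_kernel_le (fstFDeriv K) u
  exact hasFDerivAt_integral_of_dominated_of_fderiv_le univ_mem
    (.of_forall (aestronglyMeasurable_smul_kernel K u)) (integrable_smul_kernel K u x)
    (aestronglyMeasurable_smul_kernel (fstFDeriv K) u x) (ae_of_all _ fun y x _ => hC x y)
    ((integrable_bracketPow_mul u).const_mul C)
    (ae_of_all _ fun y x _ => (hasFDerivAt_fstFDeriv K x y).const_smul (u y))

theorem fderiv_integralOp_apply (K : 𝓢(V₂ × V₁, F)) (u : Lp ℂ 2 (volume : Measure V₁))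
    (x v : V₂) :
    fderiv ℝ (integralOp K u) x v = integralOp (∂_{((v, 0) : V₂ × V₁)} K) u x := by
  rw [(hasFDerivAt_integralOp K u x).fderiv]
  exact ContinuousLinearMap.integral_apply (integrable_smul_kernel (fstFDeriv K) u x) v

theorem contDiff_integralOp [FiniteDimensional ℝ V₂] (u : Lp ℂ 2 (volume : Measure V₁))
    (K : 𝓢(V₂ × V₁, F)) : ContDiff ℝ ∞ (integralOp K u) := by
  rw [contDiff_infty]
  intro n
  induction n generalizing K with
  | zero =>
    rw [Nat.cast_zero, contDiff_zero]
    exact continuous_iff_continuousAt.2 fun x => (hasFDerivAt_integralOp K u x).continuousAt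
  | succ n ih =>
    rw [Nat.cast_succ, contDiff_succ_iff_fderiv_apply]
    refine ⟨fun x => (hasFDerivAt_integralOp K u x).differentiableAt, by simp, fun v => ?_⟩
    simp_rw [fderiv_integralOp_apply]
    exact ih _

end IntegralOperator

section KernelOperator

variable {V₁ V₂ : Type*} [NormedAddCommGroup V₁] [InnerProductSpace ℝ V₁] [FiniteDimensional ℝ V₁]
  [MeasurableSpace V₁] [BorelSpace V₁] [NormedAddCommGroup V₂] [NormedSpace ℝ V₂]

theorem memLp_conj_kernel (K : 𝓢(V₂ × V₁, ℂ)) (x : V₂) :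
    MemLp (fun y => (starRingEnd ℂ) (K (x, y))) 2 volume := by
  obtain ⟨C, -, hC⟩ := exists_norm_kernel_le K 0 (decayExp V₁)
  refine (memLp_bracketPow_neg_decayExp V₁).of_le_mul (c := C)
    (Continuous.aestronglyMeasurable (by fun_prop)) (ae_of_all _ fun y => ?_)
  rw [RCLike.norm_conj, norm_bracketPow]
  simpa [bracketPow] using hC x y

/-- The function `y ↦ conj K(x, y)` as an element of `L²`. -/
noncomputable def kernelSlice (K : 𝓢(V₂ × V₁, ℂ)) (x : V₂) : Lp ℂ 2 (volume : Measure V₁) :=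
  (memLp_conj_kernel K x).toLp

theorem integralOp_eq_inner (K : 𝓢(V₂ × V₁, ℂ)) (u : Lp ℂ 2 (volume : Measure V₁)) (x : V₂) :
    integralOp K u x = inner ℂ (kernelSlice K x) u := by
  rw [integralOp, L2.inner_def]
  refine integral_congr_ae ?_
  filter_upwards [(memLp_conj_kernel K x).coeFn_toLp] with y hy
  rw [kernelSlice, hy, RCLike.inner_apply, Complex.conj_conj, smul_eq_mul]

theorem exists_norm_kernelSlice_le (K : 𝓢(V₂ × V₁, ℂ)) (ρ : ℝ) :
    ∃ C, 0 ≤ C ∧ ∀ x, ‖kernelSlice K x‖ ≤ C * bracketPow (-ρ) x := by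
  obtain ⟨C, hC0, hC⟩ := exists_norm_kernel_le K ρ (decayExp V₁)
  refine ⟨C * decayNorm V₁, mul_nonneg hC0 ENNReal.toReal_nonneg, fun x => ?_⟩
  rw [mul_right_comm]
  have := bracketPow_pos (-ρ) x
  refine norm_toLp_le_mul_decayNorm (memLp_conj_kernel K x) (by positivity) fun y => ?_
  rw [RCLike.norm_conj]
  exact hC x y

theorem exists_norm_pow_mul_norm_integralOp_le (k : ℕ) (K : 𝓢(V₂ × V₁, ℂ)) :
    ∃ C, 0 ≤ C ∧ ∀ (u : Lp ℂ 2 (volume : Measure V₁)) (x : V₂),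
      ‖x‖ ^ k * ‖integralOp K u x‖ ≤ C * ‖u‖ := by
  obtain ⟨C, hC0, hC⟩ := exists_norm_kernelSlice_le K k
  refine ⟨C, hC0, fun u x => ?_⟩
  have hslice : bracketPow k x * ‖kernelSlice K x‖ ≤ C := by
    have h := hC x
    rwa [bracketPow_neg, ← div_eq_mul_inv, le_div_iff₀' (bracketPow_pos _ x)] at h
  calc ‖x‖ ^ k * ‖integralOp K u x‖ ≤ bracketPow k x * (‖kernelSlice K x‖ * ‖u‖) := by
        rw [integralOp_eq_inner]
        have := bracketPow_pos k x
        gcongr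
        exacts [norm_pow_le_bracketPow k x, norm_inner_le_norm _ _]
    _ ≤ C * ‖u‖ := by
        rw [← mul_assoc]
        gcongr

variable [FiniteDimensional ℝ V₂]

theorem exists_norm_pow_mul_norm_iteratedFDeriv_integralOp_le (k n : ℕ) (K : 𝓢(V₂ × V₁, ℂ)) :
    ∃ C, 0 ≤ C ∧ ∀ (u : Lp ℂ 2 (volume : Measure V₁)) (x : V₂),
      ‖x‖ ^ k * ‖iteratedFDeriv ℝ n (integralOp K u) x‖ ≤ C * ‖u‖ := by
  induction n generalizing K with
  | zero => simpa only [norm_iteratedFDeriv_zero] using exists_norm_pow_mul_norm_integralOp_le k K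
  | succ n ih =>
    let b := Module.finBasis ℝ V₂
    obtain ⟨C, hC0, hC⟩ := exists_norm_iteratedFDeriv_succ_le (F := ℂ) b
    choose C' hC'0 hC' using fun j => ih (∂_{((b j, 0) : V₂ × V₁)} K)
    refine ⟨C * ∑ j, C' j, mul_nonneg hC0 (Finset.sum_nonneg fun j _ => hC'0 j), fun u x => ?_⟩
    calc ‖x‖ ^ k * ‖iteratedFDeriv ℝ (n + 1) (integralOp K u) x‖
        ≤ ‖x‖ ^ k * (C * ∑ j, ‖iteratedFDeriv ℝ n
            (fun y => fderiv ℝ (integralOp K u) y (b j)) x‖) := by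
          gcongr
          exact hC _ (contDiff_integralOp u K) n x
      _ = C * ∑ j, ‖x‖ ^ k * ‖iteratedFDeriv ℝ n
            (integralOp (∂_{((b j, 0) : V₂ × V₁)} K) u) x‖ := by
          rw [mul_left_comm, Finset.mul_sum]
          simp_rw [fderiv_integralOp_apply]
      _ ≤ C * ∑ j, C' j * ‖u‖ :=
          mul_le_mul_of_nonneg_left (Finset.sum_le_sum fun j _ => hC' j u x) hC0
      _ = (C * ∑ j, C' j) * ‖u‖ := by rw [← Finset.sum_mul, mul_assoc]

/-- The integral operator with Schwartz kernel `K`, as a linear map from `L²` to Schwartz space. -/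
noncomputable def kernelLM (K : 𝓢(V₂ × V₁, ℂ)) :
    Lp ℂ 2 (volume : Measure V₁) →ₗ[ℂ] 𝓢(V₂, ℂ) where
  toFun u :=
    { toFun := integralOp K u
      smooth' := contDiff_integralOp u K
      decay' := fun k n =>
        have ⟨_, _, hC⟩ := exists_norm_pow_mul_norm_iteratedFDeriv_integralOp_le k n K
        ⟨_, hC u⟩ }
  map_add' u v := by
    ext x
    change integralOp K (u + v) x = integralOp K u x + integralOp K v x
    simp_rw [integralOp_eq_inner, inner_add_right]
  map_smul' c u := by
    ext x
    change integralOp K (c • u) x = c • integralOp K u x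
    simp_rw [integralOp_eq_inner, inner_smul_right]
    rfl

/-- The integral operator with Schwartz kernel `K`, as a continuous linear map from `L²` to
Schwartz space. -/
noncomputable def kernelCLM (K : 𝓢(V₂ × V₁, ℂ)) :
    Lp ℂ 2 (volume : Measure V₁) →L[ℂ] 𝓢(V₂, ℂ) :=
  ⟨kernelLM K, (schwartz_withSeminorms ℂ V₂ ℂ).continuous_normedSpace_dom _ _ fun i => by
    obtain ⟨C, hC0, hC⟩ := exists_norm_pow_mul_norm_iteratedFDeriv_integralOp_le i.1 i.2 K
    exact ⟨⟨C, hC0⟩, fun u => seminorm_le_bound ℂ i.1 i.2 _ (mul_nonneg hC0 (norm_nonneg u))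
      fun x => hC u x⟩⟩

theorem kernelCLM_apply (K : 𝓢(V₂ × V₁, ℂ)) (u : Lp ℂ 2 (volume : Measure V₁)) (x : V₂) :
    kernelCLM K u x = inner ℂ (kernelSlice K x) u :=
  integralOp_eq_inner K u x

end KernelOperator

section Adjoint

/-- Complex conjugation on Schwartz functions. -/
noncomputable def conjCLM (W : Type*) [NormedAddCommGroup W] [NormedSpace ℝ W] :
    𝓢(W, ℂ) →L[ℝ] 𝓢(W, ℂ) :=
  postcompCLM (Complex.conjCLE : ℂ →L[ℝ] ℂ)

theorem conjCLM_apply {W : Type*} [NormedAddCommGroup W] [NormedSpace ℝ W] (f : 𝓢(W, ℂ)) (x : W) :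
    conjCLM W f x = (starRingEnd ℂ) (f x) := rfl

/-- The kernel `(y, x) ↦ conj K(x, y)` of the adjoint of the integral operator with kernel `K`. -/
noncomputable def adjointKernel {V₁ V₂ : Type*} [NormedAddCommGroup V₁] [NormedSpace ℝ V₁]
    [NormedAddCommGroup V₂] [NormedSpace ℝ V₂] (K : 𝓢(V₂ × V₁, ℂ)) : 𝓢(V₁ × V₂, ℂ) :=
  conjCLM _ (compCLMOfContinuousLinearEquiv ℝ (ContinuousLinearEquiv.prodComm ℝ V₁ V₂) K)

variable {V₁ V₂ : Type*} [NormedAddCommGroup V₁] [InnerProductSpace ℝ V₁] [FiniteDimensional ℝ V₁]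
  [MeasurableSpace V₁] [BorelSpace V₁]
  [NormedAddCommGroup V₂] [InnerProductSpace ℝ V₂] [FiniteDimensional ℝ V₂]
  [MeasurableSpace V₂] [BorelSpace V₂]

theorem exists_sum_norm_sq_kernelCLM_le (K : 𝓢(V₂ × V₁, ℂ)) :
    ∃ C, ∀ {ι : Type*} (t : Finset ι) (e : ι → Lp ℂ 2 (volume : Measure V₁)), Orthonormal ℂ e →
      ∑ i ∈ t, ‖(kernelCLM K (e i)).toLp 2‖ ^ 2 ≤ C := by
  obtain ⟨C, -, hC⟩ := exists_norm_kernelSlice_le K (decayExp V₂)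
  refine ⟨∫ x : V₂, C ^ 2 * bracketPow (-decayExp V₂) x ^ 2, fun t e he => ?_⟩
  have hint (g : 𝓢(V₂, ℂ)) : Integrable fun x => ‖g x‖ ^ 2 :=
    (SchwartzMap.memLp g 2 volume).integrable_norm_pow (by simp)
  simp_rw [norm_toLp_two_sq]
  rw [← integral_finsetSum _ fun i _ => hint _]
  refine integral_mono (integrable_finsetSum _ fun i _ => hint _)
    ((memLp_bracketPow_neg_decayExp V₂).integrable_sq.const_mul _) fun x => ?_
  calc ∑ i ∈ t, ‖kernelCLM K (e i) x‖ ^ 2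
      = ∑ i ∈ t, ‖(inner ℂ (e i) (kernelSlice K x) : ℂ)‖ ^ 2 := by
        simp only [kernelCLM_apply, norm_inner_symm (kernelSlice K x)]
    _ ≤ ‖kernelSlice K x‖ ^ 2 := he.sum_inner_products_le _
    _ ≤ (C * bracketPow (-decayExp V₂) x) ^ 2 := by gcongr; exact hC x
    _ = C ^ 2 * bracketPow (-decayExp V₂) x ^ 2 := mul_pow _ _ _

theorem integrable_conj_mul_kernel_mul (K : 𝓢(V₂ × V₁, ℂ)) (u : Lp ℂ 2 (volume : Measure V₂))
    (v : Lp ℂ 2 (volume : Measure V₁)) :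
    Integrable fun z : V₂ × V₁ => (starRingEnd ℂ) (u z.1) * K z * v z.2 := by
  obtain ⟨C, -, hC⟩ := exists_norm_kernel_le K (decayExp V₂) (decayExp V₁)
  refine (((integrable_bracketPow_mul u).mul_prod
    (integrable_bracketPow_mul v)).const_mul C).mono' ?_ (ae_of_all _ fun ⟨x, y⟩ => ?_)
  · exact (((Complex.continuous_conj.comp_aestronglyMeasurable
      (Lp.aestronglyMeasurable u)).comp_fst).mul
      K.continuous.aestronglyMeasurable).mul (Lp.aestronglyMeasurable v).comp_snd
  · calc ‖(starRingEnd ℂ) (u x) * K (x, y) * v y‖ = ‖u x‖ * ‖K (x, y)‖ * ‖v y‖ := by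
          rw [norm_mul, norm_mul, RCLike.norm_conj]
      _ ≤ ‖u x‖ * (C * bracketPow (-decayExp V₂) x * bracketPow (-decayExp V₁) y) * ‖v y‖ := by
          gcongr
          exact hC x y
      _ = C * (bracketPow (-decayExp V₂) x * ‖u x‖ * (bracketPow (-decayExp V₁) y * ‖v y‖)) := by
          ring

theorem inner_kernelCLM (K : 𝓢(V₂ × V₁, ℂ)) (u : Lp ℂ 2 (volume : Measure V₂))
    (v : Lp ℂ 2 (volume : Measure V₁)) :
    inner ℂ u ((kernelCLM K v).toLp 2) = inner ℂ ((kernelCLM (adjointKernel K) u).toLp 2) v := by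
  have hleft : inner ℂ u ((kernelCLM K v).toLp 2) =
      ∫ x, ∫ y, (starRingEnd ℂ) (u x) * K (x, y) * v y := by
    rw [L2.inner_def]
    refine integral_congr_ae ?_
    filter_upwards [(kernelCLM K v).coeFn_toLp 2 volume] with x hx
    rw [hx, RCLike.inner_apply']
    simp_rw [mul_assoc, integral_const_mul, mul_comm (K _)]
    rfl
  have hright : inner ℂ ((kernelCLM (adjointKernel K) u).toLp 2) v =
      ∫ y, ∫ x, (starRingEnd ℂ) (u x) * K (x, y) * v y := by
    rw [L2.inner_def]
    refine integral_congr_ae ?_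
    filter_upwards [(kernelCLM (adjointKernel K) u).coeFn_toLp 2 volume] with y hy
    rw [hy, RCLike.inner_apply', integral_mul_const]
    congr 1
    change (starRingEnd ℂ) (∫ x, u x * (starRingEnd ℂ) (K (x, y))) = _
    simp_rw [← integral_conj, map_mul, Complex.conj_conj]
  rw [hleft, hright]
  exact integral_integral_swap (integrable_conj_mul_kernel_mul K u v)

end Adjoint

/-! ### Singular value decomposition -/

section SingularValueDecomposition

theorem exists_seq_of_forall_prefix {α : Type*} [Nonempty α] (Q : ℕ → (ℕ → α) → α → Prop)
    (hcongr : ∀ n f g y, (∀ m < n, f m = g m) → Q n f y → Q n g y)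
    (h : ∀ n f, (∀ m < n, Q m f (f m)) → ∃ y, Q n f y) : ∃ f : ℕ → α, ∀ n, Q n f (f n) := by
  classical
  -- `F n` is a sequence whose first `n` members have been chosen correctly.
  let next (n : ℕ) (f : ℕ → α) : α := Classical.epsilon (Q n f)
  let F (n : ℕ) : ℕ → α :=
    n.rec (fun _ => Classical.arbitrary α) fun n f => Function.update f n (next n f)
  have hF (n : ℕ) : F (n + 1) = Function.update (F n) n (next n (F n)) := rfl
  have hstable {n m : ℕ} (hm : m < n) : F n m = F (m + 1) m := by
    induction n, hm using Nat.le_induction with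
    | base => rfl
    | succ n hn ih => rw [hF, Function.update_of_ne (by lia), ih]
  refine ⟨fun n => F (n + 1) n, fun n => ?_⟩
  induction n using Nat.strong_induction_on with
  | _ n ih =>
    have hex : ∃ y, Q n (F n) y := h n (F n) fun m hm => by
      rw [hstable hm]
      exact hcongr m _ _ _ (fun k hk => (hstable (hk.trans hm)).symm) (ih m hm)
    change Q n _ (F (n + 1) n)
    rw [hF, Function.update_self]
    exact hcongr n _ _ _ (fun m hm => hstable hm) (Classical.epsilon_spec hex)

variable {H₁ H₂ : Type*} [NormedAddCommGroup H₁] [InnerProductSpace ℂ H₁]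
  [NormedAddCommGroup H₂] [InnerProductSpace ℂ H₂]

theorem orthonormal_of_forall_lt {ι : Type*} [LinearOrder ι] {e : ι → H₁}
    (hnorm : ∀ i, ‖e i‖ = 1) (horth : ∀ i j, i < j → inner ℂ (e i) (e j) = 0) :
    Orthonormal ℂ e := by
  refine ⟨hnorm, fun i j hij => ?_⟩
  rcases lt_or_gt_of_ne hij with h | h
  · exact horth i j h
  · exact inner_eq_zero_symm.1 (horth j i h)

theorem mem_orthogonal_span_image_Iio {e : ℕ → H₁} {n : ℕ} {x : H₁} :
    x ∈ (Submodule.span ℂ (e '' Set.Iio n))ᗮ ↔ ∀ m < n, inner ℂ (e m) x = 0 := by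
  rw [← Submodule.span_singleton_le_iff_mem, ← Submodule.isOrtho_iff_le, Submodule.isOrtho_comm,
    Submodule.isOrtho_span]
  simp

theorem exists_mem_norm_eq_one_orthogonal {D : Submodule ℂ H₁} (hD : ¬ FiniteDimensional ℂ D)
    (n : ℕ) (e : ℕ → H₁) : ∃ v ∈ D, ‖v‖ = 1 ∧ ∀ m < n, inner ℂ (e m) v = 0 := by
  let coords : D →ₗ[ℂ] (Fin n → ℂ) :=
    LinearMap.pi fun m => (innerSL ℂ (e m)).toLinearMap.comp D.subtype
  have hker : LinearMap.ker coords ≠ ⊥ := fun h =>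
    hD (FiniteDimensional.of_injective coords (LinearMap.ker_eq_bot.1 h))
  obtain ⟨x, hx, hx0⟩ := Submodule.exists_mem_ne_zero_of_ne_bot hker
  refine ⟨((‖(x : H₁)‖ : ℂ)⁻¹) • (x : H₁), D.smul_mem _ x.2,
    norm_smul_inv_norm (by simpa using hx0), fun m hm => ?_⟩
  rw [inner_smul_right, show inner ℂ (e m) (x : H₁) = 0 from
    congrFun (LinearMap.mem_ker.1 hx) ⟨m, hm⟩, mul_zero]

/-- Hilbert–Schmidt operators, without reference to a basis: the sums `∑ ‖A eᵢ‖²` over finite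
parts of orthonormal sequences are uniformly bounded. -/
def IsHilbertSchmidt (A : H₁ →L[ℂ] H₂) : Prop :=
  ∃ C, ∀ (t : Finset ℕ) (e : ℕ → H₁), Orthonormal ℂ e → ∑ i ∈ t, ‖A (e i)‖ ^ 2 ≤ C

theorem IsHilbertSchmidt.exists_norm_lt {A : H₁ →L[ℂ] H₂} (hA : IsHilbertSchmidt A) {e : ℕ → H₁}
    (he : Orthonormal ℂ e) {ε : ℝ} (hε : 0 < ε) : ∃ i, ‖A (e i)‖ < ε := by
  obtain ⟨C, hC⟩ := hA
  by_contra! hge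
  obtain ⟨n, hn⟩ := exists_nat_gt (C / ε ^ 2)
  rw [div_lt_iff₀ (by positivity)] at hn
  refine hn.not_ge ?_
  calc (n : ℝ) * ε ^ 2 = ∑ _i ∈ Finset.range n, ε ^ 2 := by simp
    _ ≤ ∑ i ∈ Finset.range n, ‖A (e i)‖ ^ 2 :=
      Finset.sum_le_sum fun i _ => by gcongr; exact hge i
    _ ≤ C := hC _ e he

theorem IsHilbertSchmidt.exists_finset_norm_le {A : H₁ →L[ℂ] H₂} (hA : IsHilbertSchmidt A)
    {ε : ℝ} (hε : 0 < ε) :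
    ∃ F : Finset H₁, ∀ x, (∀ y ∈ F, inner ℂ y x = 0) → ‖A x‖ ≤ ε * ‖x‖ := by
  by_contra! hlarge
  obtain ⟨e, he, horth⟩ := exists_seq_of_forall_finset_exists
    (fun x : H₁ => ‖x‖ = 1 ∧ ε < ‖A x‖) (fun x y => inner ℂ x y = 0) fun F _ => by
      obtain ⟨x, hx, hlt⟩ := hlarge F
      have hx0 : x ≠ 0 := fun h => by simp [h] at hlt
      refine ⟨(‖x‖ : ℂ)⁻¹ • x, ⟨norm_smul_inv_norm hx0, ?_⟩, fun y hy => ?_⟩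
      · rw [map_smul, norm_smul, norm_inv, Complex.norm_real, norm_norm, inv_mul_eq_div,
          lt_div_iff₀ (norm_pos_iff.2 hx0)]
        exact hlt
      · rw [inner_smul_right, hx y hy, mul_zero]
  obtain ⟨i, hi⟩ := hA.exists_norm_lt (orthonormal_of_forall_lt (fun i => (he i).1) horth) hε
  exact hi.not_ge (he i).2.le

theorem IsHilbertSchmidt.isCompactOperator [CompleteSpace H₂] {A : H₁ →L[ℂ] H₂}
    (hA : IsHilbertSchmidt A) : IsCompactOperator A := by
  suffices A ∈ closure {f : H₁ →L[ℂ] H₂ | IsCompactOperator f} by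
    rwa [isClosed_setOfPred_isCompactOperator.closure_eq] at this
  refine Metric.mem_closure_iff.2 fun ε hε => ?_
  obtain ⟨F, hF⟩ := hA.exists_finset_norm_le (half_pos hε)
  let U : Submodule ℂ H₁ := Submodule.span ℂ (F : Set H₁)
  have : FiniteDimensional ℂ U := FiniteDimensional.span_finset ℂ F
  refine ⟨A ∘L U.starProjection, ?_, ?_⟩
  · have : ProperSpace U := FiniteDimensional.proper ℂ U
    have hcomp : IsCompactOperator (A ∘L U.subtypeL) :=
      isCompactOperator_of_locallyCompactSpace_rng _
    exact hcomp.comp_clm U.orthogonalProjectionOnto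
  · rw [dist_eq_norm]
    refine (ContinuousLinearMap.opNorm_le_bound _ (half_pos hε).le fun x => ?_).trans_lt
      (half_lt_self hε)
    calc ‖(A - A ∘L U.starProjection) x‖ = ‖A (Uᗮ.starProjection x)‖ := by
          rw [Submodule.starProjection_orthogonal_val, map_sub]
          rfl
      _ ≤ ε / 2 * ‖Uᗮ.starProjection x‖ := hF _ fun y hy =>
          (Submodule.mem_orthogonal U _).1 (Submodule.starProjection_apply_mem _ x) y
            (Submodule.subset_span hy)
      _ ≤ ε / 2 * ‖x‖ := by
          gcongr
          exact Submodule.norm_starProjection_apply_le _ x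

variable [CompleteSpace H₁] [CompleteSpace H₂]

theorem exists_norm_eq_one_adjoint_apply_apply {T : H₁ →L[ℂ] H₂} (hT : IsCompactOperator T)
    (h0 : T ≠ 0) : ∃ x, ‖x‖ = 1 ∧ (T†) (T x) = ((‖T‖ ^ 2 : ℝ) : ℂ) • x := by
  have hnt : Nontrivial H₁ := by
    by_contra h
    rw [not_nontrivial_iff_subsingleton] at h
    exact h0 (Subsingleton.elim _ _)
  have hpos : 0 ≤ (T†) ∘L T :=
    (ContinuousLinearMap.nonneg_iff_isPositive _).2 T.isPositive_adjoint_comp_self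
  have hspec : (‖(T†) ∘L T‖ : ℂ) ∈ spectrum ℂ ((T†) ∘L T) :=
    spectrum.algebraMap_mem ℂ (CStarAlgebra.norm_mem_spectrum_of_nonneg hpos)
  rw [ContinuousLinearMap.norm_adjoint_comp_self, ← sq] at hspec
  have hne : ((‖T‖ ^ 2 : ℝ) : ℂ) ≠ 0 := by simpa using h0
  obtain ⟨x, hx⟩ := (((hT.clm_comp (T†)).hasEigenvalue_iff_mem_spectrum hne).2
    hspec).exists_hasEigenvector
  refine ⟨(‖x‖ : ℂ)⁻¹ • x, norm_smul_inv_norm hx.2, ?_⟩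
  rw [map_smul, map_smul, smul_comm]
  exact congrArg _ hx.apply_eq_smul

/-- Candidates for a right singular vector, a left singular vector and the singular value. -/
structure SingularTriple (H₁ H₂ : Type*) where
  right : H₁
  left : H₂
  value : ℝ

/-- The triple `y` may follow the first `n` triples of the sequence `f` in a singular value
decomposition of `A` with singular vectors in `D₁` and `D₂`. The field `max` makes the choice
greedy: the value is the norm of `A` on the orthogonal complement of the earlier vectors. -/
structure IsNextSingularTriple (A : H₁ →L[ℂ] H₂) (D₁ : Submodule ℂ H₁) (D₂ : Submodule ℂ H₂)
    (n : ℕ) (f : ℕ → SingularTriple H₁ H₂) (y : SingularTriple H₁ H₂) : Prop where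
  right_mem : y.right ∈ D₁
  left_mem : y.left ∈ D₂
  norm_right : ‖y.right‖ = 1
  norm_left : ‖y.left‖ = 1
  orth_right : ∀ m < n, inner ℂ (f m).right y.right = 0
  orth_left : ∀ m < n, inner ℂ (f m).left y.left = 0
  nonneg : 0 ≤ y.value
  map_right : A y.right = (y.value : ℂ) • y.left
  map_left : (A†) y.left = (y.value : ℂ) • y.right
  max : ∀ x, (∀ m < n, inner ℂ (f m).right x = 0) → ‖A x‖ ≤ y.value * ‖x‖

theorem IsNextSingularTriple.congr {A : H₁ →L[ℂ] H₂} {D₁ : Submodule ℂ H₁} {D₂ : Submodule ℂ H₂}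
    {n : ℕ} {f g : ℕ → SingularTriple H₁ H₂} {y : SingularTriple H₁ H₂}
    (h : IsNextSingularTriple A D₁ D₂ n f y) (hfg : ∀ m < n, f m = g m) :
    IsNextSingularTriple A D₁ D₂ n g y where
  __ := h
  orth_right m hm := hfg m hm ▸ h.orth_right m hm
  orth_left m hm := hfg m hm ▸ h.orth_left m hm
  max x hx := h.max x fun m hm => hfg m hm ▸ hx m hm

variable {A : H₁ →L[ℂ] H₂} {D₁ : Submodule ℂ H₁} {D₂ : Submodule ℂ H₂}
  {n : ℕ} {f : ℕ → SingularTriple H₁ H₂}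

theorem exists_isNextSingularTriple_of_forall_eq_zero (hD₁ : ¬ FiniteDimensional ℂ D₁)
    (hD₂ : ¬ FiniteDimensional ℂ D₂) (hf : ∀ m < n, IsNextSingularTriple A D₁ D₂ m f (f m))
    (hA : ∀ x, (∀ m < n, inner ℂ (f m).right x = 0) → A x = 0) :
    ∃ y, IsNextSingularTriple A D₁ D₂ n f y := by
  obtain ⟨v, hvD, hv1, hv⟩ := exists_mem_norm_eq_one_orthogonal hD₁ n fun m => (f m).right
  obtain ⟨u, huD, hu1, hu⟩ := exists_mem_norm_eq_one_orthogonal hD₂ n fun m => (f m).left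
  have hAu : A ((A†) u) = 0 := hA _ fun m hm => by
    rw [ContinuousLinearMap.adjoint_inner_right, (hf m hm).map_right, inner_smul_left, hu m hm,
      mul_zero]
  have hAu' : (A†) u = 0 := by
    rw [← inner_self_eq_zero (𝕜 := ℂ), ContinuousLinearMap.adjoint_inner_left, hAu,
      inner_zero_right]
  exact ⟨⟨v, u, 0⟩, hvD, huD, hv1, hu1, hv, hu, le_rfl, by simp [hA v hv], by simp [hAu'],
    fun x hx => by simp [hA x hx]⟩

theorem isNextSingularTriple_of_adjoint_apply_apply (hAD : ∀ x, A x ∈ D₂)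
    (hAD' : ∀ y, (A†) y ∈ D₁) (hf : ∀ m < n, IsNextSingularTriple A D₁ D₂ m f (f m))
    {x : H₁} {s : ℝ} (hx : ‖x‖ = 1) (horth : ∀ m < n, inner ℂ (f m).right x = 0) (hs : 0 < s)
    (hAx : (A†) (A x) = ((s ^ 2 : ℝ) : ℂ) • x)
    (hmax : ∀ w, (∀ m < n, inner ℂ (f m).right w = 0) → ‖A w‖ ≤ s * ‖w‖) :
    IsNextSingularTriple A D₁ D₂ n f ⟨x, (s : ℂ)⁻¹ • A x, s⟩ := by
  have hs0 : (s : ℂ) ≠ 0 := by exact_mod_cast hs.ne'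
  have hnorm : ‖A x‖ = s := by
    rw [← sq_eq_sq₀ (norm_nonneg _) hs.le, ContinuousLinearMap.apply_norm_sq_eq_inner_adjoint_left,
      ContinuousLinearMap.comp_apply, hAx, inner_smul_left, inner_self_eq_norm_sq_to_K, hx,
      Complex.conj_ofReal, RCLike.ofReal_one, one_pow, mul_one]
    exact Complex.ofReal_re _
  exact
    { right_mem := by
        rw [← inv_smul_smul₀ (pow_ne_zero 2 hs0) x, ← Complex.ofReal_pow, ← hAx]
        exact D₁.smul_mem _ (hAD' _)
      left_mem := D₂.smul_mem _ (hAD x)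
      norm_right := hx
      norm_left := by
        rw [norm_smul, norm_inv, Complex.norm_real, Real.norm_of_nonneg hs.le, hnorm,
          inv_mul_cancel₀ hs.ne']
      orth_right := horth
      orth_left := fun m hm => by
        rw [inner_smul_right, ← ContinuousLinearMap.adjoint_inner_left, (hf m hm).map_left,
          inner_smul_left, horth m hm, mul_zero, mul_zero]
      nonneg := hs.le
      map_right := (smul_inv_smul₀ hs0 _).symm
      map_left := by
        rw [map_smul, hAx, smul_smul, Complex.ofReal_pow, sq, inv_mul_cancel_left₀ hs0]
      max := hmax }

theorem exists_isNextSingularTriple (hA : IsCompactOperator A) (hD₁ : ¬ FiniteDimensional ℂ D₁)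
    (hD₂ : ¬ FiniteDimensional ℂ D₂) (hAD : ∀ x, A x ∈ D₂) (hAD' : ∀ y, (A†) y ∈ D₁)
    (hf : ∀ m < n, IsNextSingularTriple A D₁ D₂ m f (f m)) :
    ∃ y, IsNextSingularTriple A D₁ D₂ n f y := by
  let U : Submodule ℂ H₁ := Submodule.span ℂ ((fun m => (f m).right) '' Set.Iio n)
  have : FiniteDimensional ℂ U := FiniteDimensional.span_of_finite ℂ ((Set.finite_Iio n).image _)
  have hU {x : H₁} : x ∈ Uᗮ ↔ ∀ m < n, inner ℂ (f m).right x = 0 := mem_orthogonal_span_image_Iio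
  have hP {x : H₁} (hx : x ∈ Uᗮ) : Uᗮ.starProjection x = x :=
    Submodule.starProjection_eq_self_iff.2 hx
  set T := A ∘L Uᗮ.starProjection with hT
  have hTA {x : H₁} (hx : ∀ m < n, inner ℂ (f m).right x = 0) : T x = A x :=
    congrArg A (hP (hU.2 hx))
  by_cases h0 : T = 0
  · exact exists_isNextSingularTriple_of_forall_eq_zero hD₁ hD₂ hf fun x hx => by
      rw [← hTA hx, h0]
      rfl
  obtain ⟨x, hx1, hx⟩ := exists_norm_eq_one_adjoint_apply_apply (hA.comp_clm _) h0
  have hTadj (y : H₂) : (T†) y = Uᗮ.starProjection ((A†) y) := by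
    rw [hT, ContinuousLinearMap.adjoint_comp,
      (isSelfAdjoint_starProjection Uᗮ).adjoint_eq]
    rfl
  rw [hTadj] at hx
  have hxU : x ∈ Uᗮ := by
    rw [← inv_smul_smul₀ (a := ((‖T‖ ^ 2 : ℝ) : ℂ)) (by simpa using h0) x, ← hx]
    exact Uᗮ.smul_mem _ (Submodule.starProjection_apply_mem _ _)
  have hxorth := hU.1 hxU
  have hAxU : (A†) (A x) ∈ Uᗮ := hU.2 fun m hm => by
    rw [ContinuousLinearMap.adjoint_inner_right, (hf m hm).map_right, inner_smul_left,
      ← ContinuousLinearMap.adjoint_inner_left, (hf m hm).map_left, inner_smul_left,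
      hxorth m hm, mul_zero, mul_zero]
  rw [hTA hxorth, hP hAxU] at hx
  exact ⟨_, isNextSingularTriple_of_adjoint_apply_apply hAD hAD' hf hx1 hxorth (norm_pos_iff.2 h0)
    hx fun w hw => hTA hw ▸ T.le_opNorm w⟩

theorem exists_singular_value_decomposition (hA : IsHilbertSchmidt A)
    (hD₁ : ¬ FiniteDimensional ℂ D₁) (hD₂ : ¬ FiniteDimensional ℂ D₂) (hAD : ∀ x, A x ∈ D₂)
    (hAD' : ∀ y, (A†) y ∈ D₁) :
    ∃ (v : ℕ → H₁) (u : ℕ → H₂) (s : ℕ → ℝ), (∀ j, v j ∈ D₁) ∧ (∀ j, u j ∈ D₂) ∧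
      Orthonormal ℂ v ∧ Orthonormal ℂ u ∧ (∀ j, 0 ≤ s j) ∧ Antitone s ∧
      (∀ j, A (v j) = (s j : ℂ) • u j) ∧ (∀ j, (A†) (u j) = (s j : ℂ) • v j) ∧
      ∀ x, (∀ j, inner ℂ (v j) x = 0) → A x = 0 := by
  have : Nonempty (SingularTriple H₁ H₂) := ⟨⟨0, 0, 0⟩⟩
  obtain ⟨f, hf⟩ := exists_seq_of_forall_prefix (IsNextSingularTriple A D₁ D₂)
    (fun _ _ _ _ hfg h => h.congr hfg)
    fun _ _ => exists_isNextSingularTriple hA.isCompactOperator hD₁ hD₂ hAD hAD'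
  have hv : Orthonormal ℂ fun j => (f j).right :=
    orthonormal_of_forall_lt (fun j => (hf j).norm_right) fun i j hij => (hf j).orth_right i hij
  have hu : Orthonormal ℂ fun j => (f j).left :=
    orthonormal_of_forall_lt (fun j => (hf j).norm_left) fun i j hij => (hf j).orth_left i hij
  have hAv (j : ℕ) : ‖A (f j).right‖ = (f j).value := by
    rw [(hf j).map_right, norm_smul, (hf j).norm_left, mul_one, Complex.norm_real,
      Real.norm_of_nonneg (hf j).nonneg]
  refine ⟨fun j => (f j).right, fun j => (f j).left, fun j => (f j).value,
    fun j => (hf j).right_mem, fun j => (hf j).left_mem, hv, hu, fun j => (hf j).nonneg,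
    antitone_nat_of_succ_le fun j => ?_, fun j => (hf j).map_right, fun j => (hf j).map_left,
    fun x hx => ?_⟩
  · have hmax := (hf j).max (f (j + 1)).right fun m hm => (hf (j + 1)).orth_right m (by lia)
    rwa [hAv, (hf (j + 1)).norm_right, mul_one] at hmax
  · by_contra hne
    have hx0 : 0 < ‖x‖ := norm_pos_iff.2 fun h => hne (by simp [h])
    obtain ⟨j, hj⟩ := hA.exists_norm_lt hv (div_pos (norm_pos_iff.2 hne) hx0)
    rw [hAv, lt_div_iff₀ hx0] at hj
    exact hj.not_ge ((hf j).max x fun m _ => hx m)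

end SingularValueDecomposition

/-! ### Rapid decay of the singular system -/

section RapidDecay

theorem CoeffBound.of_le {N : ℕ} {a : ℕ → ℝ} {C : ℝ} (h : ∀ j : ℕ, ((j : ℝ) + 1) ^ N * a j ≤ C) :
    CoeffBound N a :=
  ⟨C, Set.forall_mem_range.2 h⟩

theorem CoeffBound.exists_le {N : ℕ} {a : ℕ → ℝ} (h : CoeffBound N a) :
    ∃ C, 0 ≤ C ∧ ∀ j : ℕ, ((j : ℝ) + 1) ^ N * a j ≤ C := by
  obtain ⟨C, hC⟩ := h
  exact ⟨max C 0, le_max_right _ _, fun j => (hC ⟨j, rfl⟩).trans (le_max_left _ _)⟩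

theorem CoeffBound.mul {M N : ℕ} {a b : ℕ → ℝ} (ha : CoeffBound M a) (hb : CoeffBound N b)
    (hb0 : ∀ j, 0 ≤ b j) : CoeffBound (M + N) fun j => a j * b j := by
  obtain ⟨A, hA0, hA⟩ := ha.exists_le
  obtain ⟨B, -, hB⟩ := hb.exists_le
  refine .of_le (C := A * B) fun j => ?_
  calc ((j : ℝ) + 1) ^ (M + N) * (a j * b j)
      = (((j : ℝ) + 1) ^ M * a j) * (((j : ℝ) + 1) ^ N * b j) := by ring
    _ ≤ A * B := mul_le_mul (hA j) (hB j) (mul_nonneg (by positivity) (hb0 j)) hA0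

theorem CoeffBound.summable {N : ℕ} {a : ℕ → ℝ} (h : CoeffBound N a) (hN : 1 < N)
    (h0 : ∀ j, 0 ≤ a j) : Summable a := by
  obtain ⟨C, -, hC⟩ := h.exists_le
  have hpow : Summable fun j : ℕ => 1 / ((j : ℝ) + 1) ^ N := by
    simpa using (summable_nat_add_iff 1).2 (Real.summable_one_div_nat_pow.2 hN)
  refine .of_nonneg_of_le h0 (fun j => ?_) (hpow.mul_left C)
  rw [mul_one_div, le_div_iff₀ (by positivity), mul_comm]
  exact hC j

/-- Sequences that are `O(j^{-N})` for every `N`. The bounds are one-sided, so that this is a decay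
condition only for nonnegative sequences. -/
def RapidDecay (a : ℕ → ℝ) : Prop :=
  ∀ N : ℕ, CoeffBound N a

theorem RapidDecay.mono {a b : ℕ → ℝ} (hb : RapidDecay b) (hab : ∀ j, a j ≤ b j) :
    RapidDecay a := fun N => by
  obtain ⟨C, -, hC⟩ := (hb N).exists_le
  exact .of_le fun j => (mul_le_mul_of_nonneg_left (hab j) (by positivity)).trans (hC j)

theorem RapidDecay.rpow {s : ℕ → ℝ} (hs : RapidDecay s) (h0 : ∀ j, 0 ≤ s j) {a : ℝ} (ha : 0 < a) :
    RapidDecay fun j => s j ^ a := by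
  intro N
  obtain ⟨m, hm⟩ := exists_nat_ge (N / a)
  obtain ⟨C, -, hC⟩ := (hs m).exists_le
  refine .of_le (C := C ^ a) fun j => ?_
  have hj : (1 : ℝ) ≤ (j : ℝ) + 1 := le_add_of_nonneg_left j.cast_nonneg
  have hs0 := h0 j
  calc ((j : ℝ) + 1) ^ N * s j ^ a = (((j : ℝ) + 1) ^ (N / a) * s j) ^ a := by
        rw [Real.mul_rpow (by positivity) hs0, ← Real.rpow_mul (by positivity),
          div_mul_cancel₀ _ ha.ne', Real.rpow_natCast]
    _ ≤ (((j : ℝ) + 1) ^ (m : ℝ) * s j) ^ a := by gcongr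
    _ ≤ C ^ a := by
        rw [Real.rpow_natCast]
        gcongr
        exact hC j

theorem exists_pos_forall_rapidDecay_mul {q : ℕ → ℕ → ℝ} (hq : ∀ m j, 0 ≤ q m j) :
    ∃ ε : ℕ → ℝ, (∀ j, 0 < ε j) ∧ ∀ m, RapidDecay fun j => ε j * q m j := by
  let Q : ℕ → ℝ := fun j => ∑ m ∈ Finset.range (j + 1), q m j
  have hQ : ∀ j, 0 ≤ Q j := fun j => Finset.sum_nonneg fun m _ => hq m j
  refine ⟨fun j => 1 / (((j : ℝ) + 1) ^ j * (1 + Q j)), fun j => ?_, fun m N => ?_⟩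
  · have := hQ j
    positivity
  refine IsBoundedUnder.bddAbove_range
    (isBoundedUnder_of_eventually_le (a := 1) (eventually_atTop.2 ⟨m + N, fun j hj => ?_⟩))
  have hqQ : q m j ≤ Q j :=
    Finset.single_le_sum (fun m _ => hq m j) (Finset.mem_range.2 (by lia))
  have hj : (1 : ℝ) ≤ (j : ℝ) + 1 := le_add_of_nonneg_left j.cast_nonneg
  have hpos : 0 < 1 + Q j := by linarith [hQ j]
  dsimp only
  rw [one_div_mul_eq_div, mul_div_assoc', div_le_one (by positivity)]
  gcongr
  · exact hq m j
  · lia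
  · linarith

end RapidDecay

section Seminorms

variable {V : Type*} [NormedAddCommGroup V] [NormedSpace ℝ V]

/-- Sequences in the Schwartz space that tend to `0` faster than any power of `1 / j`, in every
seminorm. -/
def SchwartzRapidDecay (f : ℕ → 𝓢(V, ℂ)) : Prop :=
  ∀ k n : ℕ, RapidDecay fun j => SchwartzMap.seminorm ℝ k n (f j)

theorem exists_pos_rapidDecay_mul_seminorm (v : ℕ → 𝓢(V, ℂ)) :
    ∃ ε : ℕ → ℝ, (∀ j, 0 < ε j) ∧ ∀ k n : ℕ,
      RapidDecay fun j => ε j * SchwartzMap.seminorm ℝ k n (v j) := by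
  obtain ⟨ε, hε0, hε⟩ := exists_pos_forall_rapidDecay_mul
    (q := fun m j => SchwartzMap.seminorm ℝ m.unpair.1 m.unpair.2 (v j))
    fun m j => apply_nonneg _ _
  exact ⟨ε, hε0, fun k n => by simpa only [Nat.unpair_pair] using hε (Nat.pair k n)⟩

theorem SchwartzRapidDecay.exists_bound {f : ℕ → 𝓢(V, ℂ)} (hf : SchwartzRapidDecay f) (m : ℕ) :
    ∃ C, 0 ≤ C ∧ ∀ (j : ℕ) (x : V), (1 + ‖x‖) ^ m * ‖f j x‖ ≤ C := by
  obtain ⟨C₀, hC₀0, hC₀⟩ := (hf 0 0 0).exists_le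
  obtain ⟨C₁, hC₁0, hC₁⟩ := (hf m 0 0).exists_le
  simp only [pow_zero, one_mul] at hC₀ hC₁
  refine ⟨2 ^ (m - 1) * (C₀ + C₁), by positivity, fun j x => ?_⟩
  calc (1 + ‖x‖) ^ m * ‖f j x‖
      ≤ (2 ^ (m - 1) * (1 ^ m + ‖x‖ ^ m)) * ‖f j x‖ := by
        gcongr
        exact add_pow_le zero_le_one (norm_nonneg x) m
    _ = 2 ^ (m - 1) * (‖f j x‖ + ‖x‖ ^ m * ‖f j x‖) := by rw [one_pow]; ring
    _ ≤ 2 ^ (m - 1) * (C₀ + C₁) := by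
        gcongr
        exacts [(norm_le_seminorm ℝ (f j) x).trans (hC₀ j),
          (norm_pow_mul_le_seminorm ℝ (f j) m x).trans (hC₁ j)]

theorem seminorm_conjCLM_le (k n : ℕ) (f : 𝓢(V, ℂ)) :
    SchwartzMap.seminorm ℝ k n (conjCLM V f) ≤ SchwartzMap.seminorm ℝ k n f := by
  refine seminorm_le_bound ℝ k n _ (by positivity) fun x => ?_
  have h : ‖iteratedFDeriv ℝ n (Complex.conjLIE ∘ f) x‖ = ‖iteratedFDeriv ℝ n f x‖ :=
    Complex.conjLIE.norm_iteratedFDeriv_comp_left f x n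
  change ‖x‖ ^ k * ‖iteratedFDeriv ℝ n (Complex.conjLIE ∘ f) x‖ ≤ _
  rw [h]
  exact le_seminorm ℝ k n f x

theorem SchwartzRapidDecay.conj {f : ℕ → 𝓢(V, ℂ)} (hf : SchwartzRapidDecay f) :
    SchwartzRapidDecay fun j => conjCLM V (f j) :=
  fun k n => (hf k n).mono fun j => seminorm_conjCLM_le k n (f j)

theorem seminorm_ofReal_smul (k n : ℕ) {c : ℝ} (hc : 0 ≤ c) (f : 𝓢(V, ℂ)) :
    SchwartzMap.seminorm ℝ k n ((c : ℂ) • f) = c * SchwartzMap.seminorm ℝ k n f := by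
  rw [show (c : ℂ) • f = c • f by ext x; simp, map_smul_eq_mul, Real.norm_of_nonneg hc]

end Seminorms

section SingularSystem

variable {V : Type*} [NormedAddCommGroup V] [InnerProductSpace ℝ V] [FiniteDimensional ℝ V]

theorem exists_linearIndependent_schwartzMap [Nontrivial V] :
    ∃ f : ℕ → 𝓢(V, ℂ), LinearIndependent ℂ f := by
  obtain ⟨e, he⟩ := exists_norm_eq V (zero_le_one' ℝ)
  let b : ∀ n : ℕ, ContDiffBump ((n : ℝ) • e) := fun n => ⟨1 / 4, 1 / 2, by norm_num, by norm_num⟩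
  have hb : ∀ n m : ℕ, b n ((m : ℝ) • e) = Pi.single (M := fun _ => ℝ) n 1 m := fun n m => by
    rcases eq_or_ne m n with rfl | hmn
    · rw [Pi.single_eq_same, (b m).one_of_mem_closedBall
        (Metric.mem_closedBall_self (by norm_num [b]))]
    · rw [Pi.single_eq_of_ne hmn, (b n).zero_of_le_dist]
      have h1 : (1 : ℝ) ≤ |(m : ℝ) - n| := by
        exact_mod_cast Int.one_le_abs (sub_ne_zero.2 (Nat.cast_injective.ne hmn))
      rw [dist_eq_norm, ← sub_smul, norm_smul, he, mul_one, Real.norm_eq_abs]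
      change (1 / 2 : ℝ) ≤ _
      linarith
  let f : ℕ → 𝓢(V, ℂ) := fun n =>
    ((b n).hasCompactSupport.comp_left (g := Complex.ofReal) Complex.ofReal_zero).toSchwartzMap
      (Complex.ofRealCLM.contDiff.comp (b n).contDiff)
  let eval : 𝓢(V, ℂ) →ₗ[ℂ] (ℕ → ℂ) :=
    { toFun := fun g m => g ((m : ℝ) • e)
      map_add' := fun _ _ => rfl
      map_smul' := fun _ _ => rfl }
  have heval : eval ∘ f = fun n => Pi.single n 1 := by
    ext n m
    change ((b n ((m : ℝ) • e) : ℝ) : ℂ) = _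
    rw [hb, Pi.single_apply, Pi.single_apply]
    split_ifs <;> simp
  refine ⟨f, .of_comp eval ?_⟩
  rw [heval]
  exact Pi.linearIndependent_single_one ℕ ℂ

variable [MeasurableSpace V] [BorelSpace V]

theorem not_finiteDimensional_range_toLpCLM [Nontrivial V] :
    ¬ FiniteDimensional ℂ (LinearMap.range
      (toLpCLM ℂ ℂ 2 (volume : Measure V)).toLinearMap) := by
  intro hfin
  obtain ⟨f, hf⟩ := exists_linearIndependent_schwartzMap (V := V)
  have hlin : LinearIndependent ℂ
      ((toLpCLM ℂ ℂ 2 (volume : Measure V)).toLinearMap.rangeRestrict ∘ f) :=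
    hf.map' _ (LinearMap.ker_eq_bot.2 fun _ _ h =>
      injective_toLp 2 volume (congrArg Subtype.val h))
  exact not_finite_iff_infinite.2 inferInstance hlin.finite

theorem exists_norm_toLp_le_div_of_apply_eq_smul {H ι : Type*} [NormedAddCommGroup H]
    [NormedSpace ℂ H] (T : H →L[ℂ] 𝓢(V, ℂ)) {w : ι → H} (hw : ∀ i, ‖w i‖ = 1) {v : ι → 𝓢(V, ℂ)}
    {s : ι → ℝ} (hs : ∀ i, 0 < s i) (h : ∀ i, T (w i) = (s i : ℂ) • v i)
    (L : 𝓢(V, ℂ) →L[ℂ] 𝓢(V, ℂ)) : ∃ C, ∀ i, ‖(L (v i)).toLp 2 volume‖ ≤ C / s i := by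
  let S := toLpCLM ℂ ℂ 2 (volume : Measure V) ∘L L ∘L T
  refine ⟨‖S‖, fun i => ?_⟩
  have hS : S (w i) = (s i : ℂ) • (L (v i)).toLp 2 volume := by
    change toLpCLM ℂ ℂ 2 volume (L (T (w i))) = _
    rw [h, map_smul, map_smul]
    rfl
  have hle := S.le_opNorm (w i)
  rw [hS, norm_smul, Complex.norm_real, Real.norm_of_nonneg (hs i).le, hw, mul_one] at hle
  rwa [le_div_iff₀ (hs i), mul_comm]

/-- The normalisation `s j ^ (1 / 4)` lets a singular triple `(v j, u j, s j)` be rewritten with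
coefficient `s j ^ (1 / 2)`; where `s j = 0` any positive factor will do. -/
theorem exists_pos_schwartzRapidDecay_smul {s : ℕ → ℝ} (hs : ∀ j, 0 ≤ s j) (hrapid : RapidDecay s)
    {v : ℕ → 𝓢(V, ℂ)} (hv : ∀ j, ‖(v j).toLp 2 volume‖ = 1)
    (hb : ∀ L : 𝓢(V, ℂ) →L[ℂ] 𝓢(V, ℂ), ∃ C, ∀ i : {j // 0 < s j},
      ‖(L (v i)).toLp 2 volume‖ ≤ C / s i) :
    ∃ c : ℕ → ℝ, (∀ j, 0 < c j) ∧ (∀ j, 0 < s j → c j = s j ^ (1 / 4 : ℝ)) ∧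
      SchwartzRapidDecay fun j => (c j : ℂ) • v j := by
  obtain ⟨ε, hε0, hε⟩ := exists_pos_rapidDecay_mul_seminorm v
  let c : ℕ → ℝ := fun j => if 0 < s j then s j ^ (1 / 4 : ℝ) else ε j
  have hcε : ∀ j, ¬ 0 < s j → c j = ε j := fun j hj => if_neg hj
  have hcs : ∀ j, 0 < s j → c j = s j ^ (1 / 4 : ℝ) := fun j hj => if_pos hj
  have hc : ∀ j, 0 < c j := fun j => by
    rcases em (0 < s j) with hj | hj
    · rw [hcs j hj]; positivity
    · rw [hcε j hj]; exact hε0 j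
  refine ⟨c, hc, hcs, fun k n N => ?_⟩
  obtain ⟨A, hA0, hA⟩ := (hε k n N).exists_le
  obtain ⟨B, hB0, hB⟩ := exists_seminorm_le_rpow (v := fun i : {j // 0 < s j} => v i)
    (s := fun i => s i) (fun i => i.2) (fun i => hv i) hb 3 k n
  obtain ⟨D, hD0, hD⟩ := (hrapid.rpow hs (show (0 : ℝ) < 1 / 8 by norm_num) N).exists_le
  refine .of_le (C := A + D * B) fun j => ?_
  rw [seminorm_ofReal_smul k n (hc j).le]
  rcases em (0 < s j) with hj | hj
  · have hexp : s j ^ (1 / 4 : ℝ) * s j ^ (-(1 / 2 : ℝ) ^ 3) = s j ^ (1 / 8 : ℝ) := by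
      rw [← Real.rpow_add hj]
      norm_num
    calc ((j : ℝ) + 1) ^ N * (c j * SchwartzMap.seminorm ℝ k n (v j))
        ≤ ((j : ℝ) + 1) ^ N * (s j ^ (1 / 4 : ℝ) * (B * s j ^ (-(1 / 2 : ℝ) ^ 3))) := by
          rw [hcs j hj]
          gcongr
          exact hB ⟨j, hj⟩
      _ = (((j : ℝ) + 1) ^ N * s j ^ (1 / 8 : ℝ)) * B := by rw [← hexp]; ring
      _ ≤ D * B := by gcongr; exact hD j
      _ ≤ A + D * B := le_add_of_nonneg_left hA0
  · rw [hcε j hj]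
    exact (hA j).trans (le_add_of_nonneg_right (mul_nonneg hD0 hB0))

variable {V₁ V₂ : Type*} [NormedAddCommGroup V₁] [InnerProductSpace ℝ V₁] [FiniteDimensional ℝ V₁]
  [MeasurableSpace V₁] [BorelSpace V₁]
  [NormedAddCommGroup V₂] [InnerProductSpace ℝ V₂] [FiniteDimensional ℝ V₂]
  [MeasurableSpace V₂] [BorelSpace V₂]

/-- The singular value decomposition of the integral operator with Schwartz kernel `K`: the
singular functions `v j`, `u j` are Schwartz functions, `s j` are the singular values, including
zeros, and `K` annihilates the orthogonal complement of the `v j`. -/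
structure IsSingularSystem (K : 𝓢(V₂ × V₁, ℂ)) (v : ℕ → 𝓢(V₁, ℂ)) (u : ℕ → 𝓢(V₂, ℂ))
    (s : ℕ → ℝ) : Prop where
  orthonormal₁ : Orthonormal ℂ fun j => (v j).toLp 2 volume
  orthonormal₂ : Orthonormal ℂ fun j => (u j).toLp 2 volume
  nonneg : ∀ j, 0 ≤ s j
  antitone : Antitone s
  map₁ : ∀ j, kernelCLM K ((v j).toLp 2 volume) = (s j : ℂ) • u j
  map₂ : ∀ j, kernelCLM (adjointKernel K) ((u j).toLp 2 volume) = (s j : ℂ) • v j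
  map_eq_zero : ∀ x, (∀ j, inner ℂ ((v j).toLp 2 volume) x = 0) → kernelCLM K x = 0

theorem adjoint_toLpCLM_comp_kernelCLM (K : 𝓢(V₂ × V₁, ℂ)) :
    (toLpCLM ℂ ℂ 2 (volume : Measure V₂) ∘L kernelCLM K)† =
      toLpCLM ℂ ℂ 2 (volume : Measure V₁) ∘L kernelCLM (adjointKernel K) :=
  ((ContinuousLinearMap.eq_adjoint_iff _ _).2 fun u v => (inner_kernelCLM K u v).symm).symm

theorem exists_isSingularSystem [Nontrivial V₁] [Nontrivial V₂] (K : 𝓢(V₂ × V₁, ℂ)) :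
    ∃ v u s, IsSingularSystem K v u s := by
  let A := toLpCLM ℂ ℂ 2 (volume : Measure V₂) ∘L kernelCLM K
  have hA' : A† = _ := adjoint_toLpCLM_comp_kernelCLM K
  have hA : IsHilbertSchmidt A :=
    (exists_sum_norm_sq_kernelCLM_le K).imp fun C hC t e he => hC t e he
  obtain ⟨v', u', s, hv', hu', hv, hu, hs0, hs, hAv, hAu, hker⟩ :=
    exists_singular_value_decomposition hA
      (not_finiteDimensional_range_toLpCLM (V := V₁))
      (not_finiteDimensional_range_toLpCLM (V := V₂))
      (fun x => ⟨kernelCLM K x, rfl⟩) (fun y => ⟨kernelCLM (adjointKernel K) y, by rw [hA']; rfl⟩)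
  choose v hvv' using hv'
  choose u huu' using hu'
  obtain rfl : (fun j => (v j).toLp 2 volume) = v' := funext hvv'
  obtain rfl : (fun j => (u j).toLp 2 volume) = u' := funext huu'
  rw [hA'] at hAu
  exact ⟨v, u, s, hv, hu, hs0, hs, fun j => injective_toLp 2 volume (hAv j),
    fun j => injective_toLp 2 volume (hAu j),
    fun x hx => injective_toLp 2 volume ((hker x hx).trans
      (map_zero (toLpCLM ℂ ℂ 2 (volume : Measure V₂))).symm)⟩

namespace IsSingularSystem

variable {K : 𝓢(V₂ × V₁, ℂ)} {v : ℕ → 𝓢(V₁, ℂ)} {u : ℕ → 𝓢(V₂, ℂ)} {s : ℕ → ℝ}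

theorem exists_norm_toLp_le_div₁ (h : IsSingularSystem K v u s) (L : 𝓢(V₁, ℂ) →L[ℂ] 𝓢(V₁, ℂ)) :
    ∃ C, ∀ i : {j // 0 < s j}, ‖(L (v i)).toLp 2 volume‖ ≤ C / s i :=
  exists_norm_toLp_le_div_of_apply_eq_smul (ι := {j // 0 < s j}) (kernelCLM (adjointKernel K))
    (fun i => h.orthonormal₂.1 i) (fun i => i.2) (fun i => h.map₂ i) L

theorem exists_norm_toLp_le_div₂ (h : IsSingularSystem K v u s) (L : 𝓢(V₂, ℂ) →L[ℂ] 𝓢(V₂, ℂ)) :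
    ∃ C, ∀ i : {j // 0 < s j}, ‖(L (u i)).toLp 2 volume‖ ≤ C / s i :=
  exists_norm_toLp_le_div_of_apply_eq_smul (ι := {j // 0 < s j}) (kernelCLM K)
    (fun i => h.orthonormal₁.1 i) (fun i => i.2) (fun i => h.map₁ i) L

theorem exists_mul_rpow_le (h : IsSingularSystem K v u s) (N : ℕ) :
    ∃ C, 0 ≤ C ∧ ∀ j : ℕ, 0 < s j → ((j : ℝ) + 1) * s j ^ ((1 / 2 : ℝ) ^ N) ≤ C := by
  obtain ⟨L, hL, C, hC0, hC⟩ := exists_card_le_of_orthonormal (V := V₁)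
  obtain ⟨C', hC'0, hC'⟩ := hL.exists_norm_toLp_le_rpow (v := fun i : {j // 0 < s j} => v i)
    (s := fun i => s i) (fun i => i.2) (fun i => h.orthonormal₁.1 i) h.exists_norm_toLp_le_div₁
    (N + 1)
  refine ⟨C * C' ^ 2, by positivity, fun j hj => ?_⟩
  have hcard := hC (Finset.range (j + 1)) v (C' * s j ^ (-(1 / 2 : ℝ) ^ (N + 1))) h.orthonormal₁
    fun i hi => by
      have hij : s j ≤ s i := h.antitone (Nat.lt_succ_iff.1 (Finset.mem_range.1 hi))
      refine (hC' ⟨i, hj.trans_le hij⟩).trans (mul_le_mul_of_nonneg_left ?_ hC'0)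
      exact Real.rpow_le_rpow_of_nonpos hj hij (by simp)
  have hexp : (s j ^ (-(1 / 2 : ℝ) ^ (N + 1))) ^ 2 = (s j ^ ((1 / 2 : ℝ) ^ N))⁻¹ := by
    rw [← Real.rpow_natCast (s j ^ _), ← Real.rpow_mul hj.le, ← Real.rpow_neg hj.le]
    congr 1
    push_cast
    ring
  rw [mul_pow, hexp, ← mul_assoc, ← div_eq_mul_inv, le_div_iff₀ (by positivity)] at hcard
  simpa using hcard

theorem rapidDecay (h : IsSingularSystem K v u s) : RapidDecay s := by
  intro N
  obtain ⟨C, hC0, hC⟩ := h.exists_mul_rpow_le N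
  refine .of_le (C := C ^ 2 ^ N) fun j => ?_
  rcases (h.nonneg j).eq_or_lt with h0 | hj
  · rw [← h0, mul_zero]
    positivity
  have hroot : (s j ^ ((1 / 2 : ℝ) ^ N)) ^ 2 ^ N = s j := by
    rw [← Real.rpow_mul_natCast hj.le]
    push_cast
    rw [← mul_pow]
    norm_num
  calc ((j : ℝ) + 1) ^ N * s j ≤ ((j : ℝ) + 1) ^ 2 ^ N * s j := by
        gcongr
        exacts [le_add_of_nonneg_left j.cast_nonneg, Nat.lt_two_pow_self.le]
    _ = (((j : ℝ) + 1) * s j ^ ((1 / 2 : ℝ) ^ N)) ^ 2 ^ N := by rw [mul_pow, hroot]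
    _ ≤ C ^ 2 ^ N := by gcongr; exact hC j hj

end IsSingularSystem

end SingularSystem

section Expansion

theorem hasSum_inner_smul_of_orthonormal {ι H : Type*} [NormedAddCommGroup H]
    [InnerProductSpace ℂ H] [CompleteSpace H] {v : ι → H} (hv : Orthonormal ℂ v) {k : H}
    (hk : ∀ x, (∀ j, inner ℂ (v j) x = 0) → inner ℂ k x = 0) :
    HasSum (fun j => (inner ℂ (v j) k : ℂ) • v j) k := by
  classical
  have hsummable : Summable fun j => (inner ℂ (v j) k : ℂ) • v j :=
    (hv.orthogonalFamily.summable_iff_norm_sq_summable fun j => inner ℂ (v j) k).2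
      (hv.inner_products_summable k)
  obtain ⟨w, hw⟩ := hsummable
  have hvw : ∀ i, inner ℂ (v i) (k - w) = 0 := fun i => by
    have hw' := hw.mapL (innerSL ℂ (v i))
    have hk' : HasSum (fun j => innerSL ℂ (v i) ((inner ℂ (v j) k : ℂ) • v j))
        (inner ℂ (v i) k) := by
      convert hasSum_ite_eq i (inner ℂ (v i) k : ℂ) using 2 with j
      rw [innerSL_apply_apply, inner_smul_right, orthonormal_iff_ite.1 hv]
      rcases eq_or_ne i j with rfl | hij
      · simp
      · simp [hij, hij.symm]
    rw [inner_sub_right, sub_eq_zero]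
    exact hk'.unique hw'
  have hww : inner ℂ w (k - w) = 0 := by
    have hw' := hw.mapL (innerSL ℂ (k - w))
    simp_rw [innerSL_apply_apply, inner_smul_right, inner_eq_zero_symm.1 (hvw _), mul_zero] at hw'
    exact inner_eq_zero_symm.1 (hw'.unique hasSum_zero)
  have hkw : inner ℂ (k - w) (k - w) = 0 := by rw [inner_sub_left, hk _ hvw, hww, sub_zero]
  exact (sub_eq_zero.1 (inner_self_eq_zero.1 hkw)).symm ▸ hw

variable {V₁ V₂ : Type*} [NormedAddCommGroup V₁] [InnerProductSpace ℝ V₁] [FiniteDimensional ℝ V₁]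
  [MeasurableSpace V₁] [BorelSpace V₁]
  [NormedAddCommGroup V₂] [InnerProductSpace ℝ V₂] [FiniteDimensional ℝ V₂]
  [MeasurableSpace V₂] [BorelSpace V₂]

theorem ae_eq_tsum_of_hasSum_toLp {f : ℕ → 𝓢(V₁, ℂ)} {k : Lp ℂ 2 (volume : Measure V₁)}
    (hk : HasSum (fun j => (f j).toLp 2 volume) k) (hf : ∀ y, Summable fun j => f j y) :
    k =ᵐ[volume] fun y => ∑' j, f j y := by
  have hlim : Tendsto (fun n => (∑ j ∈ Finset.range n, f j).toLp 2 volume) atTop (𝓝 k) :=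
    hk.tendsto_sum_nat.congr fun n =>
      (map_sum (toLpCLM ℂ ℂ 2 (volume : Measure V₁)) f (Finset.range n)).symm
  obtain ⟨ns, hns, hae⟩ := (tendstoInMeasure_of_tendsto_Lp hlim).exists_seq_tendsto_ae
  have hcoe : ∀ᵐ y, ∀ n, (∑ j ∈ Finset.range n, f j).toLp 2 volume y =
      (∑ j ∈ Finset.range n, f j) y := ae_all_iff.2 fun n => coeFn_toLp _ 2 volume
  filter_upwards [hae, hcoe] with y hy hcoe_y
  have hpt : Tendsto (fun n => ∑ j ∈ Finset.range n, f j y) atTop (𝓝 (∑' j, f j y)) :=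
    (hf y).hasSum.tendsto_sum_nat
  refine tendsto_nhds_unique hy ((hpt.comp hns.tendsto_atTop).congr fun n => ?_)
  rw [hcoe_y, sum_apply]
  rfl

/-- The singular value expansion of `K (x, ·)` converges in `L²`, and by the bounds `hb` it also
converges uniformly; both sums are continuous, hence equal everywhere. -/
theorem IsSingularSystem.hasSum {K : 𝓢(V₂ × V₁, ℂ)} {v : ℕ → 𝓢(V₁, ℂ)} {u : ℕ → 𝓢(V₂, ℂ)}
    {s : ℕ → ℝ} (h : IsSingularSystem K v u s) (x : V₂) {a : ℕ → ℝ} (ha : Summable a)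
    (hb : ∀ j y, s j * ‖u j x‖ * ‖v j y‖ ≤ a j) (y : V₁) :
    HasSum (fun j => (s j : ℂ) * ((starRingEnd ℂ) (v j y) * u j x)) (K (x, y)) := by
  let f : ℕ → 𝓢(V₁, ℂ) := fun j => (starRingEnd ℂ) ((s j : ℂ) * u j x) • v j
  have hcoef : ∀ j, inner ℂ ((v j).toLp 2 volume) (kernelSlice K x) =
      (starRingEnd ℂ) ((s j : ℂ) * u j x) := fun j => by
    rw [← inner_conj_symm, ← kernelCLM_apply, h.map₁]
    rfl
  have hL2 : HasSum (fun j => (f j).toLp 2 volume) (kernelSlice K x) :=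
    (hasSum_inner_smul_of_orthonormal h.orthonormal₁ (k := kernelSlice K x) fun z hz => by
      rw [← kernelCLM_apply, h.map_eq_zero z hz]; rfl).congr_fun fun j => by rw [hcoef]; rfl
  have hf : ∀ j y, ‖f j y‖ ≤ a j := fun j y => by
    rw [smul_apply, smul_eq_mul, norm_mul, RCLike.norm_conj, norm_mul, Complex.norm_real,
      Real.norm_of_nonneg (h.nonneg j)]
    exact hb j y
  have hsum : ∀ y, Summable fun j => f j y := fun y => .of_norm_bounded ha fun j => hf j y
  have hcont : Continuous fun y => ∑' j, f j y :=
    continuous_tsum (fun j => (f j).continuous) ha hf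
  have hconj : (fun y => (starRingEnd ℂ) (K (x, y))) = fun y => ∑' j, f j y :=
    (Continuous.ae_eq_iff_eq volume (by fun_prop) hcont).1
      ((memLp_conj_kernel K x).coeFn_toLp.symm.trans (ae_eq_tsum_of_hasSum_toLp hL2 hsum))
  have hpt : HasSum (fun j => f j y) ((starRingEnd ℂ) (K (x, y))) :=
    congrFun hconj y ▸ (hsum y).hasSum
  have hK := hpt.map (starRingEnd ℂ) Complex.continuous_conj
  rw [Complex.conj_conj] at hK
  refine hK.congr_fun fun j => ?_
  simp only [f, Function.comp_apply, smul_apply, smul_eq_mul, map_mul, Complex.conj_conj]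
  ring

theorem tendsto_eLpNorm_sub_sum {W : Type*} [NormedAddCommGroup W] [MeasurableSpace W]
    (μ : Measure W) [hμ : μ.HasTemperateGrowth] :
    ∃ m : ℕ, ∀ (K : W → ℂ) (g : ℕ → W → ℂ) (a : ℕ → ℝ), Summable a →
      (∀ j x, (1 + ‖x‖) ^ m * ‖g j x‖ ≤ a j) → (∀ x, HasSum (fun j => g j x) (K x)) →
      Tendsto (fun n : ℕ => eLpNorm (fun x => K x - ∑ j ∈ Finset.range n, g j x) 2 μ)
        atTop (𝓝 0) := by
  obtain ⟨m, hm⟩ := hμ.exists_eLpNorm_lt_top 2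
  refine ⟨m, fun K g a ha hg hK => ?_⟩
  have hbound : ∀ n : ℕ, eLpNorm (fun x => K x - ∑ j ∈ Finset.range n, g j x) 2 μ ≤
      ENNReal.ofReal (∑' j, a (j + n)) *
        eLpNorm (fun x : W => (1 + ‖x‖) ^ (-(m : ℝ))) 2 μ := fun n => by
    refine eLpNorm_le_mul_eLpNorm_of_ae_le_mul (ae_of_all _ fun x => ?_) 2
    have htail : K x - ∑ j ∈ Finset.range n, g j x = ∑' j, g (j + n) x := by
      rw [← (hK x).tsum_eq, ← (hK x).summable.sum_add_tsum_nat_add n, add_sub_cancel_left]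
    have hsum : Summable fun j => a (j + n) / (1 + ‖x‖) ^ m :=
      ((summable_nat_add_iff n).2 ha).div_const _
    have hle : ∀ j, ‖g (j + n) x‖ ≤ a (j + n) / (1 + ‖x‖) ^ m := fun j => by
      rw [le_div_iff₀ (by positivity), mul_comm]
      exact hg _ x
    rw [htail, Real.norm_of_nonneg (by positivity), Real.rpow_neg (by positivity),
      Real.rpow_natCast, ← div_eq_mul_inv, ← tsum_div_const]
    exact tsum_of_norm_bounded hsum.hasSum hle
  have hlim : Tendsto (fun n : ℕ => ENNReal.ofReal (∑' j, a (j + n)) *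
      eLpNorm (fun x : W => (1 + ‖x‖) ^ (-(m : ℝ))) 2 μ) atTop (𝓝 0) := by
    simpa using ENNReal.Tendsto.mul_const (ENNReal.tendsto_ofReal (tendsto_sum_nat_add a))
      (Or.inr hm.ne)
  exact tendsto_of_tendsto_of_tendsto_of_le_of_le tendsto_const_nhds hlim (fun _ => zero_le) hbound

end Expansion

/-! ### Derivatives along lists of vectors -/

section IterDeriv

variable {W : Type*} [NormedAddCommGroup W] [NormedSpace ℝ W]

/-- The iterated directional derivative of `φ` along the vectors of the list `l`, the head of the
list being applied last. -/
noncomputable def iterDeriv (l : List W) (φ : W → ℂ) : W → ℂ :=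
  l.foldr (fun v ψ x => fderiv ℝ ψ x v) φ

theorem iterDeriv_cons (v : W) (l : List W) (φ : W → ℂ) :
    iterDeriv (v :: l) φ = fun x => fderiv ℝ (iterDeriv l φ) x v := rfl

theorem iterDeriv_append (l₁ l₂ : List W) (φ : W → ℂ) :
    iterDeriv (l₁ ++ l₂) φ = iterDeriv l₁ (iterDeriv l₂ φ) := by
  simp [iterDeriv]

theorem contDiff_fderiv_apply {φ : W → ℂ} (hφ : ContDiff ℝ ∞ φ) (v : W) :
    ContDiff ℝ ∞ fun x => fderiv ℝ φ x v :=
  (hφ.fderiv_right (m := ∞) (by simp)).clm_apply contDiff_const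

theorem hasCompactSupport_fderiv_apply {φ : W → ℂ} (hφ : HasCompactSupport φ) (v : W) :
    HasCompactSupport fun x => fderiv ℝ φ x v :=
  (hφ.fderiv ℝ).comp_left (g := fun T : W →L[ℝ] ℂ => T v) rfl

theorem contDiff_iterDeriv {φ : W → ℂ} (hφ : ContDiff ℝ ∞ φ) (l : List W) :
    ContDiff ℝ ∞ (iterDeriv l φ) := by
  induction l with
  | nil => exact hφ
  | cons v l ih => exact contDiff_fderiv_apply ih v

theorem hasCompactSupport_iterDeriv {φ : W → ℂ} (hφ : HasCompactSupport φ) (l : List W) :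
    HasCompactSupport (iterDeriv l φ) := by
  induction l with
  | nil => exact hφ
  | cons v l ih => exact hasCompactSupport_fderiv_apply ih v

theorem fderiv_fderiv_comm {φ : W → ℂ} (hφ : ContDiff ℝ ∞ φ) (v w x : W) :
    fderiv ℝ (fun y => fderiv ℝ φ y v) x w = fderiv ℝ (fun y => fderiv ℝ φ y w) x v := by
  have hd : DifferentiableAt ℝ (fderiv ℝ φ) x :=
    ((hφ.fderiv_right (m := ∞) (by simp)).differentiable (by simp)) x
  rw [fderiv_clm_apply hd (by fun_prop), fderiv_clm_apply hd (by fun_prop)]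
  have hsymm : IsSymmSndFDerivAt ℝ φ x := hφ.contDiffAt.isSymmSndFDerivAt (by
    rw [minSmoothness_of_isRCLikeNormedField]; exact ENat.LEInfty.out)
  simpa using hsymm w v

theorem iterDeriv_perm {φ : W → ℂ} (hφ : ContDiff ℝ ∞ φ) {l₁ l₂ : List W} (h : l₁.Perm l₂) :
    iterDeriv l₁ φ = iterDeriv l₂ φ := by
  induction h with
  | nil => rfl
  | cons v _ ih => rw [iterDeriv_cons, iterDeriv_cons, ih]
  | swap v w l =>
    ext x
    exact fderiv_fderiv_comm (contDiff_iterDeriv hφ l) v w x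
  | trans _ _ ih₁ ih₂ => rw [ih₁, ih₂]

theorem iterDeriv_fderiv_apply {φ : W → ℂ} (hφ : ContDiff ℝ ∞ φ) (v : W) (l : List W) :
    iterDeriv l (fun x => fderiv ℝ φ x v) = iterDeriv (v :: l) φ := by
  rw [iterDeriv_perm hφ (List.perm_append_singleton v l).symm, iterDeriv_append]
  rfl

section IntegrationByParts

variable [FiniteDimensional ℝ W] [MeasurableSpace W] [BorelSpace W] (μ : Measure W)
  [μ.IsAddHaarMeasure] {f φ : W → ℂ}

theorem integral_fderiv_mul (hf : ContDiff ℝ ∞ f) (hφ : ContDiff ℝ ∞ φ) (hc : HasCompactSupport φ)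
    (v : W) : ∫ x, fderiv ℝ f x v * φ x ∂μ = -∫ x, f x * fderiv ℝ φ x v ∂μ := by
  have hint : ∀ g ψ : W → ℂ, ContDiff ℝ ∞ g → ContDiff ℝ ∞ ψ → HasCompactSupport ψ →
      Integrable (fun x => g x * ψ x) μ := fun g ψ hg hψ hψc =>
    (hg.continuous.mul hψ.continuous).integrable_of_hasCompactSupport hψc.mul_left
  rw [integral_mul_fderiv_eq_neg_fderiv_mul_of_integrable
    (hint _ _ (contDiff_fderiv_apply hf v) hφ hc)
    (hint _ _ hf (contDiff_fderiv_apply hφ v) (hasCompactSupport_fderiv_apply hc v))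
    (hint _ _ hf hφ hc) (fun x _ => hf.differentiable (by simp) x)
    (fun x _ => hφ.differentiable (by simp) x), neg_neg]

theorem integral_iterDeriv_mul (hf : ContDiff ℝ ∞ f) (hφ : ContDiff ℝ ∞ φ)
    (hc : HasCompactSupport φ) (l : List W) :
    ∫ x, iterDeriv l f x * φ x ∂μ = (-1) ^ l.length * ∫ x, f x * iterDeriv l φ x ∂μ := by
  induction l generalizing φ with
  | nil => simp [iterDeriv]
  | cons v l ih =>
    rw [iterDeriv_cons, integral_fderiv_mul μ (contDiff_iterDeriv hf l) hφ hc,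
      ih (contDiff_fderiv_apply hφ v) (hasCompactSupport_fderiv_apply hc v),
      iterDeriv_fderiv_apply hφ, List.length_cons]
    ring

end IntegrationByParts

/-- The operator `iterDeriv l` on the Schwartz space. -/
noncomputable def iterDerivCLM (l : List W) : 𝓢(W, ℂ) →L[ℝ] 𝓢(W, ℂ) :=
  l.foldr (fun v T => lineDerivOpCLM ℝ 𝓢(W, ℂ) v ∘L T) (ContinuousLinearMap.id ℝ _)

theorem coe_iterDerivCLM (l : List W) (f : 𝓢(W, ℂ)) :
    (iterDerivCLM l f : W → ℂ) = iterDeriv l f := by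
  induction l with
  | nil => rfl
  | cons v l ih =>
    rw [iterDeriv_cons, ← ih]
    ext x
    exact lineDerivOp_apply_eq_fderiv v (iterDerivCLM l f) x

end IterDeriv

section MultiIndex

variable {d : ℕ}

/-- The list of indices that contains each `i` exactly `β i` times, in increasing order; it
translates between multi-indices and lists of directions. -/
def indexList (β : Fin d → ℕ) : List (Fin d) :=
  (List.finRange d).flatMap fun i => List.replicate (β i) i

theorem length_indexList (β : Fin d → ℕ) : (indexList β).length = ∑ i, β i := by
  simp [indexList, List.length_flatMap, List.sum_ofFn, ← List.ofFn_eq_map]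

theorem count_indexList (β : Fin d → ℕ) (i : Fin d) : (indexList β).count i = β i := by
  simp [indexList, List.count_flatMap, Function.comp_def, List.count_replicate,
    ← List.ofFn_eq_map, List.sum_ofFn]

theorem perm_indexList (l : List (Fin d)) : l.Perm (indexList fun i => l.count i) :=
  List.perm_iff_count.2 fun i => (count_indexList (fun i => l.count i) i).symm

/-- The `i`-th standard basis vector of `ℝ^d`. -/
noncomputable abbrev stdVec (i : Fin d) : E d := EuclideanSpace.single i 1

theorem iterate_partialDeriv (n : ℕ) (i : Fin d) (ψ : E d → ℂ) :
    (partialDeriv i)^[n] ψ = iterDeriv ((List.replicate n i).map stdVec) ψ := by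
  induction n with
  | zero => rfl
  | succ n ih => rw [Function.iterate_succ_apply', ih]; rfl

theorem multiDeriv_eq_iterDeriv (β : Fin d → ℕ) (φ : E d → ℂ) :
    multiDeriv β φ = iterDeriv ((indexList β).map stdVec) φ := by
  rw [multiDeriv, indexList]
  induction List.finRange d with
  | nil => rfl
  | cons i l ih =>
    rw [List.foldr_cons, ih, iterate_partialDeriv, List.flatMap_cons, List.map_append,
      iterDeriv_append]

theorem hasTemperateGrowth_monomial (α : Fin d → ℕ) :
    Function.HasTemperateGrowth (monomial α : E d → ℝ) := by
  suffices h : ∀ t : Finset (Fin d), Function.HasTemperateGrowth fun x : E d => ∏ i ∈ t, x i ^ α i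
    from h Finset.univ
  intro t
  induction t using Finset.cons_induction with
  | empty => simp
  | cons i t hi ih =>
    simp_rw [Finset.prod_cons]
    exact ((EuclideanSpace.proj (𝕜 := ℝ) i).hasTemperateGrowth.pow (α i)).mul ih

theorem hasWeakDeriv_schwartzMap (β : Fin d → ℕ) (f : 𝓢(E d, ℂ)) :
    HasWeakDeriv β f (multiDeriv β f) := by
  rw [multiDeriv_eq_iterDeriv, ← coe_iterDerivCLM]
  refine ⟨f.continuous.locallyIntegrable, SchwartzMap.continuous _ |>.locallyIntegrable,
    fun φ hφ hc => ?_⟩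
  rw [coe_iterDerivCLM, integral_iterDeriv_mul volume (f.smooth ⊤) hφ hc, multiDeriv_eq_iterDeriv,
    List.length_map, length_indexList]

/-- The operator `x^α ∂^β` from the Schwartz space to `L^p`. -/
noncomputable def weightedDerivCLM (p : ℝ≥0∞) [Fact (1 ≤ p)] (α β : Fin d → ℕ) :
    𝓢(E d, ℂ) →L[ℝ] Lp ℂ p (volume : Measure (E d)) :=
  toLpCLM ℝ ℂ p volume ∘L smulLeftCLM ℂ (monomial α) ∘L
    iterDerivCLM ((indexList β).map stdVec)

theorem weightedDerivNorm_le_norm_weightedDerivCLM (p : ℝ≥0∞) [Fact (1 ≤ p)] (α β : Fin d → ℕ)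
    (f : 𝓢(E d, ℂ)) :
    weightedDerivNorm p α β f ≤ ENNReal.ofReal ‖weightedDerivCLM p α β f‖ := by
  refine (iInf₂_le _ (hasWeakDeriv_schwartzMap β f)).trans_eq ?_
  have hcoe : (fun x => (monomial α x : ℂ) * multiDeriv β f x) =
      (smulLeftCLM ℂ (monomial α) (iterDerivCLM ((indexList β).map stdVec) f) : E d → ℂ) := by
    ext x
    rw [smulLeftCLM_apply_apply (hasTemperateGrowth_monomial α), coe_iterDerivCLM,
      multiDeriv_eq_iterDeriv]
    simp
  rw [hcoe]
  change _ = ENNReal.ofReal ‖toLp _ p volume‖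
  rw [norm_toLp, ENNReal.ofReal_toReal (eLpNorm_lt_top _ _ _).ne]
  rfl

theorem exists_weightedDerivNorm_le {p : ℝ≥0∞} (hp : 1 ≤ p) (α β : Fin d → ℕ) :
    ∃ (t : Finset (ℕ × ℕ)) (C : ℝ), 0 ≤ C ∧ ∀ f : 𝓢(E d, ℂ), weightedDerivNorm p α β f ≤
      ENNReal.ofReal (C * ∑ i ∈ t, SchwartzMap.seminorm ℝ i.1 i.2 f) := by
  have : Fact (1 ≤ p) := ⟨hp⟩
  obtain ⟨t, C, -, hC⟩ := Seminorm.bound_of_continuous (schwartz_withSeminorms ℝ (E d) ℂ)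
    ((normSeminorm ℝ (Lp ℂ p (volume : Measure (E d)))).comp (weightedDerivCLM p α β).toLinearMap)
    (continuous_norm.comp (weightedDerivCLM p α β).continuous)
  refine ⟨t, C, C.2, fun f => (weightedDerivNorm_le_norm_weightedDerivCLM p α β f).trans
    (ENNReal.ofReal_le_ofReal ((hC f).trans ?_))⟩
  rw [smul_apply, NNReal.smul_def, smul_eq_mul]
  refine mul_le_mul_of_nonneg_left ?_ C.2
  refine (Seminorm.finset_sup_le_sum _ t f).trans_eq ?_
  rw [sum_apply]
  rfl

theorem natCast_add_one_pow_eq_ofReal (j N : ℕ) :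
    ((j : ℝ≥0∞) + 1) ^ N = ENNReal.ofReal (((j : ℝ) + 1) ^ N) := by
  rw [ENNReal.ofReal_pow (by positivity), ENNReal.ofReal_add (by positivity) zero_le_one,
    ENNReal.ofReal_natCast, ENNReal.ofReal_one]

theorem SchwartzRapidDecay.funBound {p : ℝ≥0∞} (hp : 1 ≤ p) {f : ℕ → 𝓢(E d, ℂ)}
    (hf : SchwartzRapidDecay f) (N : ℕ) : FunBound p N fun j => ⇑(f j) := by
  intro α β
  obtain ⟨t, C, hC0, hC⟩ := exists_weightedDerivNorm_le hp α β
  choose B _ hB using fun i : ℕ × ℕ => (hf i.1 i.2 N).exists_le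
  refine lt_of_le_of_lt (iSup_le fun j => ?_)
    (ENNReal.ofReal_lt_top (r := C * ∑ i ∈ t, B i))
  calc ((j : ℝ≥0∞) + 1) ^ N * weightedDerivNorm p α β (f j)
      ≤ ENNReal.ofReal (((j : ℝ) + 1) ^ N) *
          ENNReal.ofReal (C * ∑ i ∈ t, SchwartzMap.seminorm ℝ i.1 i.2 (f j)) := by
        rw [natCast_add_one_pow_eq_ofReal]
        gcongr
        exact hC _
    _ = ENNReal.ofReal (C * ∑ i ∈ t, ((j : ℝ) + 1) ^ N *
          SchwartzMap.seminorm ℝ i.1 i.2 (f j)) := by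
        rw [← ENNReal.ofReal_mul (by positivity), mul_left_comm, Finset.mul_sum]
    _ ≤ ENNReal.ofReal (C * ∑ i ∈ t, B i) := by
        gcongr with i
        exact hB i j

end MultiIndex

/-! ### The expansion of a Schwartz kernel -/

section DirectTheorem

variable {d : ℕ}

theorem isOG_smul_of_orthonormal {v : ℕ → 𝓢(E d, ℂ)}
    (hv : Orthonormal ℂ fun j => (v j).toLp 2 volume) {c : ℕ → ℂ} (hc : ∀ j, c j ≠ 0) :
    IsOG fun j => (c j • v j).toLp 2 volume := by
  have hsmul : ∀ j, (c j • v j).toLp 2 volume = c j • (v j).toLp 2 volume := fun j =>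
    map_smul (toLpCLM ℂ ℂ 2 (volume : Measure (E d))) (c j) (v j)
  simp_rw [hsmul]
  refine ⟨fun j => smul_ne_zero (hc j) (hv.ne_zero j), fun i j hij => ?_⟩
  rw [inner_smul_left, inner_smul_right, hv.2 hij, mul_zero, mul_zero]

theorem inner_toLp_conjCLM (f g : 𝓢(E d, ℂ)) :
    inner ℂ ((conjCLM (E d) f).toLp 2 volume) ((conjCLM (E d) g).toLp 2 volume) =
      (starRingEnd ℂ) (inner ℂ (f.toLp 2 volume) (g.toLp 2 volume)) := by
  rw [inner_toL2_toL2_eq _ _ volume, inner_toL2_toL2_eq _ _ volume, ← integral_conj]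
  congr 1 with x
  simp [RCLike.inner_apply, conjCLM_apply]

theorem IsOG.conj {f : ℕ → 𝓢(E d, ℂ)} (hf : IsOG fun j => (f j).toLp 2 volume) :
    IsOG fun j => (conjCLM (E d) (f j)).toLp 2 volume := by
  refine ⟨fun j => ?_, fun i j hij => ?_⟩
  · rw [← inner_self_ne_zero (𝕜 := ℂ), inner_toLp_conjCLM, map_ne_zero, inner_self_ne_zero]
    exact hf.1 j
  · rw [inner_toLp_conjCLM, hf.2 i j hij, map_zero]

variable {d₁ d₂ : ℕ}

theorem IsSingularSystem.exists_normalization {K : 𝓢(E d₂ × E d₁, ℂ)} {v : ℕ → 𝓢(E d₁, ℂ)}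
    {u : ℕ → 𝓢(E d₂, ℂ)} {s : ℕ → ℝ} (h : IsSingularSystem K v u s) :
    ∃ lam c e : ℕ → ℝ, (∀ j, 0 ≤ lam j) ∧ (∀ j, 0 < c j) ∧ (∀ j, 0 < e j) ∧ Antitone lam ∧
      (∀ j, lam j * (c j * e j) = s j) ∧ RapidDecay lam ∧
      SchwartzRapidDecay (fun j => (c j : ℂ) • v j) ∧
      SchwartzRapidDecay fun j => (e j : ℂ) • u j := by
  obtain ⟨c, hc0, hc, hcv⟩ := exists_pos_schwartzRapidDecay_smul h.nonneg h.rapidDecay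
    h.orthonormal₁.1 h.exists_norm_toLp_le_div₁
  obtain ⟨e, he0, he, heu⟩ := exists_pos_schwartzRapidDecay_smul h.nonneg h.rapidDecay
    h.orthonormal₂.1 h.exists_norm_toLp_le_div₂
  refine ⟨fun j => s j ^ (1 / 2 : ℝ), c, e, fun j => Real.rpow_nonneg (h.nonneg j) _, hc0, he0,
    fun i j hij => Real.rpow_le_rpow (h.nonneg j) (h.antitone hij) (by norm_num), fun j => ?_,
    h.rapidDecay.rpow h.nonneg (by norm_num), hcv, heu⟩
  rcases (h.nonneg j).eq_or_lt with h0 | hj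
  · simp [← h0]
  · rw [hc j hj, he j hj, ← Real.rpow_add hj, ← Real.rpow_add hj]
    norm_num

theorem forall_pos_or_exists_eq_zero_of_antitone {a : ℕ → ℝ} (ha : Antitone a)
    (h0 : ∀ j, 0 ≤ a j) :
    (∀ j, 0 < a j) ∨ ∃ n, (∀ j, j < n → 0 < a j) ∧ ∀ j, n ≤ j → a j = 0 := by
  classical
  refine or_iff_not_imp_left.2 fun hpos => ?_
  simp only [not_forall, not_lt] at hpos
  exact ⟨Nat.find hpos, fun j hj => not_le.1 (Nat.find_min hpos hj),
    fun j hj => le_antisymm ((ha hj).trans (Nat.find_spec hpos)) (h0 j)⟩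

theorem one_add_norm_prod_le {V W : Type*} [SeminormedAddCommGroup V] [SeminormedAddCommGroup W]
    (x : V × W) : 1 + ‖x‖ ≤ (1 + ‖x.1‖) * (1 + ‖x.2‖) := by
  have h := Prod.norm_def x ▸ max_le_add_of_nonneg (norm_nonneg x.1) (norm_nonneg x.2)
  nlinarith [mul_nonneg (norm_nonneg x.1) (norm_nonneg x.2)]

theorem exists_summable_bound_tensor {lam : ℕ → ℝ} (h0 : ∀ j, 0 ≤ lam j) (hlam : RapidDecay lam)
    {f₁ : ℕ → 𝓢(E d₁, ℂ)} (hf₁ : SchwartzRapidDecay f₁) {f₂ : ℕ → 𝓢(E d₂, ℂ)}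
    (hf₂ : SchwartzRapidDecay f₂) (m : ℕ) :
    ∃ a : ℕ → ℝ, Summable a ∧
      ∀ j x, (1 + ‖x‖) ^ m * ‖(lam j : ℂ) * tensor (f₁ j) (f₂ j) x‖ ≤ a j := by
  obtain ⟨C₁, hC₁0, hC₁⟩ := hf₁.exists_bound m
  obtain ⟨C₂, -, hC₂⟩ := hf₂.exists_bound m
  refine ⟨fun j => lam j * (C₁ * C₂), ((hlam 2).summable one_lt_two h0).mul_right _,
    fun j x => ?_⟩
  have hlam0 := h0 j
  rw [tensor, norm_mul, norm_mul, Complex.norm_real, Real.norm_of_nonneg hlam0]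
  calc (1 + ‖x‖) ^ m * (lam j * (‖f₁ j x.2‖ * ‖f₂ j x.1‖))
      ≤ ((1 + ‖x.1‖) * (1 + ‖x.2‖)) ^ m * (lam j * (‖f₁ j x.2‖ * ‖f₂ j x.1‖)) := by
        gcongr
        exact one_add_norm_prod_le x
    _ = lam j * (((1 + ‖x.2‖) ^ m * ‖f₁ j x.2‖) * ((1 + ‖x.1‖) ^ m * ‖f₂ j x.1‖)) := by
        rw [mul_pow]; ring
    _ ≤ lam j * (C₁ * C₂) := by
        gcongr
        exacts [hC₁ j _, hC₂ j _]

instance : (volume : Measure (E d₂ × E d₁)).IsAddHaarMeasure := by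
  rw [Measure.volume_eq_prod]
  infer_instance

theorem hasStrongExpansion_of_hasSum {K : 𝓢(E d₂ × E d₁, ℂ)} {lam : ℕ → ℝ} (h0 : ∀ j, 0 ≤ lam j)
    (hlam : RapidDecay lam) {f₁ : ℕ → 𝓢(E d₁, ℂ)} (hf₁ : SchwartzRapidDecay f₁)
    {f₂ : ℕ → 𝓢(E d₂, ℂ)} (hf₂ : SchwartzRapidDecay f₂)
    (hK : ∀ x, HasSum (fun j => (lam j : ℂ) * tensor (f₁ j) (f₂ j) x) (K x)) :
    HasStrongExpansion K lam (fun j => ⇑(f₁ j)) fun j => ⇑(f₂ j) := by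
  obtain ⟨m, hm⟩ := tendsto_eLpNorm_sub_sum (volume : Measure (E d₂ × E d₁))
  obtain ⟨a, ha, hle⟩ := exists_summable_bound_tensor h0 hlam hf₁ hf₂ m
  exact ⟨hK, hm K _ a ha hle hK⟩

theorem exists_expansion_of_schwartzMap (hd₁ : 1 ≤ d₁) (hd₂ : 1 ≤ d₂) {p : ℝ≥0∞} (hp : 1 ≤ p)
    (K : 𝓢(E d₂ × E d₁, ℂ)) :
    ∃ (lam : ℕ → ℝ) (f₁ : ℕ → 𝓢(E d₁, ℂ)) (f₂ : ℕ → 𝓢(E d₂, ℂ)),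
      (∀ j, 0 ≤ lam j) ∧
      ((∀ j, 0 < lam j) ∨ ∃ n, (∀ j, j < n → 0 < lam j) ∧ ∀ j, n ≤ j → lam j = 0) ∧
      IsOG (fun j => (f₁ j).toLp 2) ∧ IsOG (fun j => (f₂ j).toLp 2) ∧
      HasStrongExpansion K lam (fun j => ⇑(f₁ j)) (fun j => ⇑(f₂ j)) ∧
      ∀ N : ℕ, CoeffBound N lam ∧ FunBound p N (fun j => ⇑(f₁ j)) ∧
        FunBound p N (fun j => ⇑(f₂ j)) := by
  have : Nonempty (Fin d₁) := ⟨⟨0, hd₁⟩⟩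
  have : Nonempty (Fin d₂) := ⟨⟨0, hd₂⟩⟩
  obtain ⟨v, u, s, h⟩ := exists_isSingularSystem K
  obtain ⟨lam, c, e, hlam0, hc0, he0, hanti, hs, hlam, hcv, heu⟩ := h.exists_normalization
  let f₁ : ℕ → 𝓢(E d₁, ℂ) := fun j => conjCLM (E d₁) ((c j : ℂ) • v j)
  let f₂ : ℕ → 𝓢(E d₂, ℂ) := fun j => (e j : ℂ) • u j
  have hterm : ∀ j x, (lam j : ℂ) * tensor (f₁ j) (f₂ j) x =
      (s j : ℂ) * ((starRingEnd ℂ) (v j x.2) * u j x.1) := fun j x => by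
    rw [← hs j]
    simp only [f₁, f₂, tensor, conjCLM_apply, smul_apply, smul_eq_mul, map_mul,
      Complex.conj_ofReal]
    push_cast
    ring
  obtain ⟨a, ha, hle⟩ := exists_summable_bound_tensor hlam0 hlam hcv.conj heu 0
  have hpoint : ∀ x, HasSum (fun j => (lam j : ℂ) * tensor (f₁ j) (f₂ j) x) (K x) := fun x => by
    simp_rw [hterm]
    refine h.hasSum x.1 ha (fun j y => (le_of_eq ?_).trans (hle j (x.1, y))) x.2
    rw [hterm, pow_zero, one_mul, norm_mul, norm_mul, RCLike.norm_conj, Complex.norm_real,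
      Real.norm_of_nonneg (h.nonneg j), mul_assoc, mul_comm ‖u j x.1‖]
  exact ⟨lam, f₁, f₂, hlam0, forall_pos_or_exists_eq_zero_of_antitone hanti hlam0,
    (isOG_smul_of_orthonormal h.orthonormal₁ fun j => by exact_mod_cast (hc0 j).ne').conj,
    isOG_smul_of_orthonormal h.orthonormal₂ fun j => by exact_mod_cast (he0 j).ne',
    hasStrongExpansion_of_hasSum hlam0 hlam hcv.conj heu hpoint,
    fun N => ⟨hlam N, hcv.conj.funBound hp N, heu.funBound hp N⟩⟩

end DirectTheorem

/-! ### Regularity from bounds on test functions -/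

theorem hasCompactSupport_of_tsupport_subset_closedBall {W : Type*} [PseudoMetricSpace W]
    [ProperSpace W] {φ : W → ℂ} {x : W} {r : ℝ}
    (h : tsupport φ ⊆ Metric.closedBall x r) : HasCompactSupport φ :=
  (isCompact_closedBall x r).of_isClosed_subset (isClosed_tsupport φ) h

theorem norm_sub_le_one_of_rescale_ne_zero {W : Type*} [NormedAddCommGroup W] [NormedSpace ℝ W]
    {φ : W → ℂ} (hs : tsupport φ ⊆ Metric.closedBall 0 1)
    {x z : W} {t : ℝ} (ht0 : 0 < t) (ht1 : t ≤ 1) (hz : φ (t⁻¹ • (z - x)) ≠ 0) :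
    ‖z - x‖ ≤ 1 := by
  have hmem := hs (subset_tsupport φ hz)
  rw [mem_closedBall_zero_iff, norm_smul, norm_inv, Real.norm_of_nonneg ht0.le,
    inv_mul_le_iff₀ ht0, mul_one] at hmem
  exact hmem.trans ht1

theorem one_add_norm_pow_le_of_norm_sub_le_one {W : Type*} [SeminormedAddCommGroup W] {x z : W}
    (h : ‖z - x‖ ≤ 1) (k : ℕ) :
    (1 + ‖x‖) ^ k ≤ 2 ^ k * (1 + ‖z‖) ^ k := by
  have hx := norm_le_norm_add_norm_sub z x
  rw [← mul_pow]
  gcongr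
  linarith [norm_nonneg z]

theorem intervalIntegrable_rpow_of_pos {t : ℝ} (ht0 : 0 < t) (ht1 : t ≤ 1) (a : ℝ) :
    IntervalIntegrable (fun τ : ℝ => τ ^ a) volume t 1 :=
  intervalIntegral.intervalIntegrable_rpow (Or.inr (by
    rw [Set.uIcc_of_le ht1]
    exact fun h => absurd h.1 (not_le.2 ht0)))

theorem integral_rpow_neg_le {a t : ℝ} (ha : a ≠ 1) (ht0 : 0 < t) (ht1 : t ≤ 1) :
    ∫ τ in t..1, τ ^ (-a) ≤ |1 - a|⁻¹ * t ^ (-max (a - 1) 0) := by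
  rw [integral_rpow (Or.inr ⟨by intro h; apply ha; linarith, by
    rw [Set.uIcc_of_le ht1]; exact fun h => absurd h.1 (not_le.2 ht0)⟩), Real.one_rpow,
    show -a + 1 = 1 - a by ring]
  rcases lt_or_gt_of_ne ha with h | h
  · have hpos : 0 < 1 - a := by linarith
    rw [max_eq_right (by linarith), neg_zero, Real.rpow_zero, abs_of_pos hpos, mul_one, ← one_div]
    have : 0 ≤ t ^ (1 - a) := by positivity
    gcongr
    linarith
  · have hpos : 0 < a - 1 := by linarith
    rw [max_eq_left hpos.le, abs_of_neg (by linarith), neg_sub, neg_sub, inv_mul_eq_div,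
      ← neg_div_neg_eq, neg_sub, neg_sub]
    gcongr
    linarith

theorem norm_le_norm_add_of_norm_deriv_le_rpow {f f' : ℝ → ℂ} (hf : ∀ τ, HasDerivAt f (f' τ) τ)
    (hf' : Continuous f') {C a t : ℝ} (hC : 0 ≤ C) (ha : a ≠ 1) (ht0 : 0 < t) (ht1 : t ≤ 1)
    (hle : ∀ τ ∈ Set.Ioc t 1, ‖f' τ‖ ≤ C * τ ^ (-a)) :
    ‖f t‖ ≤ ‖f 1‖ + C * (|1 - a|⁻¹ * t ^ (-max (a - 1) 0)) := by
  have hftc : ∫ τ in t..1, f' τ = f 1 - f t :=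
    intervalIntegral.integral_eq_sub_of_hasDerivAt (fun τ _ => hf τ) (hf'.intervalIntegrable t 1)
  have hdiff := intervalIntegral.norm_integral_le_of_norm_le ht1 (ae_of_all _ hle)
    ((intervalIntegrable_rpow_of_pos ht0 ht1 (-a)).const_mul C)
  rw [hftc, intervalIntegral.integral_const_mul] at hdiff
  calc ‖f t‖ ≤ ‖f 1‖ + ‖f 1 - f t‖ := norm_le_norm_add_norm_sub _ _
    _ ≤ _ := by
      gcongr
      exact hdiff.trans (mul_le_mul_of_nonneg_left (integral_rpow_neg_le ha ht0 ht1) hC)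

section ScaledAverage

variable {W ι : Type*} [NormedAddCommGroup W] [NormedSpace ℝ W] [MeasurableSpace W]
  (μ : Measure W)

/-- The average of `G` near `x` at scale `t`, with the profile `φ`. -/
noncomputable def scaledAverage (G φ : W → ℂ) (x : W) (t : ℝ) : ℂ :=
  ∫ y, G (x + t • y) * φ y ∂μ

/-- `G`, as a functional on test functions, is bounded for the sup norm with weight
`(1 + ‖y‖) ^ (-k)`. -/
def HasDualBound (k : ℕ) (G : W → ℂ) : Prop :=
  ∃ C, 0 ≤ C ∧ ∀ ψ : W → ℂ, ContDiff ℝ ∞ ψ → HasCompactSupport ψ →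
    ∀ M, 0 ≤ M → (∀ y, ‖ψ y‖ ≤ M * (1 + ‖y‖) ^ k) → ‖∫ y, G y * ψ y ∂μ‖ ≤ C * M

/-- The averages of `G` at scale `t` near `x`, for profiles supported in the unit ball, are
`O(t ^ (-a) (1 + ‖x‖) ^ (-k))` as `t → 0`, uniformly in `x`. -/
def HasScaledGrowth (k : ℕ) (a : ℝ) (G : W → ℂ) : Prop :=
  ∀ φ : W → ℂ, ContDiff ℝ ∞ φ → tsupport φ ⊆ Metric.closedBall 0 1 →
    ∃ C, 0 ≤ C ∧ ∀ (x : W) (t : ℝ), 0 < t → t ≤ 1 →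
      (1 + ‖x‖) ^ k * ‖scaledAverage μ G φ x t‖ ≤ C * t ^ (-a)

variable {μ}

theorem HasScaledGrowth.mono {k : ℕ} {a a' : ℝ} {G : W → ℂ} (h : HasScaledGrowth μ k a G)
    (ha : a ≤ a') : HasScaledGrowth μ k a' G := fun φ hφ hs => by
  obtain ⟨C, hC0, hC⟩ := h φ hφ hs
  refine ⟨C, hC0, fun x t ht0 ht1 => (hC x t ht0 ht1).trans ?_⟩
  exact mul_le_mul_of_nonneg_left
    (Real.rpow_le_rpow_of_exponent_ge ht0 ht1 (neg_le_neg ha)) hC0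

section Derivative

variable [BorelSpace W] [IsFiniteMeasureOnCompacts μ] {G φ : W → ℂ}

theorem hasDerivAt_scaledAverage_integral (hG : ContDiff ℝ ∞ G) (hφ : Continuous φ)
    (hc : HasCompactSupport φ) (x : W) (t : ℝ) :
    HasDerivAt (scaledAverage μ G φ x) (∫ y, fderiv ℝ G (x + t • y) y * φ y ∂μ) t := by
  have hG' : Continuous (fderiv ℝ G) := hG.continuous_fderiv (by simp)
  have hGc := hG.continuous
  obtain ⟨C, hC⟩ := ((isCompact_closedBall t 1).prod hc).exists_bound_of_continuousOn
    (f := fun q : ℝ × W => fderiv ℝ G (x + q.1 • q.2)) (by fun_prop)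
  have hbound : ∀ τ ∈ Metric.ball t 1, ∀ y,
      ‖fderiv ℝ G (x + τ • y) y * φ y‖ ≤ C * ‖y‖ * ‖φ y‖ := by
    intro τ hτ y
    by_cases hy : y ∈ tsupport φ
    · rw [norm_mul]
      gcongr
      exact (ContinuousLinearMap.le_opNorm _ _).trans
        (by gcongr; exact hC (τ, y) ⟨Metric.ball_subset_closedBall hτ, hy⟩)
    · simp [image_eq_zero_of_notMem_tsupport hy]
  have hderiv : ∀ y τ, HasDerivAt (fun τ : ℝ => G (x + τ • y) * φ y)
      (fderiv ℝ G (x + τ • y) y * φ y) τ := fun y τ => by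
    have hline : HasDerivAt (fun τ : ℝ => x + τ • y) y τ := by
      simpa using ((hasDerivAt_id τ).smul_const y).const_add x
    exact ((hG.differentiable (by simp) _).hasFDerivAt.comp_hasDerivAt τ hline).mul_const (φ y)
  exact (hasDerivAt_integral_of_dominated_loc_of_deriv_le (μ := μ)
    (bound := fun y => C * ‖y‖ * ‖φ y‖) (Metric.ball_mem_nhds t one_pos)
    (Eventually.of_forall fun τ => Continuous.aestronglyMeasurable (by fun_prop))
    (Continuous.integrable_of_hasCompactSupport (by fun_prop) hc.mul_left)
    (Continuous.aestronglyMeasurable (by fun_prop))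
    (ae_of_all _ fun y τ hτ => hbound τ hτ y)
    (Continuous.integrable_of_hasCompactSupport (by fun_prop) hc.norm.mul_left)
    (ae_of_all _ fun y τ _ => hderiv y τ)).2

variable [FiniteDimensional ℝ W] [Fintype ι] (b : Module.Basis ι ℝ W)

theorem hasDerivAt_scaledAverage (hG : ContDiff ℝ ∞ G) (hφ : Continuous φ)
    (hc : HasCompactSupport φ) (x : W) (t : ℝ) :
    HasDerivAt (scaledAverage μ G φ x)
      (∑ i, scaledAverage μ (fun z => fderiv ℝ G z (b i)) (fun y => (b.coord i y : ℂ) * φ y) x t)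
      t := by
  have hG' : Continuous (fderiv ℝ G) := hG.continuous_fderiv (by simp)
  have hcoord : ∀ i, Continuous fun y => b.coord i y := fun i =>
    LinearMap.continuous_of_finiteDimensional _
  refine (hasDerivAt_scaledAverage_integral hG hφ hc x t).congr_deriv ?_
  simp only [scaledAverage]
  rw [← integral_finsetSum]
  · congr 1 with y
    conv_lhs => rw [← b.sum_repr y, map_sum, b.sum_repr y, Finset.sum_mul]
    refine Finset.sum_congr rfl fun i _ => ?_
    rw [map_smul, Complex.real_smul, Module.Basis.coord_apply]
    ring
  · intro i _
    have := hcoord i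
    exact Continuous.integrable_of_hasCompactSupport (by fun_prop) hc.mul_left.mul_left

end Derivative

/-- Integrating the `t`-derivative of the averages from scale `1` down to `t` gains one power of
`t`. -/
theorem HasScaledGrowth.improve [FiniteDimensional ℝ W] [BorelSpace W]
    [IsFiniteMeasureOnCompacts μ] [Finite ι] (b : Module.Basis ι ℝ W)
    {k : ℕ} {a : ℝ} (ha : a ≠ 1) {G : W → ℂ} (hG : ContDiff ℝ ∞ G) (h : HasScaledGrowth μ k a G)
    (h' : ∀ i, HasScaledGrowth μ k a fun z => fderiv ℝ G z (b i)) :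
    HasScaledGrowth μ k (max (a - 1) 0) G := fun φ hφ hs => by
  have := Fintype.ofFinite ι
  have hcoord : ∀ i, ContDiff ℝ ∞ fun y => ((b.coord i y : ℝ) : ℂ) * φ y := fun i =>
    (Complex.ofRealCLM.contDiff.comp (LinearMap.toContinuousLinearMap (b.coord i)).contDiff).mul hφ
  have hsi : ∀ i, tsupport (fun y => ((b.coord i y : ℝ) : ℂ) * φ y) ⊆ Metric.closedBall 0 1 :=
    fun i => tsupport_mul_subset_right.trans hs
  choose C hC0 hC using fun i => h' i _ (hcoord i) (hsi i)
  obtain ⟨C₁, hC₁0, hC₁⟩ := h φ hφ hs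
  have hsum0 : 0 ≤ ∑ i, C i := Finset.sum_nonneg fun i _ => hC0 i
  refine ⟨C₁ + (∑ i, C i) * |1 - a|⁻¹, by positivity, fun x t ht0 ht1 => ?_⟩
  set w := (1 + ‖x‖) ^ k
  have hw0 : 0 < w := by positivity
  let D : ℝ → ℂ := fun τ => ∑ i, scaledAverage μ (fun z => fderiv ℝ G z (b i))
    (fun y => (b.coord i y : ℂ) * φ y) x τ
  have hDc : Continuous D := continuous_finsetSum _ fun i _ =>
    continuous_iff_continuousAt.2 fun τ =>
    (hasDerivAt_scaledAverage b (contDiff_fderiv_apply hG (b i)) (hcoord i).continuous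
      (hasCompactSupport_of_tsupport_subset_closedBall (hsi i)) x τ).continuousAt
  have hDb : ∀ τ ∈ Set.Ioc t 1, ‖D τ‖ ≤ (∑ i, C i) / w * τ ^ (-a) := fun τ hτ => by
    rw [Finset.sum_div, Finset.sum_mul]
    refine (norm_sum_le _ _).trans (Finset.sum_le_sum fun i _ => ?_)
    rw [div_mul_eq_mul_div, le_div_iff₀ hw0, mul_comm]
    exact hC i x τ (ht0.trans hτ.1) hτ.2
  have hftc := norm_le_norm_add_of_norm_deriv_le_rpow (fun τ => hasDerivAt_scaledAverage b hG
    hφ.continuous (hasCompactSupport_of_tsupport_subset_closedBall hs) x τ) hDc (by positivity) ha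
    ht0 ht1 hDb
  have hone : w * ‖scaledAverage μ G φ x 1‖ ≤ C₁ := by simpa using hC₁ x 1 one_pos le_rfl
  have hpow : 1 ≤ t ^ (-max (a - 1) 0) :=
    Real.one_le_rpow_of_pos_of_le_one_of_nonpos ht0 ht1 (by simp)
  calc w * ‖scaledAverage μ G φ x t‖
      ≤ w * (‖scaledAverage μ G φ x 1‖ +
          (∑ i, C i) / w * (|1 - a|⁻¹ * t ^ (-max (a - 1) 0))) := by gcongr
    _ = w * ‖scaledAverage μ G φ x 1‖ +
          (∑ i, C i) * |1 - a|⁻¹ * t ^ (-max (a - 1) 0) := by field_simp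
    _ ≤ C₁ * t ^ (-max (a - 1) 0) + (∑ i, C i) * |1 - a|⁻¹ * t ^ (-max (a - 1) 0) :=
        add_le_add (hone.trans (le_mul_of_one_le_right hC₁0 hpow)) le_rfl
    _ = _ := by ring

section Haar

variable [FiniteDimensional ℝ W] [BorelSpace W] [μ.IsAddHaarMeasure] {G : W → ℂ} {k : ℕ}

theorem scaledAverage_eq_smul_integral (φ : W → ℂ) (x : W) {t : ℝ} (ht : 0 < t) :
    scaledAverage μ G φ x t =
      (t ^ Module.finrank ℝ W)⁻¹ • ∫ z, G z * φ (t⁻¹ • (z - x)) ∂μ := by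
  rw [← abs_of_pos (inv_pos.2 (pow_pos ht (Module.finrank ℝ W))),
    ← integral_add_left_eq_self (fun z => G z * φ (t⁻¹ • (z - x))) x,
    ← Measure.integral_comp_smul μ (fun w => G (x + w) * φ (t⁻¹ • (x + w - x))) t, scaledAverage]
  congr 1 with y
  simp only [add_sub_cancel_left, smul_smul, inv_mul_cancel₀ ht.ne', one_smul]

theorem HasDualBound.hasScaledGrowth (h : HasDualBound μ k G) :
    HasScaledGrowth μ k (Module.finrank ℝ W) G := fun φ hφ hs => by
  obtain ⟨C, hC0, hC⟩ := h
  obtain ⟨M, hM⟩ := (hasCompactSupport_of_tsupport_subset_closedBall hs).exists_bound_of_continuous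
    hφ.continuous
  have hM0 : 0 ≤ M := (norm_nonneg _).trans (hM 0)
  refine ⟨C * (M * 2 ^ k), by positivity, fun x t ht0 ht1 => ?_⟩
  let ψ : W → ℂ := fun z => φ (t⁻¹ • (z - x))
  have hψ : ContDiff ℝ ∞ ψ := hφ.comp (by fun_prop)
  have hsupp : ∀ z, ψ z ≠ 0 → ‖z - x‖ ≤ 1 := fun z =>
    norm_sub_le_one_of_rescale_ne_zero hs ht0 ht1
  have hψc : HasCompactSupport ψ :=
    HasCompactSupport.intro (isCompact_closedBall x 1) fun z hz => by
      by_contra hne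
      exact hz (by simpa [dist_eq_norm] using hsupp z hne)
  have hx : 0 < (1 + ‖x‖) ^ k := by positivity
  have hdual : ‖∫ z, G z * ψ z ∂μ‖ ≤ C * (M * 2 ^ k / (1 + ‖x‖) ^ k) :=
    hC ψ hψ hψc _ (by positivity) fun z => by
      by_cases hz : ψ z = 0
      · rw [hz, norm_zero]
        positivity
      · rw [div_mul_eq_mul_div, le_div_iff₀ hx, mul_assoc]
        exact mul_le_mul (hM _) (one_add_norm_pow_le_of_norm_sub_le_one (hsupp z hz) k) hx.le hM0
  rw [scaledAverage_eq_smul_integral φ x ht0, norm_smul, Real.norm_of_nonneg (by positivity),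
    Real.rpow_neg ht0.le, Real.rpow_natCast]
  calc (1 + ‖x‖) ^ k * ((t ^ Module.finrank ℝ W)⁻¹ * ‖∫ z, G z * ψ z ∂μ‖)
      ≤ (1 + ‖x‖) ^ k * ((t ^ Module.finrank ℝ W)⁻¹ * (C * (M * 2 ^ k / (1 + ‖x‖) ^ k))) := by
        gcongr
    _ = _ := by field_simp

variable (μ) in
theorem exists_bump : ∃ φ : W → ℂ, ContDiff ℝ ∞ φ ∧ tsupport φ ⊆ Metric.closedBall 0 1 ∧
    ∫ y, φ y ∂μ = 1 := by
  let β : ContDiffBump (0 : W) := ⟨1 / 2, 1, by norm_num, by norm_num⟩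
  refine ⟨fun y => (β.normed μ y : ℂ), Complex.ofRealCLM.contDiff.comp β.contDiff_normed, ?_, ?_⟩
  · refine (tsupport_comp_subset (g := Complex.ofReal) Complex.ofReal_zero (β.normed μ)).trans ?_
    rw [β.tsupport_normed_eq]
  · rw [integral_complex_ofReal, β.integral_normed, Complex.ofReal_one]

theorem HasScaledGrowth.exists_bound (hG : ContDiff ℝ ∞ G) (h : HasScaledGrowth μ k 0 G) :
    ∃ C, ∀ x, (1 + ‖x‖) ^ k * ‖G x‖ ≤ C := by
  obtain ⟨φ, hφ, hs, hint⟩ := exists_bump μ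
  obtain ⟨C, -, hC⟩ := h φ hφ hs
  refine ⟨C, fun x => ?_⟩
  have hzero : scaledAverage μ G φ x 0 = G x := by
    simp only [scaledAverage, zero_smul, add_zero]
    rw [integral_const_mul, hint, mul_one]
  have hlim : Tendsto (scaledAverage μ G φ x) (𝓝[>] 0) (𝓝 (G x)) := by
    rw [← hzero]
    exact (hasDerivAt_scaledAverage_integral hG hφ.continuous
      (hasCompactSupport_of_tsupport_subset_closedBall hs) x 0).continuousAt.tendsto.mono_left
      nhdsWithin_le_nhds
  refine le_of_tendsto (hlim.norm.const_mul _) ?_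
  filter_upwards [Ioc_mem_nhdsGT (zero_lt_one' ℝ)] with t ht
  simpa using hC x t ht.1 ht.2

variable [Finite ι] (b : Module.Basis ι ℝ W)

theorem hasScaledGrowth_zero_of_hasDualBound (hG : ContDiff ℝ ∞ G)
    (h : ∀ l : List ι, HasDualBound μ k (iterDeriv (l.map b) G)) : HasScaledGrowth μ k 0 G := by
  have himp : ∀ a, a ≠ 1 → (∀ l : List ι, HasScaledGrowth μ k a (iterDeriv (l.map b) G)) →
      ∀ l : List ι, HasScaledGrowth μ k (max (a - 1) 0) (iterDeriv (l.map b) G) :=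
    fun a ha hP l => (hP l).improve b ha (contDiff_iterDeriv hG _) fun i => hP (i :: l)
  -- The exponents are kept in `ℕ + 1 / 2`, away from the exponent `1` of logarithmic growth.
  have hdesc : ∀ n : ℕ, (∀ l : List ι, HasScaledGrowth μ k (n + 1 / 2) (iterDeriv (l.map b) G)) →
      ∀ l : List ι, HasScaledGrowth μ k (1 / 2) (iterDeriv (l.map b) G) := by
    intro n
    induction n with
    | zero => intro hP; simpa using hP
    | succ n ih =>
      intro hP
      have : (0 : ℝ) ≤ n := n.cast_nonneg
      have hnext := himp _ (by push_cast; linarith) hP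
      rw [max_eq_left (by push_cast; linarith),
        show ((n + 1 : ℕ) : ℝ) + 1 / 2 - 1 = n + 1 / 2 by push_cast; ring] at hnext
      exact ih hnext
  have hhalf := hdesc (Module.finrank ℝ W) fun l => (h l).hasScaledGrowth.mono (by norm_num)
  have hzero := himp _ (by norm_num) hhalf []
  rwa [max_eq_right (by norm_num)] at hzero

end Haar

end ScaledAverage

section Regularity

variable {W ι : Type*} [NormedAddCommGroup W] [NormedSpace ℝ W] [FiniteDimensional ℝ W]
  [Finite ι] (b : Module.Basis ι ℝ W) {G : W → ℂ}

theorem exists_decay_iteratedFDeriv (hG : ContDiff ℝ ∞ G)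
    (h : ∀ (k : ℕ) (l : List ι), ∃ C, ∀ x, (1 + ‖x‖) ^ k * ‖iterDeriv (l.map b) G x‖ ≤ C)
    (k n : ℕ) (l : List ι) :
    ∃ C, ∀ x, ‖x‖ ^ k * ‖iteratedFDeriv ℝ n (iterDeriv (l.map b) G) x‖ ≤ C := by
  have := Fintype.ofFinite ι
  induction n generalizing l with
  | zero =>
    obtain ⟨C, hC⟩ := h k l
    refine ⟨C, fun x => le_trans ?_ (hC x)⟩
    rw [norm_iteratedFDeriv_zero]
    gcongr
    linarith
  | succ n ih =>
    obtain ⟨C, hC0, hC⟩ := exists_norm_iteratedFDeriv_succ_le (F := ℂ) b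
    choose C' hC' using fun i => ih (i :: l)
    refine ⟨C * ∑ i, C' i, fun x => ?_⟩
    calc ‖x‖ ^ k * ‖iteratedFDeriv ℝ (n + 1) (iterDeriv (l.map b) G) x‖
        ≤ ‖x‖ ^ k * (C * ∑ i, ‖iteratedFDeriv ℝ n (iterDeriv ((i :: l).map b) G) x‖) := by
          gcongr
          exact hC _ (contDiff_iterDeriv hG _) n x
      _ = C * ∑ i, ‖x‖ ^ k * ‖iteratedFDeriv ℝ n (iterDeriv ((i :: l).map b) G) x‖ := by
          rw [mul_left_comm, Finset.mul_sum]
      _ ≤ C * ∑ i, C' i :=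
          mul_le_mul_of_nonneg_left (Finset.sum_le_sum fun i _ => hC' i x) hC0

theorem exists_coe_schwartzMap_eq_of_hasDualBound [MeasurableSpace W] [BorelSpace W]
    {μ : Measure W} [μ.IsAddHaarMeasure] (hG : ContDiff ℝ ∞ G)
    (h : ∀ (k : ℕ) (l : List ι), HasDualBound μ k (iterDeriv (l.map b) G)) :
    ∃ S : 𝓢(W, ℂ), ⇑S = G := by
  have hpoint : ∀ (k : ℕ) (l : List ι),
      ∃ C, ∀ x, (1 + ‖x‖) ^ k * ‖iterDeriv (l.map b) G x‖ ≤ C := fun k l => by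
    have hl := contDiff_iterDeriv hG (l.map b)
    refine (hasScaledGrowth_zero_of_hasDualBound (μ := μ) b hl fun l' => ?_).exists_bound hl
    rw [← iterDeriv_append, ← List.map_append]
    exact h k (l' ++ l)
  exact ⟨⟨G, hG, fun k n => exists_decay_iteratedFDeriv b hG hpoint k n []⟩, rfl⟩

end Regularity

/-! ### Kernels given by an expansion -/

section WeakDerivative

variable {d : ℕ} {β : Fin d → ℕ} {f g g' : E d → ℂ}

theorem HasWeakDeriv.ae_eq (h : HasWeakDeriv β f g) (h' : HasWeakDeriv β f g') :
    g =ᵐ[volume] g' := by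
  refine ae_eq_of_integral_contDiff_smul_eq h.2.1 h'.2.1 fun φ hφ hc => ?_
  have hφ' : ContDiff ℝ ∞ fun x => (φ x : ℂ) := Complex.ofRealCLM.contDiff.comp hφ
  have hc' : HasCompactSupport fun x => (φ x : ℂ) := hc.comp_left (g := Complex.ofReal) rfl
  simpa only [Complex.real_smul, mul_comm] using
    (h.2.2 _ hφ' hc').trans (h'.2.2 _ hφ' hc').symm

theorem HasWeakDeriv.eLpNorm_le (h : HasWeakDeriv β f g) (p : ℝ≥0∞) (α : Fin d → ℕ) :
    eLpNorm (fun x => (monomial α x : ℂ) * g x) p volume ≤ weightedDerivNorm p α β f :=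
  le_iInf₂ fun _ h' => (eLpNorm_congr_ae (by
    filter_upwards [h.ae_eq h'] with x hx
    rw [hx])).le

theorem exists_hasWeakDeriv_of_lt_top {p : ℝ≥0∞} {α : Fin d → ℕ}
    (h : weightedDerivNorm p α β f < ⊤) : ∃ g, HasWeakDeriv β f g := by
  by_contra! hne
  exact h.ne (by simp [weightedDerivNorm, hne])

theorem HasWeakDeriv.integral_mul_iterDeriv {l : List (Fin d)}
    (h : HasWeakDeriv (fun i => l.count i) f g) {φ : E d → ℂ} (hφ : ContDiff ℝ ∞ φ)
    (hc : HasCompactSupport φ) :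
    ∫ x, f x * iterDeriv (l.map stdVec) φ x = (-1) ^ l.length * ∫ x, g x * φ x := by
  rw [h.2.2 φ hφ hc, multiDeriv_eq_iterDeriv, ← length_indexList,
    ← (perm_indexList l).length_eq, ← mul_assoc, ← mul_pow, neg_one_mul, neg_neg, one_pow, one_mul,
    iterDeriv_perm hφ ((perm_indexList l).map stdVec)]

end WeakDerivative

section MonomialWeights

variable {d : ℕ}

/-- The exponents of the monomials `1` (for `none`) and `x_i ^ r` (for `some i`), which together
control the weight `(1 + ‖x‖) ^ r`. -/
def powerExponent (r : ℕ) (o : Option (Fin d)) : Fin d → ℕ :=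
  o.elim 0 fun i => Pi.single i r

theorem abs_monomial_powerExponent (r : ℕ) (o : Option (Fin d)) (x : E d) :
    |monomial (powerExponent r o) x| = (o.elim 1 fun i => |x i|) ^ r := by
  cases o with
  | none => simp [powerExponent, monomial]
  | some i =>
    simp only [powerExponent, monomial, Option.elim_some]
    rw [Finset.prod_eq_single i (fun j _ hj => by simp [hj]) (by simp), Pi.single_eq_same, abs_pow]

theorem one_add_norm_le_sum_option (x : E d) :
    1 + ‖x‖ ≤ ∑ o : Option (Fin d), o.elim 1 fun i => |x i| := by
  rw [Fintype.sum_option]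
  simp only [Option.elim_none, Option.elim_some]
  gcongr
  conv_lhs => rw [← (EuclideanSpace.basisFun (Fin d) ℝ).sum_repr x]
  refine (norm_sum_le _ _).trans (Finset.sum_le_sum fun i _ => ?_)
  rw [norm_smul]
  simp

theorem one_add_norm_pow_le_sum_monomial (r : ℕ) (x : E d) :
    (1 + ‖x‖) ^ (r + 1) ≤ ((d : ℝ) + 1) ^ r *
      ∑ o, |monomial (powerExponent (r + 1) o) x| := by
  have hjensen := pow_sum_div_card_le_sum_pow (s := Finset.univ)
    (f := fun o : Option (Fin d) => o.elim 1 fun i => |x i|)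
    (fun o _ => by cases o <;> simp) r
  rw [Finset.card_univ, Fintype.card_option, Fintype.card_fin,
    div_le_iff₀ (by positivity), mul_comm] at hjensen
  simp_rw [abs_monomial_powerExponent]
  push_cast at hjensen
  exact (pow_le_pow_left₀ (by positivity) (one_add_norm_le_sum_option x) _).trans hjensen

theorem one_add_norm_pow_mul_le_rpow_neg_mul_sum (k m : ℕ) (x : E d) (z : ℂ) :
    (1 + ‖x‖) ^ k * ‖z‖ ≤ ((d : ℝ) + 1) ^ (k + m) * ((1 + ‖x‖) ^ (-m : ℝ) *
      ∑ o, ‖(monomial (powerExponent (k + m + 1) o) x : ℂ) * z‖) := by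
  have hx : 1 ≤ 1 + ‖x‖ := le_add_of_nonneg_right (norm_nonneg x)
  have hle : (1 + ‖x‖) ^ k * (1 + ‖x‖) ^ m ≤
      ((d : ℝ) + 1) ^ (k + m) * ∑ o, |monomial (powerExponent (k + m + 1) o) x| := by
    rw [← pow_add]
    exact (pow_le_pow_right₀ hx (k + m).le_succ).trans (one_add_norm_pow_le_sum_monomial _ x)
  rw [← le_div_iff₀ (by positivity)] at hle
  simp only [norm_mul, Complex.norm_real, Real.norm_eq_abs]
  rw [← Finset.sum_mul, Real.rpow_neg (by positivity), Real.rpow_natCast]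
  calc (1 + ‖x‖) ^ k * ‖z‖ ≤ _ * ‖z‖ := mul_le_mul_of_nonneg_right hle (norm_nonneg z)
    _ = _ := by ring

/-- By Hölder's inequality, as a negative power of `1 + ‖x‖` is in the conjugate `L^q`. -/
theorem exists_eLpNorm_one_le {p : ℝ≥0∞} (hp : 1 ≤ p) (d k : ℕ) :
    ∃ (C : ℝ≥0∞) (r : ℕ), C ≠ ⊤ ∧ ∀ g : E d → ℂ, AEStronglyMeasurable g volume →
      eLpNorm (fun x => (1 + ‖x‖) ^ k * ‖g x‖) 1 volume ≤
        C * ∑ o, eLpNorm (fun x => (monomial (powerExponent r o) x : ℂ) * g x) p volume := by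
  have hconj := ENNReal.HolderConjugate.conjExponent hp
  set q := ENNReal.conjExponent p
  have : ENNReal.HolderTriple q p 1 := hconj.symm
  obtain ⟨m, hm⟩ :=
    (inferInstance : (volume : Measure (E d)).HasTemperateGrowth).exists_eLpNorm_lt_top q
  let c : ℝ := ((d : ℝ) + 1) ^ (k + m)
  let w : E d → ℝ := fun x => (1 + ‖x‖) ^ (-m : ℝ)
  have hw : Continuous w := .rpow_const (by fun_prop) fun x => .inl (by positivity)
  refine ⟨ENNReal.ofReal c * eLpNorm w q volume, k + m + 1,
    ENNReal.mul_ne_top ENNReal.ofReal_ne_top hm.ne, fun g hg => ?_⟩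
  let G : Option (Fin d) → E d → ℝ := fun o x =>
    ‖(monomial (powerExponent (k + m + 1) o) x : ℂ) * g x‖
  have hG : ∀ o, AEStronglyMeasurable (G o) volume := fun o =>
    ((Complex.continuous_ofReal.comp
      (hasTemperateGrowth_monomial _).1.continuous).aestronglyMeasurable.mul hg).norm
  calc eLpNorm (fun x => (1 + ‖x‖) ^ k * ‖g x‖) 1 volume
      ≤ eLpNorm (c • (w • ∑ o, G o)) 1 volume := by
        refine eLpNorm_mono_real fun x => ?_
        rw [Pi.smul_apply, Pi.smul_apply', Finset.sum_apply, Real.norm_of_nonneg (by positivity)]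
        exact one_add_norm_pow_mul_le_rpow_neg_mul_sum k m x (g x)
    _ = ENNReal.ofReal c * eLpNorm (w • ∑ o, G o) 1 volume := by
        rw [eLpNorm_const_smul, Real.enorm_of_nonneg (by positivity)]
    _ ≤ ENNReal.ofReal c * (eLpNorm w q volume * eLpNorm (∑ o, G o) p volume) := by
        gcongr
        exact eLpNorm_smul_le_mul_eLpNorm (Finset.aestronglyMeasurable_sum _ fun o _ => hG o)
          hw.aestronglyMeasurable
    _ ≤ ENNReal.ofReal c * (eLpNorm w q volume * ∑ o, eLpNorm (G o) p volume) := by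
        gcongr
        exact eLpNorm_sum_le (fun o _ => hG o) hp
    _ = _ := by
        rw [mul_assoc]
        simp only [G, eLpNorm_norm]

theorem integral_weight_mul_norm_eq_toReal_eLpNorm {g : E d → ℂ}
    (hg : AEStronglyMeasurable g volume) (k : ℕ) :
    ∫ x, (1 + ‖x‖) ^ k * ‖g x‖ = (eLpNorm (fun x => (1 + ‖x‖) ^ k * ‖g x‖) 1 volume).toReal := by
  have hm : AEStronglyMeasurable (fun x => (1 + ‖x‖) ^ k * ‖g x‖) volume :=
    (Continuous.aestronglyMeasurable (by fun_prop)).mul hg.norm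
  rw [eLpNorm_one_eq_lintegral_enorm, ← integral_norm_eq_lintegral_enorm hm]
  congr 1 with x
  rw [Real.norm_of_nonneg (by positivity)]

theorem FunBound.exists_hasWeakDeriv {p : ℝ≥0∞} (hp : 1 ≤ p) {N : ℕ} {f : ℕ → E d → ℂ}
    (hf : FunBound p N f) (β : Fin d → ℕ) (k : ℕ) :
    ∃ g : ℕ → E d → ℂ, (∀ j, HasWeakDeriv β (f j) (g j)) ∧
      (∀ j, Integrable fun x => (1 + ‖x‖) ^ k * ‖g j x‖) ∧
      CoeffBound N fun j => ∫ x, (1 + ‖x‖) ^ k * ‖g j x‖ := by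
  have hle : ∀ α (j : ℕ), ((j : ℝ≥0∞) + 1) ^ N * weightedDerivNorm p α β (f j) ≤
      ⨆ j : ℕ, ((j : ℝ≥0∞) + 1) ^ N * weightedDerivNorm p α β (f j) := fun α j =>
    le_iSup (fun j : ℕ => ((j : ℝ≥0∞) + 1) ^ N * weightedDerivNorm p α β (f j)) j
  have hone : ∀ j : ℕ, 1 ≤ ((j : ℝ≥0∞) + 1) ^ N := fun j => one_le_pow₀ (by simp)
  choose g hg using fun j => exists_hasWeakDeriv_of_lt_top
    ((le_mul_of_one_le_left' (hone j)).trans_lt ((hle 0 j).trans_lt (hf 0 β)))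
  have hm : ∀ j, AEStronglyMeasurable (g j) volume := fun j => (hg j).2.1.aestronglyMeasurable
  obtain ⟨C, r, hC, hCb⟩ := exists_eLpNorm_one_le hp d k
  let B : ℝ≥0∞ := C * ∑ o : Option (Fin d), ⨆ j : ℕ, ((j : ℝ≥0∞) + 1) ^ N *
    weightedDerivNorm p (powerExponent r o) β (f j)
  have hB : B ≠ ⊤ := ENNReal.mul_ne_top hC
    (ENNReal.sum_ne_top.2 fun o _ => (hf (powerExponent r o) β).ne)
  have hbound : ∀ j : ℕ,
      ((j : ℝ≥0∞) + 1) ^ N * eLpNorm (fun x => (1 + ‖x‖) ^ k * ‖g j x‖) 1 volume ≤ B := fun j => by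
    refine (mul_le_mul_right (hCb _ (hm j)) _).trans ?_
    rw [mul_left_comm, Finset.mul_sum]
    exact mul_le_mul_right (Finset.sum_le_sum fun o _ =>
      (mul_le_mul_right ((hg j).eLpNorm_le p _) _).trans (hle _ j)) C
  refine ⟨g, hg, fun j => memLp_one_iff_integrable.1
    ⟨(Continuous.aestronglyMeasurable (by fun_prop)).mul (hm j).norm,
      (le_mul_of_one_le_left' (hone j)).trans_lt ((hbound j).trans_lt hB.lt_top)⟩,
    .of_le (C := B.toReal) fun j => ?_⟩
  rw [integral_weight_mul_norm_eq_toReal_eLpNorm (hm j),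
    ← ENNReal.toReal_ofReal (r := ((j : ℝ) + 1) ^ N) (by positivity), ← ENNReal.toReal_mul,
    ← natCast_add_one_pow_eq_ofReal]
  exact ENNReal.toReal_mono hB (hbound j)

end MonomialWeights

section Slices

variable {V₁ V₂ : Type*} [NormedAddCommGroup V₁] [NormedSpace ℝ V₁] [NormedAddCommGroup V₂]
  [NormedSpace ℝ V₂]

theorem iterDeriv_comp_add (A : V₁ →L[ℝ] V₂) (w : V₂) {φ : V₂ → ℂ} (hφ : ContDiff ℝ ∞ φ)
    (l : List V₁) :
    iterDeriv l (fun v => φ (w + A v)) = fun v => iterDeriv (l.map A) φ (w + A v) := by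
  induction l with
  | nil => rfl
  | cons u l ih =>
    rw [iterDeriv_cons, ih, List.map_cons, iterDeriv_cons]
    ext v
    have hA : HasFDerivAt (fun v => w + A v) A v := A.hasFDerivAt.const_add w
    have hcomp := ((contDiff_iterDeriv hφ (l.map A)).differentiable (by simp)
      (w + A v)).hasFDerivAt.comp v hA
    exact congrArg (fun T : V₁ →L[ℝ] ℂ => T u) hcomp.fderiv

variable {ψ : V₁ × V₂ → ℂ}

theorem iterDeriv_slice_fst (hψ : ContDiff ℝ ∞ ψ) (l : List V₁) (y : V₂) :
    iterDeriv l (fun x => ψ (x, y)) = fun x => iterDeriv (l.map (·, 0)) ψ (x, y) := by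
  simpa using! iterDeriv_comp_add (ContinuousLinearMap.inl ℝ V₁ V₂) (0, y) hψ l

theorem iterDeriv_slice_snd (hψ : ContDiff ℝ ∞ ψ) (l : List V₂) (x : V₁) :
    iterDeriv l (fun y => ψ (x, y)) = fun y => iterDeriv (l.map (0, ·)) ψ (x, y) := by
  simpa using! iterDeriv_comp_add (ContinuousLinearMap.inr ℝ V₁ V₂) (x, 0) hψ l

theorem hasCompactSupport_slice_fst {X Y : Type*} [TopologicalSpace X]
    [TopologicalSpace Y] [R1Space X] {ψ : X × Y → ℂ} (hc : HasCompactSupport ψ) (y : Y) :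
    HasCompactSupport fun x => ψ (x, y) :=
  HasCompactSupport.intro (hc.image continuous_fst) fun x hx => by
    by_contra hne
    exact hx ⟨(x, y), subset_tsupport ψ hne, rfl⟩

theorem hasCompactSupport_slice_snd {X Y : Type*} [TopologicalSpace X]
    [TopologicalSpace Y] [R1Space Y] {ψ : X × Y → ℂ} (hc : HasCompactSupport ψ) (x : X) :
    HasCompactSupport fun y => ψ (x, y) :=
  HasCompactSupport.intro (hc.image continuous_snd) fun y hy => by
    by_contra hne
    exact hy ⟨(x, y), subset_tsupport ψ hne, rfl⟩

end Slices

section Tensor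

variable {d₁ d₂ : ℕ} {ψ : E d₂ × E d₁ → ℂ}

theorem integrable_tensor_mul {f₁ : E d₁ → ℂ} {f₂ : E d₂ → ℂ} (hf₁ : LocallyIntegrable f₁)
    (hf₂ : LocallyIntegrable f₂) (hψ : Continuous ψ) (hc : HasCompactSupport ψ) :
    Integrable fun x => tensor f₁ f₂ x * ψ x := by
  have hK₁ : IsCompact (Prod.snd '' tsupport ψ) := hc.image continuous_snd
  have hK₂ : IsCompact (Prod.fst '' tsupport ψ) := hc.image continuous_fst
  have hind₁ := (hf₁.integrableOn_isCompact hK₁).integrable_indicator hK₁.measurableSet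
  have hind₂ := (hf₂.integrableOn_isCompact hK₂).integrable_indicator hK₂.measurableSet
  obtain ⟨M, hM⟩ := hc.exists_bound_of_continuous hψ
  rw [Measure.volume_eq_prod]
  refine ((hind₂.mul_prod hind₁).mul_bdd (c := M) hψ.aestronglyMeasurable
    (ae_of_all _ hM)).congr (ae_of_all _ fun x => ?_)
  by_cases hx : x ∈ tsupport ψ
  · simp only [tensor]
    rw [Set.indicator_of_mem (Set.mem_image_of_mem _ hx),
      Set.indicator_of_mem (Set.mem_image_of_mem _ hx), mul_comm (f₁ _)]
  · simp [image_eq_zero_of_notMem_tsupport hx]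

theorem integral_tensor_mul_iterDeriv_snd {l : List (Fin d₁)} {f₁ g₁ : E d₁ → ℂ} {f₂ : E d₂ → ℂ}
    (h₁ : HasWeakDeriv (fun i => l.count i) f₁ g₁) (hf₂ : LocallyIntegrable f₂)
    (hψ : ContDiff ℝ ∞ ψ) (hc : HasCompactSupport ψ) :
    ∫ x, tensor f₁ f₂ x * iterDeriv ((l.map stdVec).map (0, ·)) ψ x =
      (-1) ^ l.length * ∫ x, tensor g₁ f₂ x * ψ x := by
  have hleft := integrable_tensor_mul h₁.1 hf₂
    (contDiff_iterDeriv hψ ((l.map stdVec).map (0, ·))).continuous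
    (hasCompactSupport_iterDeriv hc _)
  have hright := integrable_tensor_mul h₁.2.1 hf₂ hψ.continuous hc
  rw [Measure.volume_eq_prod] at hleft hright ⊢
  rw [integral_prod _ hleft, integral_prod _ hright, ← integral_const_mul]
  congr 1 with x
  have hslice := h₁.integral_mul_iterDeriv (φ := fun y => ψ (x, y)) (hψ.comp (by fun_prop))
    (hasCompactSupport_slice_snd hc x)
  rw [iterDeriv_slice_snd hψ] at hslice
  simp only [tensor]
  simp_rw [mul_comm (f₁ _), mul_comm (g₁ _), mul_assoc]
  rw [integral_const_mul, integral_const_mul, hslice]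
  ring

theorem integral_tensor_mul_iterDeriv_fst {l : List (Fin d₂)} {f₂ g₂ : E d₂ → ℂ} {f₁ : E d₁ → ℂ}
    (h₂ : HasWeakDeriv (fun i => l.count i) f₂ g₂) (hf₁ : LocallyIntegrable f₁)
    (hψ : ContDiff ℝ ∞ ψ) (hc : HasCompactSupport ψ) :
    ∫ x, tensor f₁ f₂ x * iterDeriv ((l.map stdVec).map (·, 0)) ψ x =
      (-1) ^ l.length * ∫ x, tensor f₁ g₂ x * ψ x := by
  have hleft := integrable_tensor_mul hf₁ h₂.1
    (contDiff_iterDeriv hψ ((l.map stdVec).map (·, 0))).continuous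
    (hasCompactSupport_iterDeriv hc _)
  have hright := integrable_tensor_mul hf₁ h₂.2.1 hψ.continuous hc
  rw [Measure.volume_eq_prod] at hleft hright ⊢
  rw [integral_prod_symm _ hleft, integral_prod_symm _ hright, ← integral_const_mul]
  congr 1 with y
  have hslice := h₂.integral_mul_iterDeriv (φ := fun x => ψ (x, y)) (hψ.comp (by fun_prop))
    (hasCompactSupport_slice_fst hc y)
  rw [iterDeriv_slice_fst hψ] at hslice
  simp only [tensor]
  simp_rw [mul_assoc]
  rw [integral_const_mul, integral_const_mul, hslice]
  ring

theorem integral_tensor_mul_iterDeriv {l₁ : List (Fin d₁)} {l₂ : List (Fin d₂)}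
    {f₁ g₁ : E d₁ → ℂ} {f₂ g₂ : E d₂ → ℂ} (h₁ : HasWeakDeriv (fun i => l₁.count i) f₁ g₁)
    (h₂ : HasWeakDeriv (fun i => l₂.count i) f₂ g₂) (hψ : ContDiff ℝ ∞ ψ)
    (hc : HasCompactSupport ψ) :
    ∫ x, tensor f₁ f₂ x *
        iterDeriv ((l₂.map stdVec).map (·, 0) ++ (l₁.map stdVec).map (0, ·)) ψ x =
      (-1) ^ (l₂.length + l₁.length) * ∫ x, tensor g₁ g₂ x * ψ x := by
  rw [iterDeriv_append, integral_tensor_mul_iterDeriv_fst h₂ h₁.1 (contDiff_iterDeriv hψ _)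
    (hasCompactSupport_iterDeriv hc _), integral_tensor_mul_iterDeriv_snd h₁ h₂.2.1 hψ hc,
    pow_add, mul_assoc]

theorem norm_integral_tensor_mul_le {k : ℕ} {g₁ : E d₁ → ℂ} {g₂ : E d₂ → ℂ} {M : ℝ}
    (h₁ : Integrable fun x => (1 + ‖x‖) ^ k * ‖g₁ x‖)
    (h₂ : Integrable fun x => (1 + ‖x‖) ^ k * ‖g₂ x‖) (hψ : ∀ x, ‖ψ x‖ ≤ M * (1 + ‖x‖) ^ k)
    (hM : 0 ≤ M) :
    ‖∫ x, tensor g₁ g₂ x * ψ x‖ ≤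
      M * ((∫ x, (1 + ‖x‖) ^ k * ‖g₂ x‖) * ∫ x, (1 + ‖x‖) ^ k * ‖g₁ x‖) := by
  rw [← integral_prod_mul, ← integral_const_mul, Measure.volume_eq_prod]
  refine norm_integral_le_of_norm_le ((h₂.mul_prod h₁).const_mul M) (ae_of_all _ fun x => ?_)
  calc ‖tensor g₁ g₂ x * ψ x‖ = ‖g₁ x.2‖ * ‖g₂ x.1‖ * ‖ψ x‖ := by rw [norm_mul, tensor, norm_mul]
    _ ≤ ‖g₁ x.2‖ * ‖g₂ x.1‖ * (M * ((1 + ‖x.1‖) * (1 + ‖x.2‖)) ^ k) := by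
        gcongr
        refine (hψ x).trans ?_
        gcongr
        exact one_add_norm_prod_le x
    _ = M * ((1 + ‖x.1‖) ^ k * ‖g₂ x.1‖ * ((1 + ‖x.2‖) ^ k * ‖g₁ x.2‖)) := by
        rw [mul_pow]
        ring

end Tensor

section Converse

variable {d₁ d₂ : ℕ} {p : ℝ≥0∞} {K : E d₂ × E d₁ → ℂ} {lam : ℕ → ℝ} {f₁ : ℕ → E d₁ → ℂ}
  {f₂ : ℕ → E d₂ → ℂ}

/-- The standard basis of `ℝ^{d₂} × ℝ^{d₁}`. -/
noncomputable def prodBasis (d₁ d₂ : ℕ) : Module.Basis (Fin d₂ ⊕ Fin d₁) ℝ (E d₂ × E d₁) :=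
  (EuclideanSpace.basisFun (Fin d₂) ℝ).toBasis.prod (EuclideanSpace.basisFun (Fin d₁) ℝ).toBasis

theorem exists_perm_map_prodBasis (l : List (Fin d₂ ⊕ Fin d₁)) :
    ∃ (l₂ : List (Fin d₂)) (l₁ : List (Fin d₁)),
      (l.map (prodBasis d₁ d₂)).Perm
        ((l₂.map stdVec).map (·, 0) ++ (l₁.map stdVec).map (0, ·)) := by
  induction l with
  | nil => exact ⟨[], [], .refl _⟩
  | cons o l ih =>
    obtain ⟨l₂, l₁, h⟩ := ih
    rcases o with i | i
    · refine ⟨i :: l₂, l₁, ?_⟩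
      simpa [prodBasis, stdVec] using! h.cons (stdVec i, (0 : E d₁))
    · refine ⟨l₂, i :: l₁, ?_⟩
      simpa [prodBasis, stdVec] using! (h.cons _).trans List.perm_middle.symm

theorem hasDualBound_iterDeriv_of_hasExpansion {M N₁ N₂ : ℕ} (hp : 1 ≤ p) (hK : ContDiff ℝ ∞ K)
    (h0 : ∀ j, 0 ≤ lam j) (hexp : HasExpansion K lam f₁ f₂) (hlam : CoeffBound M lam)
    (hf₁ : FunBound p N₁ f₁) (hf₂ : FunBound p N₂ f₂) (hN : 1 < M + (N₂ + N₁)) (k : ℕ)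
    (l₂ : List (Fin d₂)) (l₁ : List (Fin d₁)) :
    HasDualBound volume k
      (iterDeriv ((l₂.map stdVec).map (·, 0) ++ (l₁.map stdVec).map (0, ·)) K) := by
  obtain ⟨g₁, hg₁, hint₁, hb₁⟩ := hf₁.exists_hasWeakDeriv hp (fun i => l₁.count i) k
  obtain ⟨g₂, hg₂, hint₂, hb₂⟩ := hf₂.exists_hasWeakDeriv hp (fun i => l₂.count i) k
  let a₁ : ℕ → ℝ := fun j => ∫ x, (1 + ‖x‖) ^ k * ‖g₁ j x‖
  let a₂ : ℕ → ℝ := fun j => ∫ x, (1 + ‖x‖) ^ k * ‖g₂ j x‖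
  have ha₁ : ∀ j, 0 ≤ a₁ j := fun j => integral_nonneg fun x => by positivity
  have ha₂ : ∀ j, 0 ≤ a₂ j := fun j => integral_nonneg fun x => by positivity
  have hterm : ∀ j, 0 ≤ lam j * (a₂ j * a₁ j) := fun j =>
    mul_nonneg (h0 j) (mul_nonneg (ha₂ j) (ha₁ j))
  have hsum : Summable fun j => lam j * (a₂ j * a₁ j) :=
    (hlam.mul (hb₂.mul hb₁ ha₁) fun j => mul_nonneg (ha₂ j) (ha₁ j)).summable hN hterm
  refine ⟨∑' j, lam j * (a₂ j * a₁ j), tsum_nonneg hterm, fun ψ hψ hc C hC hψC => ?_⟩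
  rw [integral_iterDeriv_mul volume hK hψ hc, norm_mul, norm_pow, norm_neg, norm_one, one_pow,
    one_mul]
  refine le_of_tendsto (hexp _ (contDiff_iterDeriv hψ _) (hasCompactSupport_iterDeriv hc _)).norm
    (.of_forall fun n => ?_)
  calc ‖∑ j ∈ Finset.range n, (lam j : ℂ) * ∫ x, tensor (f₁ j) (f₂ j) x *
          iterDeriv ((l₂.map stdVec).map (·, 0) ++ (l₁.map stdVec).map (0, ·)) ψ x‖
      ≤ ∑ j ∈ Finset.range n, lam j * (C * (a₂ j * a₁ j)) := by
        refine norm_sum_le_of_le _ fun j _ => ?_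
        rw [integral_tensor_mul_iterDeriv (hg₁ j) (hg₂ j) hψ hc, norm_mul, norm_mul, norm_pow,
          norm_neg, norm_one, one_pow, one_mul, Complex.norm_real, Real.norm_of_nonneg (h0 j)]
        exact mul_le_mul_of_nonneg_left
          (norm_integral_tensor_mul_le (hint₁ j) (hint₂ j) hψC hC) (h0 j)
    _ = (∑ j ∈ Finset.range n, lam j * (a₂ j * a₁ j)) * C := by
        rw [Finset.sum_mul]
        exact Finset.sum_congr rfl fun j _ => by ring
    _ ≤ (∑' j, lam j * (a₂ j * a₁ j)) * C :=
        mul_le_mul_of_nonneg_right (hsum.sum_le_tsum _ fun j _ => hterm j) hC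

theorem isSchwartz_of_hasExpansion {M N₁ N₂ : ℕ} (hp : 1 ≤ p) (hK : ContDiff ℝ ∞ K)
    (h0 : ∀ j, 0 ≤ lam j) (hexp : HasExpansion K lam f₁ f₂) (hlam : CoeffBound M lam)
    (hf₁ : FunBound p N₁ f₁) (hf₂ : FunBound p N₂ f₂) (hN : 1 < M + (N₂ + N₁)) :
    IsSchwartz K := by
  refine exists_coe_schwartzMap_eq_of_hasDualBound (μ := volume) (prodBasis d₁ d₂) hK fun k l => ?_
  obtain ⟨l₂, l₁, hl⟩ := exists_perm_map_prodBasis l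
  rw [iterDeriv_perm hK hl]
  exact hasDualBound_iterDeriv_of_hasExpansion hp hK h0 hexp hlam hf₁ hf₂ hN k l₂ l₁

end Converse

end KernelExpansion

open KernelExpansion in
theorem theorem5p1_general (d₁ d₂ : ℕ) (hd₁ : 1 ≤ d₁) (hd₂ : 1 ≤ d₂) (p : ℝ≥0∞) (hp : 1 ≤ p)
    (K : E d₂ × E d₁ → ℂ) :
    (IsSchwartz K →
      ∃ (lam : ℕ → ℝ) (f₁ : ℕ → 𝓢(E d₁, ℂ)) (f₂ : ℕ → 𝓢(E d₂, ℂ)),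
        (∀ j, 0 ≤ lam j) ∧
        ((∀ j, 0 < lam j) ∨ ∃ n, (∀ j, j < n → 0 < lam j) ∧ ∀ j, n ≤ j → lam j = 0) ∧
        IsOG (fun j => (f₁ j).toLp 2) ∧ IsOG (fun j => (f₂ j).toLp 2) ∧
        HasStrongExpansion K lam (fun j => ⇑(f₁ j)) (fun j => ⇑(f₂ j)) ∧
        ∀ N : ℕ, CoeffBound N lam ∧ FunBound p N (fun j => ⇑(f₁ j)) ∧
          FunBound p N (fun j => ⇑(f₂ j))) ∧
    (ContDiff ℝ ∞ K → ∀ M N₁ N₂ : ℕ, 1 < M + (N₂ + N₁) →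
      ∀ (lam : ℕ → ℝ) (f₁ : ℕ → E d₁ → ℂ) (f₂ : ℕ → E d₂ → ℂ), (∀ j, 0 ≤ lam j) →
        HasExpansion K lam f₁ f₂ → CoeffBound M lam → FunBound p N₁ f₁ → FunBound p N₂ f₂ →
        IsSchwartz K) := by
  constructor
  · rintro ⟨S, rfl⟩
    exact exists_expansion_of_schwartzMap hd₁ hd₂ hp S
  · intro hK M N₁ N₂ hN lam f₁ f₂ h0 hexp hlam hf₁ hf₂
    exact isSchwartz_of_hasExpansion hp hK h0 hexp hlam hf₁ hf₂ hN

theorem theorem5p1 (d₁ d₂ : ℕ) (hd₁ : 1 ≤ d₁) (hd₂ : 1 ≤ d₂) (p : ℝ≥0∞) (hp : 1 ≤ p)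
    (K : KernelExpansion.E d₂ × KernelExpansion.E d₁ → ℂ) (hK : ContDiff ℝ ∞ K) :
    (KernelExpansion.IsSchwartz K →
      ∃ (lam : ℕ → ℝ) (f₁ : ℕ → 𝓢(KernelExpansion.E d₁, ℂ)) (f₂ : ℕ → 𝓢(KernelExpansion.E d₂, ℂ)),
        (∀ j, 0 ≤ lam j) ∧
        ((∀ j, 0 < lam j) ∨ ∃ n, (∀ j, j < n → 0 < lam j) ∧ ∀ j, n ≤ j → lam j = 0) ∧
        KernelExpansion.IsOG (fun j => (f₁ j).toLp 2) ∧
        KernelExpansion.IsOG (fun j => (f₂ j).toLp 2) ∧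
        KernelExpansion.HasStrongExpansion K lam (fun j => ⇑(f₁ j)) (fun j => ⇑(f₂ j)) ∧
        ∀ N : ℕ, KernelExpansion.CoeffBound N lam ∧
          KernelExpansion.FunBound p N (fun j => ⇑(f₁ j)) ∧
          KernelExpansion.FunBound p N (fun j => ⇑(f₂ j))) ∧
    (∀ (lam : ℕ → ℝ) (f₁ : ℕ → KernelExpansion.E d₁ → ℂ) (f₂ : ℕ → KernelExpansion.E d₂ → ℂ),
        (∀ j, 0 ≤ lam j) →
        KernelExpansion.HasExpansion K lam f₁ f₂ →
        (∀ N : ℕ, 1 ≤ N → KernelExpansion.CoeffBound N lam ∧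
          KernelExpansion.FunBound p N f₁ ∧ KernelExpansion.FunBound p N f₂) →
        KernelExpansion.IsSchwartz K) := by
  exact theorem5p1_general d₁ d₂ hd₁ hd₂ p hp K |>.imp_right fun h lam f₁ f₂ h0 hexp hb =>
    have hb₁ := hb 1 le_rfl
    h hK 1 1 1 (by norm_num) lam f₁ f₂ h0 hexp hb₁.1 hb₁.2.1 hb₁.2.2
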